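/- Let $M=\mathbb C^n/(\mathbb Z^n+i\mathbb Z^n)$ with coordinates $z=x+iw$, standard complex structure $J$ and flat form $\omega_0=i\sum_a dz^a\wedge d\bar z^a$. Let the torus $\mathbb T=\mathbb R^n/\mathbb Z^n$ act by $t\cdot(x+iw)=x+i(w+t)$. Let $\omega=i\sum g_{a\bar b}\,dz^a\wedge d\bar z^b$ be a $\mathbb T$-invariant Kähler form in the class $[\omega_0]$ (that is, $\omega=\omega_0+i\partial\bar\partial\varphi>0$ with $\varphi$ smooth and real on $M$), and let $\alpha=\sum\alpha_a{}^{\bar b}\,dz^a\otimes\partial_{\bar z^b}$ be a smooth $\mathbb T$-invariant section of $\mathcal A^{1,0}(T^{0,1}M)$ such that the eigenvalues of $\alpha\bar\alpha$ have real part $<1$ at every point (they are real and non-negative when $\alpha$ is compatible with $\omega$). Let $\psi(x)=\tfrac12(1+\sqrt{1-x})^{-1}$. For a diagonalisable matrix $B$ with real eigenvalues and a real function $f$, let $f(B)$ be the corresponding spectral function of $B$. Put $\hat\alpha=\psi(\alpha\bar\alpha)$. The HcscK system for $(\omega,\alpha)$ consists of the compatibility equation $$\omega(J-,\alpha^{\top}-)+\omega(\alpha^{\top}-,J-)=0,$$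 the complex moment map equation $\operatorname{div}(\partial^*\alpha)=0$, and the real moment map equation $2S-2\hat S+\operatorname{div}X=0$. Here all metric quantities are those of $g_{a\bar b}$, $S=-g^{a\bar b}\partial_{\bar b}\Gamma^c_{ca}$ is the scalar curvature, $\hat S$ is its average with respect to $\omega^n$, and $$X=2\operatorname{Re}\bigl(g(\nabla^a\alpha,\bar\alpha\hat\alpha)\,\partial_{z^a}-g(\nabla^{\bar b}\alpha,\bar\alpha\hat\alpha)\,\partial_{\bar z^b}-2\nabla^*(\alpha\bar\alpha\hat\alpha)\bigr).$$ (1) There is a smooth $\mathbb Z^n$-periodic function $h(x)$ such that $f(z)=|z|^2+4h(x)$ is a potential of $\omega$, i.e. $g_{a\bar b}=\partial_{z^a}\partial_{\bar z^b}f$. Let $h$ be any such function, $v(x)=\tfrac12|x|^2+h(x)$, and $u(y)=\sup_x(y\cdot x-v(x))$ the Legendre transform of $v$. Let $\xi(y)$ be the matrix $q_{ab}(x)=\alpha_a{}^{\bar c}(x)\,g_{b\bar c}(x)$ at $x=\partial_yu(y)$. (2) The metric is $g_{a\bar b}=v_{,ab}$. The functions $u,v$ are smooth on $\mathbb R^n$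 and satisfy the Legendre relations: $x=\partial_yu(y)\iff y=\partial_xv(x)$, and then $u(y)+v(x)=y\cdot x$. The matrix $G=D^2u$ is positive definite and $\mathbb Z^n$-periodic, $\xi$ is smooth and $\mathbb Z^n$-periodic, and $\alpha=\xi G$ at corresponding points. (3) $\alpha$ is compatible with $\omega$ if and only if $\xi$ is everywhere symmetric. If it is, then the complex moment map equation is equivalent to $$(\xi^{ab})_{,ab}=0,$$ and the real moment map equation is equivalent to $$\Bigl(-\tfrac12G^{ab}+\bigl(\psi(\xi G\bar\xi G)\,\xi G\bar\xi\bigr)^{ab}\Bigr)_{,ab}=0,$$ which in turn is equivalent to $$\Bigl(\bigl((1-\xi G\bar\xi G)^{1/2}G^{-1}\bigr)^{ab}\Bigr)_{,ab}=0.$$ Here $G^{ab}$ are the entries of $G^{-1}$ and the derivatives are with respect to $y$. (4) Consequently $(\omega,\alpha)$ solves the HcscK system if and only if $\xi$ is symmetric and satisfies the first equation together with the second (equivalently, the third). -/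

import Mathlib

open scoped ContDiff ComplexOrder
open Complex (I)

namespace HcscK

noncomputable section

variable {n : ℕ}

/-! ### Tensors on the torus `ℂⁿ / (ℤⁿ + iℤⁿ)`, in the coordinates `z = x + i w`

The tangent bundle is trivialised by the coordinate fields, so tensors on the torus are
lattice-periodic functions on `ℂⁿ`, with values in vectors or matrices of components. -/

/-- `F` descends to the torus `ℂⁿ / (ℤⁿ + iℤⁿ)`. -/
def LatticePeriodic {E : Type*} (F : (Fin n → ℂ) → E) : Prop :=
  ∀ (z : Fin n → ℂ) (k l : Fin n → ℤ), F (fun a => z a + (k a : ℂ) + I * (l a : ℂ)) = F z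

/-- Invariance under the real torus acting by `t · (x + i w) = x + i (w + t)`; translations act on
components of tensors by translating the argument. -/
def TorusInvariant {E : Type*} (F : (Fin n → ℂ) → E) : Prop :=
  ∀ (z : Fin n → ℂ) (t : Fin n → ℝ), F (fun a => z a + I * (t a : ℂ)) = F z

/-- `∂f/∂zᵃ = (∂f/∂xᵃ - i ∂f/∂wᵃ) / 2`. -/
def dz (a : Fin n) (f : (Fin n → ℂ) → ℂ) (z : Fin n → ℂ) : ℂ :=
  (1 / 2) * (fderiv ℝ f z (Pi.single a 1) - I * fderiv ℝ f z (Pi.single a I))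

/-- `∂f/∂z̄ᵃ = (∂f/∂xᵃ + i ∂f/∂wᵃ) / 2`. -/
def dzbar (a : Fin n) (f : (Fin n → ℂ) → ℂ) (z : Fin n → ℂ) : ℂ :=
  (1 / 2) * (fderiv ℝ f z (Pi.single a 1) + I * fderiv ℝ f z (Pi.single a I))

/-- Entrywise complex conjugate of a matrix (no transpose). -/
def conj (B : Matrix (Fin n) (Fin n) ℂ) : Matrix (Fin n) (Fin n) ℂ :=
  B.map (starRingEnd ℂ)

/-- `g z a b = g_{a b̄}(z)` are the components of a Kähler form `ω = i ∑ g_{a b̄} dzᵃ ∧ dz̄ᵇ` on the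
torus in the Kähler class of `ω₀ = i ∑ dzᵃ ∧ dz̄ᵃ`: it is positive and `ω = ω₀ + i ∂∂̄φ` for a
smooth real function `φ` on the torus. -/
structure IsKahlerFormInClass (g : (Fin n → ℂ) → Matrix (Fin n) (Fin n) ℂ) : Prop where
  posDef : ∀ z, (g z).PosDef
  cohomologous : ∃ φ : (Fin n → ℂ) → ℝ, ContDiff ℝ ∞ φ ∧ LatticePeriodic φ ∧
    ∀ z a b, g z a b =
      (1 : Matrix (Fin n) (Fin n) ℂ) a b + dz a (dzbar b (fun ζ => (φ ζ : ℂ))) z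

/-- `α z a b = α_a^{b̄}(z)` are the components of a smooth section
`α = ∑ α_a^{b̄} dzᵃ ⊗ ∂_{z̄ᵇ}` of `A^{1,0}(T^{0,1}M)`, a first-order deformation of the standard
complex structure. -/
structure IsHiggsTerm (α : (Fin n → ℂ) → Matrix (Fin n) (Fin n) ℂ) : Prop where
  smooth : ∀ a b, ContDiff ℝ ∞ (fun z => α z a b)
  periodic : LatticePeriodic α

/-! ### Spectral functions of matrices -/

/-- The spectral function `f(B) = ∑ᵢ f(δᵢ) ∏_{j ≠ i} (δⱼ - B) / (δⱼ - δᵢ)`, with `δᵢ` the distinct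
eigenvalues of `B`. It is applied to diagonalisable matrices with real eigenvalues. -/
def spectralFun (f : ℝ → ℝ) (B : Matrix (Fin n) (Fin n) ℂ) : Matrix (Fin n) (Fin n) ℂ :=
  Polynomial.aeval B
    (Lagrange.interpolate B.charpoly.roots.toFinset id (fun μ => ((f μ.re : ℝ) : ℂ)))

/-- `ψ(x) = 1 / (2 (1 + √(1 - x)))`. -/
def psi (x : ℝ) : ℝ := (1 / 2) * (1 + Real.sqrt (1 - x))⁻¹

/-! ### Kähler geometry of `g` -/

section Kahler

variable (g α : (Fin n → ℂ) → Matrix (Fin n) (Fin n) ℂ)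

/-- `g^{a b̄}`, determined by `∑_b g^{a b̄} g_{c b̄} = δ^a_c`. -/
def ginv (z : Fin n → ℂ) (a b : Fin n) : ℂ := (g z)⁻¹ b a

/-- The Christoffel symbol `Γ^c_{ab} = g^{c d̄} ∂_{zᵃ} g_{b d̄}`. -/
def christoffel (z : Fin n → ℂ) (c a b : Fin n) : ℂ :=
  ∑ d, ginv g z c d * dz a (fun ζ => g ζ b d) z

/-- The scalar curvature `S = - g^{a b̄} ∂_{z̄ᵇ} Γ^c_{ca}` (a real number). -/
def scalarCurvature (z : Fin n → ℂ) : ℝ :=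
  (-∑ a, ∑ b, ginv g z a b * dzbar b (fun ζ => ∑ c, christoffel g ζ c c a) z).re

/-- A fundamental domain of the lattice `ℤⁿ + iℤⁿ`, up to a null set. -/
def unitCell (n : ℕ) : Set (Fin n → ℂ) :=
  {z | ∀ a, (z a).re ∈ Set.Icc (0 : ℝ) 1 ∧ (z a).im ∈ Set.Icc (0 : ℝ) 1}

/-- The average `Ŝ` of the scalar curvature for the volume form `ωⁿ`, which is a constant multiple
of `det(g_{a b̄})` times Lebesgue measure. -/
def averageScalarCurvature : ℝ :=
  (∫ z in unitCell n, scalarCurvature g z * (g z).det.re) / ∫ z in unitCell n, (g z).det.re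

/-- The divergence `∇_a Xᵃ = ∂_{zᵃ} Xᵃ + Γ^c_{ca} Xᵃ` of the `(1,0)`-vector field `Xᵃ ∂_{zᵃ}`. -/
def divergence10 (X : (Fin n → ℂ) → Fin n → ℂ) (z : Fin n → ℂ) : ℂ :=
  ∑ a, (dz a (fun ζ => X ζ a) z + ∑ c, christoffel g z c c a * X z a)

/-- The divergence `∇_{b̄} Y^{b̄}` of the `(0,1)`-vector field `Y^{b̄} ∂_{z̄ᵇ}`. -/
def divergence01 (Y : (Fin n → ℂ) → Fin n → ℂ) (z : Fin n → ℂ) : ℂ :=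
  ∑ b, (dzbar b (fun ζ => Y ζ b) z + ∑ c, starRingEnd ℂ (christoffel g z c c b) * Y z b)

/-- `(∇_c α)_a^{b̄} = ∂_{zᶜ} α_a^{b̄} - Γ^d_{ca} α_d^{b̄}`. -/
def nablaZ (z : Fin n → ℂ) (c : Fin n) : Matrix (Fin n) (Fin n) ℂ :=
  Matrix.of fun a b => dz c (fun ζ => α ζ a b) z - ∑ d, christoffel g z d c a * α z d b

/-- `(∇_{c̄} α)_a^{b̄} = ∂_{z̄ᶜ} α_a^{b̄} + Γ^{b̄}_{c̄ d̄} α_a^{d̄}`. -/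
def nablaZbar (z : Fin n → ℂ) (c : Fin n) : Matrix (Fin n) (Fin n) ℂ :=
  Matrix.of fun a b =>
    dzbar c (fun ζ => α ζ a b) z + ∑ d, starRingEnd ℂ (christoffel g z b c d) * α z a d

/-- `∇ᵃα = g^{a b̄} ∇_{b̄} α`. -/
def nablaUp (z : Fin n → ℂ) (a : Fin n) : Matrix (Fin n) (Fin n) ℂ :=
  ∑ b, ginv g z a b • nablaZbar g α z b

/-- `∇^{b̄}α = g^{a b̄} ∇_a α`. -/
def nablaUpBar (z : Fin n → ℂ) (b : Fin n) : Matrix (Fin n) (Fin n) ℂ :=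
  ∑ a, ginv g z a b • nablaZ g α z a

/-- The metric pairing `g(P, Q) = g^{c ē} g_{f d̄} P_c^{d̄} Q_{ē}^f` of `P = P_c^{d̄} dzᶜ ⊗ ∂_{z̄ᵈ}`
with `Q = Q_{ē}^f dz̄ᵉ ⊗ ∂_{zᶠ}`. -/
def pairing (z : Fin n → ℂ) (P Q : Matrix (Fin n) (Fin n) ℂ) : ℂ :=
  ∑ c, ∑ d, ∑ e, ∑ f, ginv g z c e * g z f d * P c d * Q e f

/-- `(∂^*α)^{b̄} = - g^{a c̄} ∇_{c̄} α_a^{b̄}`. -/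
def delStar (z : Fin n → ℂ) (b : Fin n) : ℂ :=
  -∑ a, ∑ c, ginv g z a c * nablaZbar g α z c a b

/-- `(∇^*Q)ᶜ = - g^{a d̄} ∇_{d̄} Q_a^c` for `Q = Q_a^c dzᵃ ⊗ ∂_{zᶜ}`; there are no Christoffel
symbols in `∇_{d̄} Q_a^c = ∂_{z̄ᵈ} Q_a^c`. -/
def nablaStar (Q : (Fin n → ℂ) → Matrix (Fin n) (Fin n) ℂ) (z : Fin n → ℂ) (c : Fin n) : ℂ :=
  -∑ a, ∑ d, ginv g z a d * dzbar d (fun ζ => Q ζ a c) z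

/-- `α̂ = ψ(α ᾱ)`. -/
def alphaHat (z : Fin n → ℂ) : Matrix (Fin n) (Fin n) ℂ :=
  spectralFun psi (α z * conj (α z))

/-- The `(1,0)`-part of the real vector field
`X = 2 Re (g(∇ᵃα, ᾱα̂) ∂_{zᵃ} - g(∇^{b̄}α, ᾱα̂) ∂_{z̄ᵇ} - 2 ∇^*(αᾱα̂))`.
(For `V = V^{1,0} + V^{0,1}`, the `(1,0)`-part of `2 Re V = V + V̄` is `V^{1,0}` plus the conjugate
of `V^{0,1}`.) -/
def vectorFieldX (z : Fin n → ℂ) (a : Fin n) : ℂ :=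
  (pairing g z (nablaUp g α z a) (conj (α z) * alphaHat α z)
      - 2 * nablaStar g (fun ζ => α ζ * conj (α ζ) * alphaHat α ζ) z a)
    + starRingEnd ℂ (-pairing g z (nablaUpBar g α z a) (conj (α z) * alphaHat α z))

/-! ### The HcscK system -/

/-- A complexified tangent vector `∑ pᵃ ∂_{zᵃ} + ∑ rᵃ ∂_{z̄ᵃ}` is the pair `(p, r)`; the form `ω`
is extended complex-bilinearly. -/
def omega (z : Fin n → ℂ) (X Y : (Fin n → ℂ) × (Fin n → ℂ)) : ℂ :=
  I * ∑ a, ∑ b, g z a b * (X.1 a * Y.2 b - Y.1 a * X.2 b)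

/-- The standard complex structure on complexified tangent vectors. -/
def stdJ (X : (Fin n → ℂ) × (Fin n → ℂ)) : (Fin n → ℂ) × (Fin n → ℂ) :=
  (I • X.1, -(I • X.2))

/-- `αᵀ` as an endomorphism of the complexified tangent space. -/
def alphaT (z : Fin n → ℂ) (X : (Fin n → ℂ) × (Fin n → ℂ)) : (Fin n → ℂ) × (Fin n → ℂ) :=
  (0, fun b => ∑ a, X.1 a * α z a b)

/-- The compatibility equation `ω(J-, αᵀ-) + ω(αᵀ-, J-) = 0`. -/
def Compatible : Prop :=
  ∀ z X Y, omega g z (stdJ X) (alphaT α z Y) + omega g z (alphaT α z X) (stdJ Y) = 0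

/-- The complex moment map `div(∂^*α)`. -/
def complexMomentMap (z : Fin n → ℂ) : ℂ := divergence01 g (delStar g α) z

/-- The real moment map `2 S - 2 Ŝ + div X`; the divergence of the real vector field `X` is twice
the real part of the divergence of its `(1,0)`-part. -/
def realMomentMap (z : Fin n → ℂ) : ℝ :=
  2 * scalarCurvature g z - 2 * averageScalarCurvature g
    + 2 * (divergence10 g (vectorFieldX g α) z).re

/-- The HcscK system for `(ω, α)`. -/
structure HcscKSystem : Prop where
  compatible : Compatible g α
  complexEq : ∀ z, complexMomentMap g α z = 0
  realEq : ∀ z, realMomentMap g α z = 0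

/-- The components `q_{ab} = α_a^{c̄} g_{b c̄}` of the quadratic differential of `α` and `ω`. -/
def quadraticDifferential (z : Fin n → ℂ) : Matrix (Fin n) (Fin n) ℂ :=
  Matrix.of fun a b => ∑ c, α z a c * g z b c

end Kahler

/-! ### Symplectic coordinates -/

/-- `ℤⁿ`-periodicity of a function on `ℝⁿ`. -/
def IntPeriodic {E : Type*} (F : (Fin n → ℝ) → E) : Prop :=
  ∀ (x : Fin n → ℝ) (k : Fin n → ℤ), F (fun a => x a + (k a : ℝ)) = F x

/-- The partial derivative `∂F/∂xᵃ` on `ℝⁿ`. -/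
def pd {E : Type*} [NormedAddCommGroup E] [NormedSpace ℝ E] (a : Fin n)
    (F : (Fin n → ℝ) → E) (x : Fin n → ℝ) : E :=
  fderiv ℝ F x (Pi.single a 1)

/-- The gradient `(∂F/∂x¹, …, ∂F/∂xⁿ)`. -/
def grad (F : (Fin n → ℝ) → ℝ) (x : Fin n → ℝ) : Fin n → ℝ := fun a => pd a F x

/-- The Hessian matrix. -/
def hess (F : (Fin n → ℝ) → ℝ) (x : Fin n → ℝ) : Matrix (Fin n) (Fin n) ℝ :=
  Matrix.of fun a b => pd a (pd b F) x

/-- The point `x + i 0` of `ℂⁿ`. -/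
def realPoint (x : Fin n → ℝ) : Fin n → ℂ := fun a => (x a : ℂ)

/-- The coordinates `x` of `z = x + i w`. -/
def rePart (z : Fin n → ℂ) : Fin n → ℝ := fun a => (z a).re

/-- The local potential `f(z) = |z|² + 4 h(x)`. -/
def localPotential (h : (Fin n → ℝ) → ℝ) (z : Fin n → ℂ) : ℝ :=
  ∑ a, ‖z a‖ ^ 2 + 4 * h (rePart z)

/-- `h` is a smooth `ℤⁿ`-periodic function such that `f(z) = |z|² + 4 h(x)` is a potential of the
Kähler form, i.e. `g_{a b̄} = ∂_{zᵃ} ∂_{z̄ᵇ} f`. -/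
structure IsInvariantPotential (g : (Fin n → ℂ) → Matrix (Fin n) (Fin n) ℂ)
    (h : (Fin n → ℝ) → ℝ) : Prop where
  smooth : ContDiff ℝ ∞ h
  periodic : IntPeriodic h
  potential : ∀ z a b, g z a b = dz a (dzbar b (fun ζ => (localPotential h ζ : ℂ))) z

/-- `v(x) = |x|²/2 + h(x)`. -/
def convexPotential (h : (Fin n → ℝ) → ℝ) (x : Fin n → ℝ) : ℝ :=
  (1 / 2) * ∑ a, x a ^ 2 + h x

/-- The Legendre transform `u(y) = sup_x (y · x - v(x))`. -/
def legendre (v : (Fin n → ℝ) → ℝ) (y : Fin n → ℝ) : ℝ :=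
  ⨆ x : Fin n → ℝ, (∑ a, y a * x a - v x)

/-- `u` and `v` are smooth and Legendre dual on all of `ℝⁿ`: the relations `x = ∂u(y)` and
`y = ∂v(x)` are equivalent, and they imply `u(y) + v(x) = y · x`. -/
structure LegendreDual (u v : (Fin n → ℝ) → ℝ) : Prop where
  smooth_left : ContDiff ℝ ∞ u
  smooth_right : ContDiff ℝ ∞ v
  grad_iff : ∀ x y, x = grad u y ↔ y = grad v x
  add_eq : ∀ x y, y = grad v x → u y + v x = ∑ a, y a * x a

/-- The symmetric tensor `ξ`: the matrix `q(x)` in the coordinate `y`, where `x = ∂u(y)`. -/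
def xi (g α : (Fin n → ℂ) → Matrix (Fin n) (Fin n) ℂ) (u : (Fin n → ℝ) → ℝ)
    (y : Fin n → ℝ) : Matrix (Fin n) (Fin n) ℂ :=
  quadraticDifferential g α (realPoint (grad u y))

/-- `G = D²u`, as a complex matrix. -/
def hessC (u : (Fin n → ℝ) → ℝ) (y : Fin n → ℝ) : Matrix (Fin n) (Fin n) ℂ :=
  (hess u y).map (fun r : ℝ => (r : ℂ))

/-- `(N^{ab})_{,ab}`. -/
def doubleDiv (N : (Fin n → ℝ) → Matrix (Fin n) (Fin n) ℂ) (y : Fin n → ℝ) : ℂ :=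
  ∑ a, ∑ b, pd a (pd b (fun η => N η a b)) y

section Symplectic

variable (u : (Fin n → ℝ) → ℝ) (ξ : (Fin n → ℝ) → Matrix (Fin n) (Fin n) ℂ)

/-- The matrix `ξ G ξ̄ G`. -/
def xiSq (y : Fin n → ℝ) : Matrix (Fin n) (Fin n) ℂ :=
  ξ y * hessC u y * conj (ξ y) * hessC u y

/-- `(ξ^{ab})_{,ab} = 0`. -/
def ComplexEquation : Prop := ∀ y, doubleDiv ξ y = 0

/-- `(-½ G^{ab} + (ψ(ξGξ̄G) ξ G ξ̄)^{ab})_{,ab} = 0`. -/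
def RealEquation : Prop :=
  ∀ y, doubleDiv (fun η => -(1 / 2 : ℂ) • (hessC u η)⁻¹
    + spectralFun psi (xiSq u ξ η) * ξ η * hessC u η * conj (ξ η)) y = 0

/-- `((1 - ξGξ̄G)^{1/2} G⁻¹)^{ab}_{,ab} = 0`. -/
def AbreuEquation : Prop :=
  ∀ y, doubleDiv (fun η => spectralFun Real.sqrt (1 - xiSq u ξ η) * (hessC u η)⁻¹) y = 0

end Symplectic

end

end HcscK

open HcscK

namespace HcscK

noncomputable section

variable {n : ℕ}

/-! ### Partial derivatives of functions on `ℝⁿ` -/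

/-! Torus invariance removes the imaginary coordinates: on functions of x = Re z, both ∂_z and ∂_z̄
are half of ∂_x. The potential φ is itself invariant, because its difference with an imaginary
translate is pluriharmonic on a compact torus, hence constant, and the constant vanishes by looking
at a maximum and a minimum of φ (`torusInvariant_of_ddbar`). So the metric is a real Hessian W = D²v
and α = A(x).

Since v is strictly convex and a periodic perturbation of |x|²/2, ∂v is a diffeomorphism of ℝⁿ
commuting with integer translations; its inverse is ∂u, and D²u = W⁻¹ (`legendre_properties`). Hence
∂/∂y becomes the operator `dy` in x. The curvature computations rest on `sum_dy_metric_mul`: up to a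
factor ½, the divergence of a field is the flat y-divergence of the covector obtained by lowering
its index. In the same way, the z̄-covariant derivative of α is the plain derivative of q = AW with
the index raised again. This gives Abreu's formula for S, and the complex moment map equals -¼
(ξ^{ab})_{,ab}.

For the real equation put G = W⁻¹ and B = αᾱ = qGq̄G. If q is symmetric then GB is Hermitian, so B
is diagonalisable with real eigenvalues, and Ψ = ψ(B) is a real polynomial in B. The resulting
commutation rules of Ψ with q and G make the pairing terms of X supply exactly the term missing from
a product rule (`SpectralRelations.re_trace`). Thus 2S + div X is the real part of (N^{ab})_{,ab}
with N = -½W + ΨqGq̄. The matrix N is Hermitian, so this double divergence is already real; and Ŝ =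
0, since S det W is the divergence of a periodic field by the Piola identity. Finally tψ(t) = ½(1 -
√(1-t)) turns N into -½ √(1-B) W, which is the last form of the equation.

Differentiating Ψ requires smoothness even where eigenvalues of B collide. It follows from ψ(B) =
½(1 + √(1-B))⁻¹ and the inverse function theorem for S ↦ S² (`MatSmooth.spectralFun_sqrt`). -/

theorem pd_add {a : Fin n} {F H : (Fin n → ℝ) → ℂ} {x : Fin n → ℝ}
    (hF : DifferentiableAt ℝ F x) (hH : DifferentiableAt ℝ H x) :
    pd a (fun x => F x + H x) x = pd a F x + pd a H x := by
  unfold pd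
  rw [fderiv_fun_add hF hH]
  rfl

theorem pd_mul {a : Fin n} {F H : (Fin n → ℝ) → ℂ} {x : Fin n → ℝ}
    (hF : DifferentiableAt ℝ F x) (hH : DifferentiableAt ℝ H x) :
    pd a (fun x => F x * H x) x = pd a F x * H x + F x * pd a H x := by
  unfold pd
  rw [fderiv_fun_mul hF hH]
  simp
  ring

theorem pd_sum {ι : Type*} {s : Finset ι} {a : Fin n} {F : ι → (Fin n → ℝ) → ℂ} {x : Fin n → ℝ}
    (hF : ∀ i ∈ s, DifferentiableAt ℝ (F i) x) :
    pd a (fun x => ∑ i ∈ s, F i x) x = ∑ i ∈ s, pd a (F i) x := by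
  unfold pd
  rw [fderiv_fun_sum hF]
  simp

theorem pd_const_mul (a : Fin n) (c : ℂ) (F : (Fin n → ℝ) → ℂ) (x : Fin n → ℝ) :
    pd a (fun x => c * F x) x = c * pd a F x := by
  have := congrFun (fderiv_const_smul_field (𝕜 := ℝ) (f := F) c) x
  unfold pd
  have h2 : (fun x => c * F x) = c • F := rfl
  rw [h2, this]
  simp

theorem pd_const (a : Fin n) (c : ℂ) (x : Fin n → ℝ) :
    pd a (fun _ => c) x = 0 := by
  simp [pd]

theorem pd_conj (a : Fin n) (F : (Fin n → ℝ) → ℂ) (x : Fin n → ℝ) :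
    pd a (fun x => starRingEnd ℂ (F x)) x = starRingEnd ℂ (pd a F x) := by
  unfold pd
  have := Complex.conjLIE.toContinuousLinearEquiv.comp_fderiv (f := F) (x := x)
  have h2 : (fun x => starRingEnd ℂ (F x)) = Complex.conjLIE.toContinuousLinearEquiv ∘ F := rfl
  rw [h2, this]
  simp

theorem pd_ofReal {a : Fin n} {F : (Fin n → ℝ) → ℝ} {x : Fin n → ℝ}
    (hF : DifferentiableAt ℝ F x) :
    pd a (fun x => (F x : ℂ)) x = ((pd a F x : ℝ) : ℂ) := by
  unfold pd
  have := (Complex.ofRealCLM.hasFDerivAt (x := F x)).comp x hF.hasFDerivAt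
  have h2 : (fun x => (F x : ℂ)) = Complex.ofRealCLM ∘ F := rfl
  rw [h2, this.fderiv]
  simp

theorem ContDiff.pd {E : Type*} [NormedAddCommGroup E] [NormedSpace ℝ E]
    {F : (Fin n → ℝ) → E} (hF : ContDiff ℝ ∞ F) (a : Fin n) :
    ContDiff ℝ ∞ (HcscK.pd a F) := by
  unfold HcscK.pd
  exact (hF.fderiv_right (m := ∞) (by simp)).clm_apply contDiff_const

theorem pd_comm {E : Type*} [NormedAddCommGroup E] [NormedSpace ℝ E]
    {F : (Fin n → ℝ) → E} (hF : ContDiff ℝ ∞ F) (a b : Fin n) (x : Fin n → ℝ) :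
    pd a (pd b F) x = pd b (pd a F) x := by
  have h1 : ContDiff ℝ ∞ (fderiv ℝ F) := hF.fderiv_right (m := ∞) (by simp)
  have h2 : DifferentiableAt ℝ (fderiv ℝ F) x := h1.differentiable (by simp) x
  have hs : IsSymmSndFDerivAt ℝ F x :=
    hF.contDiffAt.isSymmSndFDerivAt (by
      rw [minSmoothness_of_isRCLikeNormedField]
      exact WithTop.coe_le_coe.2 (le_top : (2 : ℕ∞) ≤ ⊤))
  have key : ∀ c d : Fin n, HcscK.pd c (HcscK.pd d F) x =
      fderiv ℝ (fderiv ℝ F) x (Pi.single c 1) (Pi.single d 1) := by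
    intro c d
    have : HcscK.pd d F = fun y => fderiv ℝ F y (Pi.single d 1) := rfl
    rw [this]
    unfold HcscK.pd
    rw [fderiv_clm_apply h2 (differentiableAt_const _)]
    simp
  rw [key, key]
  exact hs _ _

theorem fderiv_eq_sum_pd {E : Type*} [NormedAddCommGroup E] [NormedSpace ℝ E]
    (F : (Fin n → ℝ) → E) (x d : Fin n → ℝ) :
    fderiv ℝ F x d = ∑ a, d a • pd a F x := by
  unfold pd
  conv_lhs => rw [← Finset.univ_sum_single d]
  rw [map_sum]
  refine Finset.sum_congr rfl fun a _ => ?_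
  rw [← map_smul, ← Pi.single_smul]
  simp

/-! ### Smooth matrix-valued functions -/

/-- All entries of `M` are smooth. -/
def MatSmooth (M : (Fin n → ℝ) → Matrix (Fin n) (Fin n) ℂ) : Prop :=
  ∀ a b, ContDiff ℝ ∞ (fun x => M x a b)

/-- The entrywise partial derivative. -/
def mpd (a : Fin n) (M : (Fin n → ℝ) → Matrix (Fin n) (Fin n) ℂ) (x : Fin n → ℝ) :
    Matrix (Fin n) (Fin n) ℂ :=
  Matrix.of fun i j => pd a (fun x => M x i j) x

theorem mpd_apply (a : Fin n) (M : (Fin n → ℝ) → Matrix (Fin n) (Fin n) ℂ) (x : Fin n → ℝ)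
    (i j : Fin n) : mpd a M x i j = pd a (fun x => M x i j) x := rfl

theorem _root_.ContDiff.diffAt {F : (Fin n → ℝ) → ℂ} (hF : ContDiff ℝ ∞ F) (x : Fin n → ℝ) :
    DifferentiableAt ℝ F x := hF.differentiable (by simp) x

namespace MatSmooth

variable {M N : (Fin n → ℝ) → Matrix (Fin n) (Fin n) ℂ}

theorem mul (hM : MatSmooth M) (hN : MatSmooth N) : MatSmooth (fun x => M x * N x) := by
  intro a b
  simp only [Matrix.mul_apply]
  exact ContDiff.sum fun c _ => (hM a c).mul (hN c b)

theorem add (hM : MatSmooth M) (hN : MatSmooth N) : MatSmooth (fun x => M x + N x) :=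
  fun a b => (hM a b).add (hN a b)

theorem sub (hM : MatSmooth M) (hN : MatSmooth N) : MatSmooth (fun x => M x - N x) :=
  fun a b => (hM a b).sub (hN a b)

theorem smul (c : ℂ) (hM : MatSmooth M) : MatSmooth (fun x => c • M x) :=
  fun a b => contDiff_const.mul (hM a b)

theorem const (C : Matrix (Fin n) (Fin n) ℂ) : MatSmooth (fun _ => C) :=
  fun _ _ => contDiff_const

theorem conj (hM : MatSmooth M) : MatSmooth (fun x => HcscK.conj (M x)) :=
  fun a b => Complex.conjLIE.toContinuousLinearEquiv.contDiff.comp (hM a b)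

theorem mpd (a : Fin n) (hM : MatSmooth M) : MatSmooth (HcscK.mpd a M) :=
  fun i j => HcscK.ContDiff.pd (hM i j) a

theorem trace (hM : MatSmooth M) : ContDiff ℝ ∞ (fun x => (M x).trace) :=
  ContDiff.sum fun i _ => hM i i

theorem det (hM : MatSmooth M) : ContDiff ℝ ∞ (fun x => (M x).det) := by
  simp only [Matrix.det_apply]
  exact ContDiff.sum fun σ _ => (contDiff_prod fun i _ => hM _ _).const_smul _

theorem adjugate (hM : MatSmooth M) : MatSmooth (fun x => (M x).adjugate) := by
  intro a b
  simp only [Matrix.adjugate_apply]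
  refine det (M := fun x => (M x).updateRow b (Pi.single a 1)) fun i j => ?_
  simp only [Matrix.updateRow_apply]
  split_ifs
  · exact contDiff_const
  · exact hM i j

theorem inv (hM : MatSmooth M) (h : ∀ x, IsUnit (M x).det) : MatSmooth (fun x => (M x)⁻¹) := by
  intro a b
  simp only [Matrix.inv_def, Ring.inverse_eq_inv', Matrix.smul_apply, smul_eq_mul]
  exact (hM.det.inv fun x => (h x).ne_zero).mul (hM.adjugate a b)

end MatSmooth

theorem mpd_mul {M N : (Fin n → ℝ) → Matrix (Fin n) (Fin n) ℂ} (hM : MatSmooth M)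
    (hN : MatSmooth N) (a : Fin n) (x : Fin n → ℝ) :
    mpd a (fun x => M x * N x) x = mpd a M x * N x + M x * mpd a N x := by
  ext i j
  simp only [mpd_apply, Matrix.mul_apply, Matrix.add_apply]
  rw [pd_sum (F := fun k x => M x i k * N x k j) fun k _ => ((hM i k).diffAt x).mul ((hN k j).diffAt x), ← Finset.sum_add_distrib]
  exact Finset.sum_congr rfl fun k _ => pd_mul ((hM i k).diffAt x) ((hN k j).diffAt x)

theorem mpd_inv {M : (Fin n → ℝ) → Matrix (Fin n) (Fin n) ℂ} (hM : MatSmooth M)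
    (h : ∀ x, IsUnit (M x).det) (a : Fin n) (x : Fin n → ℝ) :
    mpd a (fun x => (M x)⁻¹) x = -((M x)⁻¹ * mpd a M x * (M x)⁻¹) := by
  have h1 := mpd_mul hM (hM.inv h) a x
  have h2 : mpd a (fun x => M x * (M x)⁻¹) x = 0 := by
    have : (fun x => M x * (M x)⁻¹) = fun _ => 1 := by
      funext x; exact Matrix.mul_nonsing_inv _ (h x)
    rw [this]; ext i j; simp [mpd_apply, pd_const]
  rw [h2] at h1
  have h3 := congrArg (fun Z => (M x)⁻¹ * Z) h1
  simp only [mul_zero, mul_add, ← mul_assoc, Matrix.nonsing_inv_mul _ (h x), one_mul] at h3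
  rw [eq_neg_iff_add_eq_zero, add_comm]
  exact h3.symm

theorem mpd_conj (M : (Fin n → ℝ) → Matrix (Fin n) (Fin n) ℂ) (a : Fin n) (x : Fin n → ℝ) :
    mpd a (fun x => conj (M x)) x = conj (mpd a M x) := by
  ext i j
  exact pd_conj a _ x

theorem conj_mul (A B : Matrix (Fin n) (Fin n) ℂ) : conj (A * B) = conj A * conj B :=
  Matrix.map_mul

theorem conj_conj (A : Matrix (Fin n) (Fin n) ℂ) : conj (conj A) = A := by
  ext; simp [conj]

theorem conj_transpose (A : Matrix (Fin n) (Fin n) ℂ) :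
    (conj A).transpose = A.conjTranspose := rfl

/-! ### Derivatives of functions of `x = Re z` -/

/-- The real part as a continuous linear map. -/
def reCLM (n : ℕ) : (Fin n → ℂ) →L[ℝ] (Fin n → ℝ) :=
  ContinuousLinearMap.pi fun a => Complex.reCLM.comp (ContinuousLinearMap.proj a)

/-- No differentiability of F is needed: F is recovered from its pullback by restricting to a real
affine slice through z, so the two functions are differentiable together, and otherwise both
derivatives are zero by convention. -/
theorem fderiv_comp_rePart {E : Type*} [NormedAddCommGroup E] [NormedSpace ℝ E]
    (F : (Fin n → ℝ) → E) (z d : Fin n → ℂ) :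
    fderiv ℝ (fun ζ => F (rePart ζ)) z d = fderiv ℝ F (rePart z) (rePart d) := by
  by_cases hF : DifferentiableAt ℝ F (rePart z)
  · have h := HasFDerivAt.comp (f := rePart) z hF.hasFDerivAt (reCLM n).hasFDerivAt
    have h2 : (fun ζ => F (rePart ζ)) = F ∘ rePart := rfl
    rw [h2, h.fderiv]
    rfl
  · have hF' : ¬ DifferentiableAt ℝ (fun ζ => F (rePart ζ)) z := by
      intro h
      apply hF
      -- The affine section of `rePart` through z, with the imaginary part frozen.
      let j : (Fin n → ℝ) → (Fin n → ℂ) := fun x a => z a + ((x a - (z a).re : ℝ) : ℂ)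
      have hj : DifferentiableAt ℝ j (rePart z) := by
        rw [differentiableAt_pi]
        intro a
        refine (differentiableAt_const _).add ?_
        refine Complex.ofRealCLM.differentiableAt.comp (rePart z) (f := fun x => x a - (z a).re) ?_
        fun_prop
      have hjz : j (rePart z) = z := by
        funext a; simp [j, rePart]
      have h3 : F = (fun ζ => F (rePart ζ)) ∘ j := by
        funext x
        simp only [Function.comp]
        congr 1
        funext a; simp [j, rePart]
      rw [h3]
      rw [← hjz] at h
      exact h.comp _ hj
    rw [fderiv_zero_of_not_differentiableAt hF, fderiv_zero_of_not_differentiableAt hF']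
    rfl

theorem rePart_single_one (a : Fin n) : rePart (Pi.single a 1) = Pi.single a 1 := by
  funext b
  by_cases h : b = a
  · subst h; simp [rePart]
  · simp [rePart, h]

theorem rePart_single_I (a : Fin n) : rePart (Pi.single a I) = 0 := by
  funext b
  by_cases h : b = a
  · subst h; simp [rePart]
  · simp [rePart, h]

/-- The w-derivative drops out, so ∂_z and ∂_z̄ have the same effect; every factor ½ or ¼ in the
curvature formulas comes from here. -/
theorem dz_comp_rePart (a : Fin n) (F : (Fin n → ℝ) → ℂ) (z : Fin n → ℂ) :
    dz a (fun ζ => F (rePart ζ)) z = (1 / 2) * pd a F (rePart z) := by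
  simp [dz, fderiv_comp_rePart, rePart_single_one, rePart_single_I, pd]

theorem dzbar_comp_rePart (a : Fin n) (F : (Fin n → ℝ) → ℂ) (z : Fin n → ℂ) :
    dzbar a (fun ζ => F (rePart ζ)) z = (1 / 2) * pd a F (rePart z) := by
  simp [dzbar, fderiv_comp_rePart, rePart_single_one, rePart_single_I, pd]

theorem TorusInvariant.eq_comp_rePart {E : Type*} {F : (Fin n → ℂ) → E} (hF : TorusInvariant F)
    (z : Fin n → ℂ) : F z = F (realPoint (rePart z)) := by
  rw [← hF (realPoint (rePart z)) fun a => (z a).im]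
  congr 1
  funext a
  simp only [realPoint, rePart]
  rw [mul_comm, Complex.re_add_im]

theorem rePart_realPoint (x : Fin n → ℝ) : rePart (realPoint x) = x := rfl

theorem contDiff_realPoint : ContDiff ℝ ∞ (realPoint (n := n)) :=
  contDiff_pi.2 fun a => Complex.ofRealCLM.contDiff.comp (contDiff_apply ℝ ℝ a)

/-! ### Diagonalisable matrices with real eigenvalues -/

/-- `B = P diag(δ) P⁻¹` with real `δ`. -/
structure RealDiag (B P : Matrix (Fin n) (Fin n) ℂ) (δ : Fin n → ℝ) : Prop where
  unit : IsUnit P.det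
  eq : B = P * Matrix.diagonal (fun i => (δ i : ℂ)) * P⁻¹

open scoped MatrixOrder in
theorem exists_eq_conjTranspose_mul_self {G : Matrix (Fin n) (Fin n) ℂ} (hG : G.PosDef) :
    ∃ S : Matrix (Fin n) (Fin n) ℂ, G = S.conjTranspose * S ∧ IsUnit S.det := by
  obtain ⟨S, hS⟩ := CStarAlgebra.nonneg_iff_eq_star_mul_self.mp hG.posSemidef.nonneg
  refine ⟨S, hS, ?_⟩
  have h := hG.isUnit
  rw [Matrix.isUnit_iff_isUnit_det, hS, Matrix.det_mul] at h
  exact (IsUnit.mul_iff.mp h).2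

theorem exists_realDiag_of_isHermitian {H : Matrix (Fin n) (Fin n) ℂ} (hH : H.IsHermitian) :
    ∃ P δ, RealDiag H P δ := by
  refine ⟨hH.eigenvectorUnitary, hH.eigenvalues, ?_, ?_⟩
  · have h : (hH.eigenvectorUnitary : Matrix (Fin n) (Fin n) ℂ) *
        star (hH.eigenvectorUnitary : Matrix (Fin n) (Fin n) ℂ) = 1 := by simp
    exact (Matrix.isUnit_iff_isUnit_det _).1 (IsUnit.of_mul_eq_one _ h)
  · have h : (hH.eigenvectorUnitary : Matrix (Fin n) (Fin n) ℂ) *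
        star (hH.eigenvectorUnitary : Matrix (Fin n) (Fin n) ℂ) = 1 := by simp
    rw [Matrix.inv_eq_right_inv h]
    conv_lhs => rw [hH.spectral_theorem]
    simp [Unitary.conjStarAlgAut_apply]
    rfl

theorem RealDiag.conj_left {B P S : Matrix (Fin n) (Fin n) ℂ} {δ : Fin n → ℝ}
    (h : RealDiag (S * B * S⁻¹) P δ) (hS : IsUnit S.det) : RealDiag B (S⁻¹ * P) δ where
  unit := by
    rw [Matrix.det_mul]
    exact (Matrix.isUnit_nonsing_inv_det _ hS).mul h.unit
  eq := by
    rw [Matrix.mul_inv_rev, Matrix.nonsing_inv_nonsing_inv _ hS]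
    calc B = S⁻¹ * (S * B * S⁻¹) * S := by
          simp only [mul_assoc, Matrix.nonsing_inv_mul _ hS, mul_one]
          rw [← mul_assoc, Matrix.nonsing_inv_mul _ hS, one_mul]
      _ = _ := by rw [h.eq]; simp only [mul_assoc]

/-- A matrix that is self-adjoint for a positive definite Hermitian form is diagonalisable with
real eigenvalues. -/
theorem exists_realDiag {G B : Matrix (Fin n) (Fin n) ℂ} (hG : G.PosDef)
    (hB : (G * B).IsHermitian) : ∃ P δ, RealDiag B P δ := by
  obtain ⟨S, hS, hSu⟩ := exists_eq_conjTranspose_mul_self hG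
  have hSu' : IsUnit S.conjTranspose.det := by
    rw [Matrix.det_conjTranspose]; exact hSu.star
  have h1 : (S * B * S⁻¹).IsHermitian := by
    -- With G = S*S, conjugation by S turns the form G into the standard one, so self-adjointness
    -- for G becomes ordinary Hermitian symmetry.
    have h2 : S * B * S⁻¹ = (S⁻¹).conjTranspose * (G * B) * S⁻¹ := by
      rw [hS, Matrix.conjTranspose_nonsing_inv]
      simp only [← mul_assoc, Matrix.nonsing_inv_mul _ hSu', one_mul]
    rw [h2]
    exact Matrix.isHermitian_conjTranspose_mul_mul _ hB
  obtain ⟨P, δ, h⟩ := exists_realDiag_of_isHermitian h1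
  exact ⟨_, _, h.conj_left hSu⟩

/-- Intertwining relations pass to powers and then to polynomials. This serves for diagonalisation
(Z = P), for commutants (A = B), and for moving ψ(B) across q and G. -/
theorem aeval_mul_eq_mul_aeval {R : Type*} [CommRing R] [Algebra R ℂ]
    {A B Z : Matrix (Fin n) (Fin n) ℂ} (h : A * Z = Z * B)
    (p : Polynomial R) : Polynomial.aeval A p * Z = Z * Polynomial.aeval B p := by
  induction p using Polynomial.induction_on' with
  | add p q hp hq => simp only [map_add, add_mul, mul_add, hp, hq]
  | monomial k c =>
    have hk : A ^ k * Z = Z * B ^ k := by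
      induction k with
      | zero => simp
      | succ k ih => rw [pow_succ, mul_assoc, h, ← mul_assoc, ih, mul_assoc, ← pow_succ]
    simp only [Polynomial.aeval_monomial, mul_assoc, hk]
    rw [Algebra.algebraMap_eq_smul_one]
    simp

theorem aeval_diagonal {R : Type*} [CommRing R] [Algebra R ℂ] (d : Fin n → ℂ)
    (p : Polynomial R) :
    Polynomial.aeval (Matrix.diagonal d) p =
      Matrix.diagonal fun i => Polynomial.aeval (d i) p := by
  induction p using Polynomial.induction_on' with
  | add p q hp hq => simp only [map_add, hp, hq, Matrix.diagonal_add]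
  | monomial k c =>
    simp only [Polynomial.aeval_monomial, Matrix.diagonal_pow, Algebra.algebraMap_eq_smul_one]
    ext i j
    by_cases hij : i = j
    · subst hij; simp
    · simp [hij]

namespace RealDiag

variable {B P : Matrix (Fin n) (Fin n) ℂ} {δ : Fin n → ℝ}

theorem aeval_eq {R : Type*} [CommRing R] [Algebra R ℂ] (h : RealDiag B P δ)
    (p : Polynomial R) :
    Polynomial.aeval B p =
      P * Matrix.diagonal (fun i => Polynomial.aeval (δ i : ℂ) p) * P⁻¹ := by
  have h1 : B * P = P * Matrix.diagonal (fun i => (δ i : ℂ)) := by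
    rw [h.eq, mul_assoc, Matrix.nonsing_inv_mul _ h.unit, mul_one]
  rw [← aeval_diagonal, ← aeval_mul_eq_mul_aeval h1 p, mul_assoc,
    Matrix.mul_nonsing_inv _ h.unit, mul_one]

theorem roots_charpoly (h : RealDiag B P δ) :
    B.charpoly.roots = Finset.univ.val.map fun i => (δ i : ℂ) := by
  have h1 : B.charpoly = (Matrix.diagonal fun i => (δ i : ℂ)).charpoly := by
    rw [h.eq, Matrix.charpoly_mul_comm, ← mul_assoc, Matrix.nonsing_inv_mul _ h.unit, one_mul]
  rw [h1, Matrix.charpoly_diagonal]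
  have h2 := Polynomial.roots_multiset_prod_X_sub_C (Finset.univ.val.map fun i => (δ i : ℂ))
  rw [Multiset.map_map] at h2
  exact h2

/-- Every δᵢ is a root of the characteristic polynomial, hence an interpolation node, where the
interpolating polynomial takes the value f(δᵢ). -/
theorem spectralFun_eq (h : RealDiag B P δ) (f : ℝ → ℝ) :
    spectralFun f B = P * Matrix.diagonal (fun i => ((f (δ i) : ℝ) : ℂ)) * P⁻¹ := by
  unfold spectralFun
  rw [h.aeval_eq]
  congr 3
  funext i
  rw [Polynomial.coe_aeval_eq_eval]
  have := Lagrange.eval_interpolate_at_node (s := B.charpoly.roots.toFinset) (v := id)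
    (fun μ : ℂ => ((f μ.re : ℝ) : ℂ)) (i := (δ i : ℂ)) Function.injective_id.injOn
    (by simp only [h.roots_charpoly, Multiset.mem_toFinset, Multiset.mem_map]
        exact ⟨i, by simp, rfl⟩)
  simpa using this

/-- Interpolation over ℝ at the real eigenvalues gives the same matrix. Real coefficients are what
allows complex conjugation to pass through the spectral function. -/
theorem exists_real_poly (h : RealDiag B P δ) (f : ℝ → ℝ) :
    ∃ p : Polynomial ℝ, spectralFun f B = Polynomial.aeval B p := by
  refine ⟨Lagrange.interpolate (Finset.univ.image δ) id f, ?_⟩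
  rw [h.aeval_eq, h.spectralFun_eq]
  congr 3
  funext i
  have := Lagrange.eval_interpolate_at_node (s := Finset.univ.image δ) (v := id) f (i := δ i)
    Function.injective_id.injOn (by simp)
  have h2 := Polynomial.aeval_algebraMap_apply ℂ (δ i)
    (Lagrange.interpolate (Finset.univ.image δ) id f)
  rw [Polynomial.coe_aeval_eq_eval] at h2
  simp only [id] at this
  rw [this] at h2
  exact h2.symm

theorem one_sub (h : RealDiag B P δ) : RealDiag (1 - B) P (fun i => 1 - δ i) where
  unit := h.unit
  eq := by
    have : (Matrix.diagonal fun i => ((1 - δ i : ℝ) : ℂ)) =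
        1 - Matrix.diagonal fun i => (δ i : ℂ) := by
      rw [← Matrix.diagonal_one, Matrix.diagonal_sub]; simp
    rw [this, mul_sub, sub_mul, mul_one, Matrix.mul_nonsing_inv _ h.unit, ← h.eq]

theorem mul_diagonal (hP : IsUnit P.det) (d e : Fin n → ℂ) :
    (P * Matrix.diagonal d * P⁻¹) * (P * Matrix.diagonal e * P⁻¹) =
      P * Matrix.diagonal (fun i => d i * e i) * P⁻¹ := by
  rw [← Matrix.diagonal_mul_diagonal]
  simp only [mul_assoc]
  congr 2
  rw [← mul_assoc P⁻¹, Matrix.nonsing_inv_mul _ hP, one_mul]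

theorem mem_spectrum (h : RealDiag B P δ) (i : Fin n) : (δ i : ℂ) ∈ spectrum ℂ B := by
  rw [Matrix.mem_spectrum_iff_isRoot_charpoly, ← Polynomial.mem_roots B.charpoly_monic.ne_zero,
    h.roots_charpoly]
  simp

theorem sqrt_mul_sqrt (h : RealDiag B P δ) (hδ : ∀ i, δ i < 1) :
    spectralFun Real.sqrt (1 - B) * spectralFun Real.sqrt (1 - B) = 1 - B := by
  rw [h.one_sub.spectralFun_eq, mul_diagonal h.unit]
  conv_rhs => rw [h.one_sub.eq]
  congr 3
  funext i
  rw [← Complex.ofReal_mul, Real.mul_self_sqrt (by linarith [hδ i])]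

theorem one_add_sqrt (h : RealDiag B P δ) :
    1 + spectralFun Real.sqrt (1 - B) =
      P * Matrix.diagonal (fun i => ((1 + Real.sqrt (1 - δ i) : ℝ) : ℂ)) * P⁻¹ := by
  have h2 : (Matrix.diagonal fun i => ((1 + Real.sqrt (1 - δ i) : ℝ) : ℂ)) =
      1 + Matrix.diagonal fun i => (Real.sqrt (1 - δ i) : ℂ) := by
    rw [← Matrix.diagonal_one, Matrix.diagonal_add]; simp
  rw [h2, mul_add, add_mul, mul_one, Matrix.mul_nonsing_inv _ h.unit,
    h.one_sub.spectralFun_eq]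

theorem psi_mul (h : RealDiag B P δ) :
    spectralFun psi B * (1 + spectralFun Real.sqrt (1 - B)) = (1 / 2 : ℂ) • 1 := by
  rw [h.one_add_sqrt, h.spectralFun_eq, mul_diagonal h.unit]
  have : (Matrix.diagonal fun i : Fin n =>
      ((psi (δ i) : ℝ) : ℂ) * ((1 + Real.sqrt (1 - δ i) : ℝ) : ℂ)) = (1 / 2 : ℂ) • 1 := by
    ext i j
    by_cases hij : i = j
    · subst hij
      rw [Matrix.diagonal_apply_eq, ← Complex.ofReal_mul]
      have h3 : (1 + Real.sqrt (1 - δ i)) ≠ 0 := by positivity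
      have : psi (δ i) * (1 + Real.sqrt (1 - δ i)) = 1 / 2 := by
        unfold psi; field_simp
      rw [this]; simp
    · simp [hij]
  rw [this, Matrix.mul_smul, Matrix.smul_mul, mul_one, Matrix.mul_nonsing_inv _ h.unit]

theorem isUnit_det_one_add_sqrt (h : RealDiag B P δ) :
    IsUnit (1 + spectralFun Real.sqrt (1 - B)).det := by
  have h1 : ((2 : ℂ) • spectralFun psi B) * (1 + spectralFun Real.sqrt (1 - B)) = 1 := by
    rw [Matrix.smul_mul, h.psi_mul, smul_smul]
    norm_num
  exact (Matrix.isUnit_iff_isUnit_det _).1 (IsUnit.of_mul_eq_one_right _ h1)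

theorem psi_eq (h : RealDiag B P δ) :
    spectralFun psi B = (1 / 2 : ℂ) • (1 + spectralFun Real.sqrt (1 - B))⁻¹ := by
  have h1 := congrArg (fun Z => Z * (1 + spectralFun Real.sqrt (1 - B))⁻¹) h.psi_mul
  simp only [mul_assoc, Matrix.mul_nonsing_inv _ h.isUnit_det_one_add_sqrt, mul_one,
    Matrix.smul_mul, one_mul] at h1
  exact h1

/-- Factor B = (1 + √(1-B))(1 - √(1-B)); the first factor is half the inverse of ψ(B). The bound δ <
1 ensures that the real square root squares back to 1 - B. -/
theorem psi_mul_self (h : RealDiag B P δ) (hδ : ∀ i, δ i < 1) :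
    spectralFun psi B * B = (1 / 2 : ℂ) • (1 - spectralFun Real.sqrt (1 - B)) := by
  have h1 : B = (1 + spectralFun Real.sqrt (1 - B)) * (1 - spectralFun Real.sqrt (1 - B)) := by
    rw [add_mul, one_mul, mul_sub, mul_one, h.sqrt_mul_sqrt hδ]
    abel
  calc spectralFun psi B * B = spectralFun psi B *
        ((1 + spectralFun Real.sqrt (1 - B)) * (1 - spectralFun Real.sqrt (1 - B))) := by rw [← h1]
    _ = _ := by rw [← mul_assoc, h.psi_mul, Matrix.smul_mul, one_mul]

end RealDiag

/-! ### Smoothness of the square root -/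

/-- A square root of `R²` commuting with the positive diagonalisable matrix `R` and without
eigenvalues on the negative half-line is `R`. -/
theorem RealDiag.eq_of_mul_self_eq {R P S : Matrix (Fin n) (Fin n) ℂ} {ρ : Fin n → ℝ}
    (h : RealDiag R P ρ) (hρ : ∀ i, 0 ≤ ρ i) (hSR : S * R = R * S) (hsq : S * S = R * R)
    (hS : ∀ t : ℝ, 0 ≤ t → (S + Matrix.scalar (Fin n) (t : ℂ)).det ≠ 0) : S = R := by
  have h0 : (S - R) * (S + R) = 0 := by
    rw [sub_mul, mul_add, mul_add, hsq, hSR]; abel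
  -- It suffices to cancel S + R in (S - R)(S + R) = 0. A kernel vector of S + R would produce an
  -- eigenvalue -ρᵢ ≤ 0 of S, contrary to `hS`.
  have hunit : IsUnit (S + R).det := by
    rw [isUnit_iff_ne_zero]
    intro hdet
    set T := P⁻¹ * S * P with hT
    have hRP : R * P = P * Matrix.diagonal (fun i => (ρ i : ℂ)) := by
      rw [h.eq, mul_assoc, Matrix.nonsing_inv_mul _ h.unit, mul_one]
    have hPR : P⁻¹ * R = Matrix.diagonal (fun i => (ρ i : ℂ)) * P⁻¹ := by
      conv_lhs => rw [h.eq]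
      rw [← mul_assoc, ← mul_assoc, Matrix.nonsing_inv_mul _ h.unit, one_mul]
    have hcomm : T * Matrix.diagonal (fun i => (ρ i : ℂ)) =
        Matrix.diagonal (fun i => (ρ i : ℂ)) * T := by
      rw [hT, mul_assoc, ← hRP, ← mul_assoc, mul_assoc P⁻¹, hSR, ← mul_assoc, hPR]
      simp only [mul_assoc]
    have hconj : ∀ C : Matrix (Fin n) (Fin n) ℂ, (P⁻¹ * C * P).det = C.det := by
      intro C
      rw [Matrix.det_mul, Matrix.det_mul, mul_comm, ← mul_assoc, ← Matrix.det_mul,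
        Matrix.mul_nonsing_inv _ h.unit, Matrix.det_one, one_mul]
    have hTD : (T + Matrix.diagonal (fun i => (ρ i : ℂ))).det = 0 := by
      rw [← hdet, ← hconj (S + R), mul_add, add_mul, hPR, mul_assoc _ P⁻¹ P,
        Matrix.nonsing_inv_mul _ h.unit, mul_one]
    obtain ⟨v, hv, hv0⟩ := Matrix.exists_mulVec_eq_zero_iff.2 hTD
    obtain ⟨i, hi⟩ := Function.ne_iff.1 hv
    have hentry : ∀ k j, ρ k ≠ ρ j → T k j = 0 := by
      intro k j hkj
      have := congrFun (congrFun hcomm k) j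
      rw [Matrix.mul_diagonal, Matrix.diagonal_mul] at this
      have h3 : T k j * ((ρ j : ℂ) - ρ k) = 0 := by linear_combination this
      rcases mul_eq_zero.1 h3 with h4 | h4
      · exact h4
      · exact absurd (Complex.ofReal_injective (sub_eq_zero.1 h4)).symm hkj
    have hdet2 : (T + Matrix.scalar (Fin n) (ρ i : ℂ)).det ≠ 0 := by
      have : T + Matrix.scalar (Fin n) (ρ i : ℂ) =
          P⁻¹ * (S + Matrix.scalar (Fin n) (ρ i : ℂ)) * P := by
        rw [mul_add, add_mul, mul_assoc P⁻¹ (Matrix.scalar _ _),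
          (Matrix.scalar_commute (ρ i : ℂ) (fun _ => mul_comm _ _) P).eq, ← mul_assoc,
          Matrix.nonsing_inv_mul _ h.unit, one_mul]
      rw [this, hconj]
      exact hS _ (hρ i)
    apply hdet2
    -- T commutes with the diagonal matrix, so it preserves the blocks of equal ρ; the truncation of
    -- v to the block of ρᵢ is therefore still killed, now by T + ρᵢ.
    refine Matrix.exists_mulVec_eq_zero_iff.1 ⟨fun j => if ρ j = ρ i then v j else 0, ?_, ?_⟩
    · intro h5
      have := congrFun h5 i
      simp only [if_true, Pi.zero_apply] at this
      exact hi this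
    · funext k
      have hvk := congrFun hv0 k
      rw [Matrix.add_mulVec, Pi.add_apply, Matrix.mulVec_diagonal] at hvk
      have hsc : (Matrix.scalar (Fin n) (ρ i : ℂ)).mulVec
          (fun j => if ρ j = ρ i then v j else 0) k =
          (ρ i : ℂ) * (if ρ k = ρ i then v k else 0) := by
        rw [Matrix.scalar_apply, Matrix.mulVec_diagonal]
      rw [Matrix.add_mulVec, Pi.add_apply, hsc, Pi.zero_apply]
      by_cases hk : ρ k = ρ i
      · have : (T.mulVec fun j => if ρ j = ρ i then v j else 0) k = T.mulVec v k := by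
          simp only [Matrix.mulVec, dotProduct]
          refine Finset.sum_congr rfl fun j _ => ?_
          split_ifs with hj
          · rfl
          · rw [hentry k j (by rw [hk]; exact fun h => hj h.symm)]; simp
        rw [this, if_pos hk, ← hk]
        exact hvk
      · have : (T.mulVec fun j => if ρ j = ρ i then v j else 0) k = 0 := by
          simp only [Matrix.mulVec, dotProduct]
          refine Finset.sum_eq_zero fun j _ => ?_
          split_ifs with hj
          · rw [hentry k j (by rw [hj]; exact hk)]; simp
          · simp
        rw [this, if_neg hk]; simp
  have h6 := congrArg (fun Z => Z * (S + R)⁻¹) h0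
  simp only [mul_assoc, Matrix.mul_nonsing_inv _ hunit, mul_one, zero_mul] at h6
  exact sub_eq_zero.1 h6

/-- In an eigenbasis of R the map X ↦ RX + XR multiplies the (i, j) entry by ρᵢ + ρⱼ > 0. This map
is the derivative of S ↦ S² at R. -/
theorem RealDiag.sylvester_injective {R P X : Matrix (Fin n) (Fin n) ℂ} {ρ : Fin n → ℝ}
    (h : RealDiag R P ρ) (hρ : ∀ i, 0 < ρ i) (hX : R * X + X * R = 0) : X = 0 := by
  have hRP : R * P = P * Matrix.diagonal (fun i => (ρ i : ℂ)) := by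
    rw [h.eq, mul_assoc, Matrix.nonsing_inv_mul _ h.unit, mul_one]
  have hPR : P⁻¹ * R = Matrix.diagonal (fun i => (ρ i : ℂ)) * P⁻¹ := by
    conv_lhs => rw [h.eq]
    rw [← mul_assoc, ← mul_assoc, Matrix.nonsing_inv_mul _ h.unit, one_mul]
  have h1 : Matrix.diagonal (fun i => (ρ i : ℂ)) * (P⁻¹ * X * P) +
      (P⁻¹ * X * P) * Matrix.diagonal (fun i => (ρ i : ℂ)) = 0 := by
    have := congrArg (fun Z => P⁻¹ * Z * P) hX
    simp only [mul_add, add_mul, mul_zero, zero_mul] at this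
    rw [← this]
    congr 1
    · simp only [← mul_assoc, hPR]
    · simp only [mul_assoc, hRP]
  have h2 : P⁻¹ * X * P = 0 := by
    ext i j
    have := congrFun (congrFun h1 i) j
    rw [Matrix.add_apply, Matrix.mul_diagonal, Matrix.diagonal_mul] at this
    have h3 : (((ρ i + ρ j : ℝ)) : ℂ) * (P⁻¹ * X * P) i j = 0 := by
      push_cast; simp only [Matrix.zero_apply] at this; linear_combination this
    rcases mul_eq_zero.1 h3 with h4 | h4
    · exact absurd (Complex.ofReal_eq_zero.1 h4) (add_pos (hρ i) (hρ j)).ne'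
    · exact h4
  calc X = P * (P⁻¹ * X * P) * P⁻¹ := by
        simp only [mul_assoc, Matrix.mul_nonsing_inv _ h.unit, mul_one]
        rw [← mul_assoc, Matrix.mul_nonsing_inv _ h.unit, one_mul]
    _ = 0 := by rw [h2]; simp

attribute [local instance] Matrix.linftyOpNormedRing Matrix.linftyOpNormedAlgebra

/-- Having no eigenvalue in (-∞, 0] is an open condition: for bounded t it follows from compactness
of the interval, and large t is excluded because eigenvalues are bounded by the norm. -/
theorem eventually_det_add_scalar_ne_zero (R : Matrix (Fin n) (Fin n) ℂ)
    (hR : ∀ t : ℝ, 0 ≤ t → (R + Matrix.scalar (Fin n) (t : ℂ)).det ≠ 0) :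
    ∀ᶠ S in nhds R, ∀ t : ℝ, 0 ≤ t → (S + Matrix.scalar (Fin n) (t : ℂ)).det ≠ 0 := by
  -- The factor ‖1‖ is kept because it is 0 when n = 0; the added 1 leaves room for S near R.
  set C := (‖R‖ + 1) * ‖(1 : Matrix (Fin n) (Fin n) ℂ)‖
  have h1 : ∀ᶠ S in nhds R, ∀ t ∈ Set.Icc (0 : ℝ) C,
      (S + Matrix.scalar (Fin n) (t : ℂ)).det ≠ 0 := by
    refine isCompact_Icc.eventually_forall_of_forall_eventually fun t ht => ?_
    have hc : Continuous fun z : Matrix (Fin n) (Fin n) ℂ × ℝ =>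
        (z.1 + Matrix.scalar (Fin n) (z.2 : ℂ)).det := by
      refine Continuous.matrix_det (continuous_fst.add ?_)
      simp only [Matrix.scalar_apply]
      exact Continuous.matrix_diagonal (by fun_prop)
    exact hc.continuousAt.eventually_ne (hR t ht.1)
  have h2 : ∀ᶠ S in nhds R, ‖S‖ < ‖R‖ + 1 :=
    continuous_norm.continuousAt.eventually (gt_mem_nhds (by simp))
  filter_upwards [h1, h2] with S hS1 hS2 t ht
  by_cases htC : t ≤ C
  · exact hS1 t ⟨ht, htC⟩
  · intro hdet
    have hmem : (-(t : ℂ)) ∈ spectrum ℂ S := by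
      rw [spectrum.mem_iff, Matrix.isUnit_iff_isUnit_det, isUnit_iff_ne_zero, not_not]
      have : algebraMap ℂ (Matrix (Fin n) (Fin n) ℂ) (-(t : ℂ)) - S =
          -(S + Matrix.scalar (Fin n) (t : ℂ)) := by
        rw [map_neg]
        have : algebraMap ℂ (Matrix (Fin n) (Fin n) ℂ) (t : ℂ) = Matrix.scalar (Fin n) (t : ℂ) := rfl
        rw [this]; abel
      rw [this, Matrix.det_neg, hdet, mul_zero]
    have h3 := spectrum.norm_le_norm_mul_of_mem hmem
    rw [norm_neg, Complex.norm_real, Real.norm_of_nonneg ht] at h3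
    exact htC (h3.trans (mul_le_mul_of_nonneg_right hS2.le (norm_nonneg _)))

theorem contDiff_matrix_entries {A : (Fin n → ℝ) → Matrix (Fin n) (Fin n) ℂ} (hA : MatSmooth A) :
    ContDiff ℝ ∞ A := by
  have h : A = fun x => ∑ i, ∑ j, (A x i j) • Matrix.single i j (1 : ℂ) := by
    funext x
    conv_lhs => rw [Matrix.matrix_eq_sum_single (A x)]
    simp
  rw [h]
  exact ContDiff.sum fun i _ => ContDiff.sum fun j _ => (hA i j).smul contDiff_const

/-- The square root of a smooth family of diagonalisable matrices with positive eigenvalues is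
smooth. -/
theorem MatSmooth.spectralFun_sqrt {A : (Fin n → ℝ) → Matrix (Fin n) (Fin n) ℂ}
    (hA : MatSmooth A) (hdiag : ∀ x, ∃ P δ, RealDiag (A x) P δ ∧ ∀ i, 0 < δ i) :
    MatSmooth fun x => spectralFun Real.sqrt (A x) := by
  have hsqrt : ∀ x, ∃ P ρ, RealDiag (spectralFun Real.sqrt (A x)) P ρ ∧ (∀ i, 0 < ρ i) ∧
      spectralFun Real.sqrt (A x) * spectralFun Real.sqrt (A x) = A x := by
    intro x
    obtain ⟨P, δ, h, hδ⟩ := hdiag x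
    refine ⟨P, fun i => Real.sqrt (δ i), ⟨h.unit, h.spectralFun_eq _⟩,
      fun i => Real.sqrt_pos.2 (hδ i), ?_⟩
    rw [h.spectralFun_eq, RealDiag.mul_diagonal h.unit]
    conv_rhs => rw [h.eq]
    congr 3
    funext i
    rw [← Complex.ofReal_mul, Real.mul_self_sqrt (hδ i).le]
  have hcomm : ∀ x (S : Matrix (Fin n) (Fin n) ℂ), S * A x = A x * S →
      S * spectralFun Real.sqrt (A x) = spectralFun Real.sqrt (A x) * S := by
    intro x S hS
    unfold spectralFun
    exact (aeval_mul_eq_mul_aeval hS.symm _).symm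
  set R := fun x => spectralFun Real.sqrt (A x) with hRdef
  suffices h : ContDiff ℝ ∞ R by
    intro i j
    have h2 : Continuous (Matrix.entryLinearMap ℝ ℂ i j) :=
      LinearMap.continuous_of_finiteDimensional _
    exact (ContinuousLinearMap.mk (Matrix.entryLinearMap ℝ ℂ i j) h2).contDiff.comp h
  rw [contDiff_iff_contDiffAt]
  intro x₀
  obtain ⟨P, ρ, hR0, hρ, hsq0⟩ := hsqrt x₀
  let L : Matrix (Fin n) (Fin n) ℂ →ₗ[ℝ] Matrix (Fin n) (Fin n) ℂ :=
    LinearMap.mulLeft ℝ (R x₀) + LinearMap.mulRight ℝ (R x₀)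
  have hL : Function.Injective L := by
    rw [injective_iff_map_eq_zero]
    intro X hX
    exact hR0.sylvester_injective hρ hX
  let E : Matrix (Fin n) (Fin n) ℂ ≃L[ℝ] Matrix (Fin n) (Fin n) ℂ :=
    (LinearEquiv.ofInjectiveEndo L hL).toContinuousLinearEquiv
  have hder : HasFDerivAt (fun S : Matrix (Fin n) (Fin n) ℂ => S * S)
      (E : Matrix (Fin n) (Fin n) ℂ →L[ℝ] Matrix (Fin n) (Fin n) ℂ) (R x₀) := by
    have h1 := (hasFDerivAt_id (𝕜 := ℝ) (R x₀)).mul' (hasFDerivAt_id (𝕜 := ℝ) (R x₀))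
    exact h1.congr_fderiv (ContinuousLinearMap.ext fun X => rfl)
  have hsm : ContDiffAt ℝ ∞ (fun S : Matrix (Fin n) (Fin n) ℂ => S * S) (R x₀) :=
    (contDiff_id.mul contDiff_id).contDiffAt
  -- A smooth local branch of the square root near A x₀; the remaining task is to identify it with
  -- the spectral square root at nearby points.
  set ℓ := hsm.localInverse hder (by simp) with hℓ
  have hℓs : ContDiffAt ℝ ∞ ℓ (R x₀ * R x₀) := hsm.to_localInverse hder (by simp)
  have hℓ0 : ℓ (R x₀ * R x₀) = R x₀ := hsm.localInverse_apply_image hder (by simp)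
  have hℓr : ∀ᶠ T in nhds (R x₀ * R x₀), ℓ T * ℓ T = T :=
    (hsm.hasStrictFDerivAt' hder (by simp)).eventually_right_inverse
  have hAc : ContDiff ℝ ∞ A := contDiff_matrix_entries hA
  rw [hsq0] at hℓs hℓ0 hℓr
  have hAt : Filter.Tendsto A (nhds x₀) (nhds (A x₀)) := hAc.continuous.continuousAt
  have hcomp : ContDiffAt ℝ ∞ (fun x => ℓ (A x)) x₀ := hℓs.comp x₀ hAc.contDiffAt
  refine hcomp.congr_of_eventuallyEq ?_
  have hpos0 : ∀ t : ℝ, 0 ≤ t → (R x₀ + Matrix.scalar (Fin n) (t : ℂ)).det ≠ 0 := by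
    intro t ht
    have h3 : R x₀ + Matrix.scalar (Fin n) (t : ℂ) =
        P * Matrix.diagonal (fun i => ((ρ i + t : ℝ) : ℂ)) * P⁻¹ := by
      have : (Matrix.diagonal fun i => ((ρ i + t : ℝ) : ℂ)) =
          Matrix.diagonal (fun i => (ρ i : ℂ)) + Matrix.scalar (Fin n) (t : ℂ) := by
        rw [Matrix.scalar_apply, Matrix.diagonal_add]; simp
      rw [this, mul_add, add_mul, ← hR0.eq,
        ← (Matrix.scalar_commute (t : ℂ) (fun _ => mul_comm _ _) P).eq, mul_assoc _ P,
        Matrix.mul_nonsing_inv _ hR0.unit, mul_one]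
    rw [h3, Matrix.det_mul, Matrix.det_mul, Matrix.det_diagonal]
    refine mul_ne_zero (mul_ne_zero hR0.unit.ne_zero ?_)
      (Matrix.isUnit_nonsing_inv_det _ hR0.unit).ne_zero
    rw [Finset.prod_ne_zero_iff]
    intro i _
    exact_mod_cast (by linarith [hρ i] : (0 : ℝ) < ρ i + t).ne'
  have hev := eventually_det_add_scalar_ne_zero _ hpos0
  rw [← hℓ0] at hev
  have hev2 := hcomp.continuousAt.eventually hev
  filter_upwards [hev2, hAt.eventually hℓr] with x hx1 hx2
  obtain ⟨P', ρ', hRx, hρ', hsqx⟩ := hsqrt x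
  -- Being a square root of A x, the branch commutes with A x, hence with every polynomial in it;
  -- this includes the spectral square root, as the uniqueness lemma requires.
  have hc : ℓ (A x) * A x = A x * ℓ (A x) := by
    have : ℓ (A x) * (ℓ (A x) * ℓ (A x)) = (ℓ (A x) * ℓ (A x)) * ℓ (A x) := (mul_assoc _ _ _).symm
    rwa [hx2] at this
  exact (hRx.eq_of_mul_self_eq (fun i => (hρ' i).le) (hcomm x _ hc) (hx2.trans hsqx.symm)
    hx1).symm

/-! ### Periodic functions and the Legendre transform -/

theorem hess_isSymm {v : (Fin n → ℝ) → ℝ} (hv : ContDiff ℝ ∞ v) (x : Fin n → ℝ) :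
    (hess v x).IsSymm := by
  ext a b
  exact pd_comm hv b a x

theorem IntPeriodic.exists_bound {E : Type*} [NormedAddCommGroup E] {F : (Fin n → ℝ) → E}
    (hF : IntPeriodic F) (hc : Continuous F) : ∃ C, 0 ≤ C ∧ ∀ x, ‖F x‖ ≤ C := by
  obtain ⟨C, hC⟩ := (isCompact_Icc (a := (0 : Fin n → ℝ)) (b := 1)).exists_bound_of_continuousOn
    hc.continuousOn
  refine ⟨max C 0, le_max_right _ _, fun x => ?_⟩
  have h1 := hF x fun a => -⌊x a⌋
  rw [← h1]
  refine (hC _ ⟨fun a => ?_, fun a => ?_⟩).trans (le_max_left _ _)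
  · have := Int.floor_le (x a)
    simp only [Pi.zero_apply, Int.cast_neg]; linarith
  · have := Int.lt_floor_add_one (x a)
    simp only [Pi.one_apply, Int.cast_neg]; linarith

theorem pd_translate {E : Type*} [NormedAddCommGroup E] [NormedSpace ℝ E]
    (F : (Fin n → ℝ) → E) (a : Fin n) (x k : Fin n → ℝ) :
    pd a (fun x => F (fun b => x b + k b)) x = pd a F (fun b => x b + k b) := by
  unfold pd
  have := fderiv_comp_add_right (𝕜 := ℝ) (f := F) (x := x) k
  exact congrArg (fun L : (Fin n → ℝ) →L[ℝ] E => L (Pi.single a 1)) this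

theorem IntPeriodic.pd {E : Type*} [NormedAddCommGroup E] [NormedSpace ℝ E]
    {F : (Fin n → ℝ) → E} (hF : IntPeriodic F) (a : Fin n) : IntPeriodic (pd a F) := by
  intro x k
  rw [← pd_translate F a x fun b => (k b : ℝ)]
  congr 1
  funext x
  exact hF x k

theorem contDiff_convexPotential {h : (Fin n → ℝ) → ℝ} (hs : ContDiff ℝ ∞ h) :
    ContDiff ℝ ∞ (convexPotential h) := by
  unfold convexPotential
  refine (contDiff_const.mul (ContDiff.sum fun a _ => ?_)).add hs
  exact (contDiff_apply ℝ ℝ a).pow 2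

theorem grad_convexPotential {h : (Fin n → ℝ) → ℝ} (hs : ContDiff ℝ ∞ h) (x : Fin n → ℝ) :
    grad (convexPotential h) x = x + grad h x := by
  funext a
  have h1 : HasFDerivAt (fun x : Fin n → ℝ => (1 / 2 : ℝ) * ∑ b, x b ^ 2)
      ((1 / 2 : ℝ) • ∑ b, (2 * x b) • (ContinuousLinearMap.proj b : (Fin n → ℝ) →L[ℝ] ℝ)) x := by
    refine (HasFDerivAt.fun_sum fun b _ => ?_).const_mul _
    simpa using (hasFDerivAt_apply (𝕜 := ℝ) b x).pow 2
  have h2 := h1.add (hs.differentiable (by simp) x).hasFDerivAt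
  have h3 : convexPotential h = (fun x : Fin n → ℝ => (1 / 2 : ℝ) * ∑ b, x b ^ 2) + h := rfl
  simp only [grad, pd, Pi.add_apply]
  rw [h3, h2.fderiv]
  simp [Pi.single_apply]

/-- The quadratic part contributes the identity map and h contributes a periodic one. This
equivariance transfers periodicity from x to y. -/
theorem grad_convexPotential_add_int {h : (Fin n → ℝ) → ℝ} (hs : ContDiff ℝ ∞ h)
    (hp : IntPeriodic h) (x : Fin n → ℝ) (k : Fin n → ℤ) :
    grad (convexPotential h) (fun a => x a + k a) =
      fun a => grad (convexPotential h) x a + k a := by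
  rw [grad_convexPotential hs, grad_convexPotential hs]
  funext a
  have := hp.pd a x k
  simp only [Pi.add_apply, grad, this]
  ring

section Gradient

variable {v : (Fin n → ℝ) → ℝ}

theorem contDiff_grad (hv : ContDiff ℝ ∞ v) : ContDiff ℝ ∞ (grad v) :=
  contDiff_pi.2 fun a => ContDiff.pd hv a

theorem fderiv_grad (hv : ContDiff ℝ ∞ v) (x d : Fin n → ℝ) :
    fderiv ℝ (grad v) x d = (hess v x).mulVec d := by
  funext a
  have h1 : fderiv ℝ (grad v) x d a = fderiv ℝ (pd a v) x d := by
    unfold grad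
    rw [fderiv_pi fun b => (ContDiff.pd hv b).differentiable (by simp) x]
    rfl
  rw [h1, fderiv_eq_sum_pd]
  simp only [Matrix.mulVec, dotProduct, smul_eq_mul]
  refine Finset.sum_congr rfl fun b _ => ?_
  rw [mul_comm]
  congr 1
  exact pd_comm hv b a x

theorem fderiv_eq_grad_dotProduct (v : (Fin n → ℝ) → ℝ) (x d : Fin n → ℝ) :
    fderiv ℝ v x d = grad v x ⬝ᵥ d := by
  rw [fderiv_eq_sum_pd]
  simp only [dotProduct, smul_eq_mul, grad]
  exact Finset.sum_congr rfl fun b _ => mul_comm _ _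

/-- The mean value theorem for w ↦ ∂v(w)·(y - x) gives the Hessian quadratic form at an intermediate
point, evaluated on y - x. -/
theorem grad_strictMono (hv : ContDiff ℝ ∞ v) (hpos : ∀ x, (hess v x).PosDef)
    {x y : Fin n → ℝ} (hxy : x ≠ y) : 0 < (grad v y - grad v x) ⬝ᵥ (y - x) := by
  have hd : Differentiable ℝ (grad v) := (contDiff_grad hv).differentiable (by simp)
  let ev : (Fin n → ℝ) →L[ℝ] ℝ :=
    ∑ a, (y a - x a) • (ContinuousLinearMap.proj a : (Fin n → ℝ) →L[ℝ] ℝ)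
  have hev : ∀ w, ev w = w ⬝ᵥ (y - x) := by
    intro w
    simp only [ev, sum_apply, dotProduct]
    exact Finset.sum_congr rfl fun a _ => by simp [mul_comm]
  obtain ⟨z, -, hz⟩ := domain_mvt (f := fun w => ev (grad v w)) (s := Set.univ) (x := x) (y := y)
    (f' := fun w => ev.comp (fderiv ℝ (grad v) w))
    (fun w _ => (ev.hasFDerivAt.comp w (hd w).hasFDerivAt).hasFDerivWithinAt) convex_univ
    trivial trivial
  have hz' : ev (grad v y) - ev (grad v x) = ev (fderiv ℝ (grad v) z (y - x)) := hz
  rw [sub_dotProduct, ← hev, ← hev, hz', hev, fderiv_grad hv, dotProduct_comm]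
  have := (hpos z).dotProduct_mulVec_pos (sub_ne_zero.2 hxy.symm)
  simpa using this

theorem grad_injective (hv : ContDiff ℝ ∞ v) (hpos : ∀ x, (hess v x).PosDef) :
    Function.Injective (grad v) := by
  intro x y h
  by_contra hxy
  have := grad_strictMono hv hpos hxy
  rw [h, sub_self, zero_dotProduct] at this
  exact lt_irrefl _ this

/-- The mean value theorem replaces v(y) - v(x) by the slope at x + θ(y - x), which monotonicity of
the gradient compares with the slope at x. -/
theorem gradient_inequality (hv : ContDiff ℝ ∞ v) (hpos : ∀ x, (hess v x).PosDef)
    (x y : Fin n → ℝ) : v x + grad v x ⬝ᵥ (y - x) ≤ v y := by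
  have hd : Differentiable ℝ v := hv.differentiable (by simp)
  obtain ⟨z, hz, hz'⟩ := domain_mvt (f := v) (s := Set.univ) (x := x) (y := y)
    (f' := fun w => fderiv ℝ v w)
    (fun w _ => (hd w).hasFDerivAt.hasFDerivWithinAt) convex_univ trivial trivial
  rw [fderiv_eq_grad_dotProduct] at hz'
  rw [segment_eq_image'] at hz
  obtain ⟨θ, hθ, rfl⟩ := hz
  suffices h : 0 ≤ (grad v (x + θ • (y - x)) - grad v x) ⬝ᵥ (y - x) by
    rw [sub_dotProduct] at h
    simp only at hz'
    linarith
  by_cases hx : x = x + θ • (y - x)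
  · rw [← hx]; simp
  · have h2 := grad_strictMono hv hpos hx
    rw [add_sub_cancel_left, dotProduct_smul, smul_eq_mul] at h2
    exact (pos_of_mul_pos_right h2 hθ.1).le

/-- The gradient inequality says exactly that the supremum at the slope ∂v(x) is attained at x; it
also supplies the boundedness without which `⨆` would be a default value. -/
theorem legendre_grad (hv : ContDiff ℝ ∞ v) (hpos : ∀ x, (hess v x).PosDef) (x : Fin n → ℝ) :
    legendre v (grad v x) = ∑ a, grad v x a * x a - v x := by
  have hle : ∀ w, ∑ a, grad v x a * w a - v w ≤ ∑ a, grad v x a * x a - v x := by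
    intro w
    have := gradient_inequality hv hpos x w
    rw [dotProduct_sub] at this
    simp only [dotProduct] at this
    linarith
  exact le_antisymm (ciSup_le hle)
    (le_ciSup (f := fun w => ∑ a, grad v x a * w a - v w) ⟨_, Set.forall_mem_range.2 hle⟩ x)

end Gradient

/-- Periodicity bounds h, so v(x) - y·x grows quadratically and attains a minimum, where the
gradient of v equals y. -/
theorem grad_convexPotential_surjective {h : (Fin n → ℝ) → ℝ} (hs : ContDiff ℝ ∞ h)
    (hp : IntPeriodic h) : Function.Surjective (grad (convexPotential h)) := by
  intro y
  obtain ⟨C, -, hC⟩ := hp.exists_bound hs.continuous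
  have hv := contDiff_convexPotential hs
  set F : (Fin n → ℝ) → ℝ := fun x => convexPotential h x - ∑ a, y a * x a with hF
  have hlin : ContDiff ℝ ∞ fun x : Fin n → ℝ => ∑ a, y a * x a :=
    ContDiff.sum fun a _ => contDiff_const.mul (contDiff_apply ℝ ℝ a)
  have hFs : ContDiff ℝ ∞ F := hv.sub hlin
  have hbound : ∀ x, ‖x‖ * ((1 / 2) * ‖x‖ - ∑ a, |y a|) - C ≤ F x := by
    intro x
    have h1 : ‖x‖ ^ 2 ≤ ∑ a, x a ^ 2 := by
      rw [← Real.le_sqrt (norm_nonneg x), pi_norm_le_iff_of_nonneg (Real.sqrt_nonneg _)]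
      · exact fun a => Real.abs_le_sqrt (Finset.single_le_sum (f := fun a => x a ^ 2)
          (fun b _ => sq_nonneg _) (Finset.mem_univ a))
      · exact Finset.sum_nonneg fun a _ => sq_nonneg (x a)
    have h2 : ∑ a, y a * x a ≤ (∑ a, |y a|) * ‖x‖ := by
      rw [Finset.sum_mul]
      refine Finset.sum_le_sum fun a _ => ?_
      refine (le_abs_self _).trans ?_
      rw [abs_mul]
      exact mul_le_mul_of_nonneg_left (norm_le_pi_norm x a) (abs_nonneg _)
    have h3 := hC x
    rw [Real.norm_eq_abs, abs_le] at h3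
    simp only [hF, convexPotential]
    linarith [h3.1]
  have htend : Filter.Tendsto F (Filter.cocompact _) Filter.atTop := by
    refine Filter.tendsto_atTop_mono hbound ?_
    have hn := tendsto_norm_cocompact_atTop (E := Fin n → ℝ)
    refine Filter.tendsto_atTop_add_const_right _ _ (hn.atTop_mul_atTop₀ ?_)
    exact Filter.tendsto_atTop_add_const_right _ _ (hn.const_mul_atTop (by norm_num))
  obtain ⟨x, hx⟩ := hFs.continuous.exists_forall_le htend
  refine ⟨x, ?_⟩
  have hmin : IsLocalMin F x := Filter.Eventually.of_forall hx
  have h0 := hmin.fderiv_eq_zero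
  have h1 : fderiv ℝ F x = fderiv ℝ (convexPotential h) x -
      fderiv ℝ (fun x : Fin n → ℝ => ∑ a, y a * x a) x :=
    fderiv_fun_sub (hv.differentiable (by simp) x) (hlin.differentiable (by simp) x)
  have h2 : HasFDerivAt (fun x : Fin n → ℝ => ∑ a, y a * x a)
      (∑ a, y a • (ContinuousLinearMap.proj a : (Fin n → ℝ) →L[ℝ] ℝ)) x :=
    HasFDerivAt.fun_sum fun a _ => (hasFDerivAt_apply (𝕜 := ℝ) a x).const_mul (y a)
  rw [h0, h2.fderiv] at h1
  funext a
  have h3 := congrArg (fun L : (Fin n → ℝ) →L[ℝ] ℝ => L (Pi.single a 1)) h1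
  simp [Pi.single_apply] at h3
  simp only [grad, pd]
  linarith

/-- The gradient of the Legendre transform is a smooth inverse of the gradient. -/
theorem legendre_properties {h : (Fin n → ℝ) → ℝ} (hs : ContDiff ℝ ∞ h) (hp : IntPeriodic h)
    (hpos : ∀ x, (hess (convexPotential h) x).PosDef) :
    LegendreDual (legendre (convexPotential h)) (convexPotential h) ∧
    (∀ y, hess (legendre (convexPotential h)) y =
      (hess (convexPotential h) (grad (legendre (convexPotential h)) y))⁻¹) := by
  set v := convexPotential h with hvdef
  have hv : ContDiff ℝ ∞ v := contDiff_convexPotential hs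
  have hT := contDiff_grad hv
  have hinj := grad_injective hv hpos
  obtain ⟨X, hX⟩ := (grad_convexPotential_surjective hs hp).hasRightInverse
  rw [← hvdef] at hX
  have hXl : ∀ x, X (grad v x) = x := fun x => hinj (hX _)
  -- The inverse function theorem gives a smooth local inverse near each point; injectivity of the
  -- gradient forces it to agree with the chosen global inverse X.
  have hXs : ContDiff ℝ ∞ X := by
    rw [contDiff_iff_contDiffAt]
    intro y
    have hLinj : Function.Injective (fderiv ℝ (grad v) (X y) : (Fin n → ℝ) →ₗ[ℝ] (Fin n → ℝ)) := by
      rw [injective_iff_map_eq_zero]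
      intro d hd
      have hd' : (hess v (X y)).mulVec d = 0 := by rw [← fderiv_grad hv]; exact hd
      exact Matrix.eq_zero_of_mulVec_eq_zero (hpos (X y)).det_pos.ne' hd'
    let E : (Fin n → ℝ) ≃L[ℝ] (Fin n → ℝ) :=
      (LinearEquiv.ofInjectiveEndo _ hLinj).toContinuousLinearEquiv
    have hder : HasFDerivAt (grad v) (E : (Fin n → ℝ) →L[ℝ] (Fin n → ℝ)) (X y) :=
      (hT.differentiable (by simp) (X y)).hasFDerivAt.congr_fderiv
        (ContinuousLinearMap.ext fun _ => rfl)
    have hloc := hT.contDiffAt.to_localInverse hder (by simp)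
    have hr : ∀ᶠ w in nhds (grad v (X y)),
        grad v (hT.contDiffAt.localInverse hder (by simp) w) = w :=
      (hT.contDiffAt.hasStrictFDerivAt' hder (by simp)).eventually_right_inverse
    rw [hX y] at hloc hr
    refine hloc.congr_of_eventuallyEq ?_
    filter_upwards [hr] with w hw
    exact hinj ((hX w).trans hw.symm)
  have hu : ∀ y, legendre v y = ∑ a, y a * X y a - v (X y) := by
    intro y
    have := legendre_grad hv hpos (X y)
    rwa [hX y] at this
  have hus : ContDiff ℝ ∞ (legendre v) := by
    have : legendre v = fun y => ∑ a, y a * X y a - v (X y) := funext hu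
    rw [this]
    refine (ContDiff.sum fun a _ => ?_).sub (hv.comp hXs)
    exact (contDiff_apply ℝ ℝ a).mul (contDiff_pi.1 hXs a)
  have hgrad : ∀ y, grad (legendre v) y = X y := by
    intro y
    have hlin : HasFDerivAt (fun w : Fin n → ℝ => ∑ a, w a * X y a)
        (∑ a, X y a • (ContinuousLinearMap.proj a : (Fin n → ℝ) →L[ℝ] ℝ)) y :=
      HasFDerivAt.fun_sum fun a _ => (hasFDerivAt_apply (𝕜 := ℝ) a y).mul_const (X y a)
    -- Envelope argument: the affine function w ↦ w·X(y) - v(X(y)) lies below u and touches it at y,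
    -- so the two gradients agree there.
    have hmin : IsLocalMin (fun w => legendre v w - ∑ a, w a * X y a) y := by
      refine Filter.Eventually.of_forall fun w => ?_
      have h1 := gradient_inequality hv hpos (X w) (X y)
      rw [hX w, dotProduct_sub] at h1
      simp only [dotProduct] at h1
      simp only [hu]
      linarith
    have h0 := hmin.fderiv_eq_zero
    have h1 : fderiv ℝ (fun w => legendre v w - ∑ a, w a * X y a) y = fderiv ℝ (legendre v) y -
        fderiv ℝ (fun w : Fin n → ℝ => ∑ a, w a * X y a) y :=
      fderiv_fun_sub (hus.differentiable (by simp) y) hlin.differentiableAt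
    rw [h0, hlin.fderiv] at h1
    funext a
    have h3 := congrArg (fun L : (Fin n → ℝ) →L[ℝ] ℝ => L (Pi.single a 1)) h1
    simp [Pi.single_apply] at h3
    simp only [grad, pd]
    linarith
  refine ⟨⟨hus, hv, fun x y => ?_, fun x y hxy => ?_⟩, fun y => ?_⟩
  · rw [hgrad]
    exact ⟨fun hx => by rw [hx, hX], fun hy => by rw [hy, hXl]⟩
  · rw [hu, hxy, hXl]; ring
  · rw [hgrad]
    have hcomp : ∀ d, (hess v (X y)).mulVec (fderiv ℝ X y d) = d := by
      intro d
      rw [← fderiv_grad hv]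
      have h1 := (hT.differentiable (by simp) (X y)).hasFDerivAt.comp y
        (hXs.differentiable (by simp) y).hasFDerivAt
      have h2 : grad v ∘ X = id := funext hX
      rw [h2] at h1
      exact (congrArg (fun L : (Fin n → ℝ) →L[ℝ] (Fin n → ℝ) => L d)
        (h1.unique (hasFDerivAt_id y)))
    have hrow : ∀ a b, hess (legendre v) y a b = fderiv ℝ X y (Pi.single a 1) b := by
      intro a b
      have h1 : pd b (legendre v) = fun w => X w b := funext fun w => congrFun (hgrad w) b
      simp only [hess, Matrix.of_apply]
      have h2 := fderiv_pi fun b => (contDiff_pi.1 hXs b).differentiable (by simp) y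
      rw [h1]
      exact (congrArg (fun L : (Fin n → ℝ) →L[ℝ] (Fin n → ℝ) => L (Pi.single a 1) b) h2).symm
    have hinv : hess v (X y) * (hess (legendre v) y).transpose = 1 := by
      ext a b
      have h1 := congrFun (hcomp (Pi.single b 1)) a
      simp only [Matrix.mul_apply, Matrix.transpose_apply, hrow]
      simp only [Matrix.mulVec, dotProduct] at h1
      rw [h1, Matrix.one_apply, Pi.single_apply]
    rw [(hess_isSymm hus y).eq] at hinv
    exact (Matrix.inv_eq_right_inv hinv).symm

/-! ### Lattice-periodic functions on `ℂⁿ` -/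

theorem LatticePeriodic.exists_mem_box {E : Type*} {F : (Fin n → ℂ) → E}
    (hF : LatticePeriodic F) (z : Fin n → ℂ) :
    ∃ p ∈ Set.Icc (0 : Fin n → ℝ) 1 ×ˢ Set.Icc (0 : Fin n → ℝ) 1,
      F (fun a => (p.1 a : ℂ) + I * p.2 a) = F z := by
  refine ⟨(fun a => Int.fract (z a).re, fun a => Int.fract (z a).im),
    ⟨⟨fun a => Int.fract_nonneg _, fun a => (Int.fract_lt_one _).le⟩,
      ⟨fun a => Int.fract_nonneg _, fun a => (Int.fract_lt_one _).le⟩⟩, ?_⟩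
  rw [← hF z (fun a => -⌊(z a).re⌋) (fun a => -⌊(z a).im⌋)]
  congr 1
  funext a
  apply Complex.ext <;> simp [Int.fract, sub_eq_add_neg]

theorem LatticePeriodic.exists_forall_le {F : (Fin n → ℂ) → ℝ} (hF : LatticePeriodic F)
    (hc : Continuous F) : ∃ z₀, ∀ z, F z ≤ F z₀ := by
  have hj : Continuous fun p : (Fin n → ℝ) × (Fin n → ℝ) =>
      (fun a => (p.1 a : ℂ) + I * p.2 a : Fin n → ℂ) := by fun_prop
  obtain ⟨p, -, hp⟩ := (isCompact_Icc.prod isCompact_Icc).exists_isMaxOn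
    (s := Set.Icc (0 : Fin n → ℝ) 1 ×ˢ Set.Icc (0 : Fin n → ℝ) 1)
    ⟨(0, 0), by simp⟩ (hc.comp hj).continuousOn
  refine ⟨fun a => (p.1 a : ℂ) + I * p.2 a, fun z => ?_⟩
  obtain ⟨q, hq, hqz⟩ := hF.exists_mem_box z
  rw [← hqz]
  exact hp hq

theorem fderiv_translate {E : Type*} [NormedAddCommGroup E] [NormedSpace ℝ E]
    (F : (Fin n → ℂ) → E) (z t : Fin n → ℂ) :
    fderiv ℝ (fun ζ => F (fun a => ζ a + t a)) z = fderiv ℝ F (fun a => z a + t a) :=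
  fderiv_comp_add_right (𝕜 := ℝ) (f := F) (x := z) t

theorem dz_translate (F : (Fin n → ℂ) → ℂ) (a : Fin n) (z t : Fin n → ℂ) :
    dz a (fun ζ => F (fun b => ζ b + t b)) z = dz a F (fun b => z b + t b) := by
  simp only [dz, fderiv_translate]

theorem dzbar_translate (F : (Fin n → ℂ) → ℂ) (a : Fin n) (z t : Fin n → ℂ) :
    dzbar a (fun ζ => F (fun b => ζ b + t b)) z = dzbar a F (fun b => z b + t b) := by
  simp only [dzbar, fderiv_translate]

theorem ContDiff.dzbar {F : (Fin n → ℂ) → ℂ} (hF : ContDiff ℝ ∞ F) (a : Fin n) :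
    ContDiff ℝ ∞ (HcscK.dzbar a F) := by
  have h1 : ContDiff ℝ ∞ (fderiv ℝ F) := hF.fderiv_right (m := ∞) (by simp)
  unfold HcscK.dzbar
  exact contDiff_const.mul ((h1.clm_apply contDiff_const).add
    (contDiff_const.mul (h1.clm_apply contDiff_const)))

theorem latticePeriodic_dzbar {F : (Fin n → ℂ) → ℂ} (hF : LatticePeriodic F) (a : Fin n) :
    LatticePeriodic (dzbar a F) := by
  intro z k l
  have h1 := dzbar_translate F a z fun b => (k b : ℂ) + I * (l b : ℂ)
  have h2 : (fun ζ => F (fun b => ζ b + ((k b : ℂ) + I * (l b : ℂ)))) = F := by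
    funext ζ
    rw [← hF ζ k l]
    simp only [add_assoc]
  rw [h2] at h1
  rw [h1]
  simp only [add_assoc]

theorem dz_sub {F H : (Fin n → ℂ) → ℂ} {a : Fin n} {z : Fin n → ℂ}
    (hF : DifferentiableAt ℝ F z) (hH : DifferentiableAt ℝ H z) :
    dz a (fun ζ => F ζ - H ζ) z = dz a F z - dz a H z := by
  unfold dz
  rw [fderiv_fun_sub hF hH]
  simp only [sub_apply]
  ring

theorem dzbar_sub {F H : (Fin n → ℂ) → ℂ} {a : Fin n} {z : Fin n → ℂ}
    (hF : DifferentiableAt ℝ F z) (hH : DifferentiableAt ℝ H z) :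
    dzbar a (fun ζ => F ζ - H ζ) z = dzbar a F z - dzbar a H z := by
  unfold dzbar
  rw [fderiv_fun_sub hF hH]
  simp only [sub_apply]
  ring

theorem sum_single_complex (d : Fin n → ℂ) :
    d = ∑ a, ((d a).re • (Pi.single a 1 : Fin n → ℂ) + (d a).im • (Pi.single a I : Fin n → ℂ)) := by
  conv_lhs => rw [← Finset.univ_sum_single d]
  refine Finset.sum_congr rfl fun a _ => ?_
  rw [← Pi.single_smul, ← Pi.single_smul, ← Pi.single_add]
  congr 1
  simp [Complex.re_add_im]

/-- A lattice-periodic antiholomorphic function is constant. -/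
theorem LatticePeriodic.eq_of_dz_eq_zero {H : (Fin n → ℂ) → ℂ} (hp : LatticePeriodic H)
    (hs : ContDiff ℝ ∞ H) (h0 : ∀ a z, dz a H z = 0) (z w : Fin n → ℂ) : H z = H w := by
  have hI : ∀ a z, fderiv ℝ H z (Pi.single a I) = -I * fderiv ℝ H z (Pi.single a 1) := by
    intro a z
    have := h0 a z
    unfold dz at this
    have h2 : fderiv ℝ H z (Pi.single a 1) - I * fderiv ℝ H z (Pi.single a I) = 0 := by
      simpa using this
    linear_combination I * h2 + fderiv ℝ H z (Pi.single a I) * Complex.I_mul_I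
  set K : (Fin n → ℂ) → ℂ := fun z => starRingEnd ℂ (H z) with hK
  have hder : ∀ z, HasFDerivAt K
      ((Complex.conjCLE : ℂ →L[ℝ] ℂ).comp (fderiv ℝ H z)) z := fun z =>
    (Complex.conjCLE : ℂ →L[ℝ] ℂ).hasFDerivAt.comp z (hs.differentiable (by simp) z).hasFDerivAt
  -- The conjugate of H has a complex-linear differential; it is entire and, by periodicity,
  -- bounded, so Liouville's theorem applies.
  have hdiff : Differentiable ℂ K := by
    intro z
    have hlin : ∀ d : Fin n → ℂ, starRingEnd ℂ (fderiv ℝ H z d) =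
        ∑ a, d a * starRingEnd ℂ (fderiv ℝ H z (Pi.single a 1)) := by
      intro d
      conv_lhs => rw [sum_single_complex d]
      simp only [map_sum, map_add, map_smul, hI]
      refine Finset.sum_congr rfl fun a _ => ?_
      conv_rhs => rw [← Complex.re_add_im (d a)]
      simp only [Complex.real_smul, map_mul, Complex.conj_ofReal, map_neg, Complex.conj_I]
      ring
    let L : (Fin n → ℂ) →L[ℂ] ℂ := ∑ a, starRingEnd ℂ (fderiv ℝ H z (Pi.single a 1)) •
      (ContinuousLinearMap.proj a : (Fin n → ℂ) →L[ℂ] ℂ)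
    refine (hasFDerivAt_of_restrictScalars ℝ (hder z) (f' := L) ?_).differentiableAt
    ext d
    simp only [L, ContinuousLinearMap.coe_restrictScalars', sum_apply, smul_apply,
      ContinuousLinearMap.proj_apply, smul_eq_mul]
    refine Eq.trans ?_ (hlin d).symm
    exact Finset.sum_congr rfl fun a _ => mul_comm _ _
  have hbdd : Bornology.IsBounded (Set.range K) := by
    obtain ⟨z₀, hz₀⟩ := LatticePeriodic.exists_forall_le (F := fun z => ‖H z‖)
      (fun z k l => by simp only [hp z k l]) hs.continuous.norm
    rw [isBounded_iff_forall_norm_le]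
    refine ⟨‖H z₀‖, ?_⟩
    rintro _ ⟨z, rfl⟩
    simpa [hK] using hz₀ z
  exact (starRingEnd ℂ).injective (hdiff.apply_eq_apply_of_bounded hbdd z w)

/-- A lattice-periodic real pluriharmonic function is constant. -/
theorem LatticePeriodic.eq_of_pluriharmonic {F : (Fin n → ℂ) → ℝ} (hp : LatticePeriodic F)
    (hs : ContDiff ℝ ∞ F)
    (h0 : ∀ a b z, dz a (dzbar b (fun ζ => (F ζ : ℂ))) z = 0) (z w : Fin n → ℂ) : F z = F w := by
  have hFc : ContDiff ℝ ∞ fun ζ => (F ζ : ℂ) := Complex.ofRealCLM.contDiff.comp hs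
  have hpc : LatticePeriodic fun ζ => (F ζ : ℂ) := fun z k l => by simp only [hp z k l]
  have hd : ∀ z, fderiv ℝ (fun ζ => (F ζ : ℂ)) z = Complex.ofRealCLM.comp (fderiv ℝ F z) :=
    fun z => (Complex.ofRealCLM.hasFDerivAt.comp z
      (hs.differentiable (by simp) z).hasFDerivAt).fderiv
  obtain ⟨z₀, hz₀⟩ := hp.exists_forall_le hs.continuous
  have hmax : fderiv ℝ F z₀ = 0 := IsLocalMax.fderiv_eq_zero (Filter.Eventually.of_forall hz₀)
  have hb : ∀ b z, dzbar b (fun ζ => (F ζ : ℂ)) z = 0 := by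
    intro b z
    -- Each ∂_z̄ derivative is antiholomorphic and periodic, hence constant, and it vanishes at the
    -- maximum z₀.
    rw [(latticePeriodic_dzbar hpc b).eq_of_dz_eq_zero (ContDiff.dzbar hFc b) (fun a z => h0 a b z) z z₀]
    simp [dzbar, hd, hmax]
  refine is_const_of_fderiv_eq_zero (𝕜 := ℝ) (hs.differentiable (by simp)) (fun z => ?_) z w
  ext d
  have hcomp : ∀ b, fderiv ℝ F z (Pi.single b 1) = 0 ∧ fderiv ℝ F z (Pi.single b I) = 0 := by
    intro b
    have h1 := hb b z
    simp only [dzbar, hd, ContinuousLinearMap.comp_apply, Complex.ofRealCLM_apply] at h1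
    have h2 : ((fderiv ℝ F z (Pi.single b 1) : ℝ) : ℂ) +
        I * ((fderiv ℝ F z (Pi.single b I) : ℝ) : ℂ) = 0 := by simpa using h1
    exact ⟨by simpa using congrArg Complex.re h2, by simpa using congrArg Complex.im h2⟩
  conv_lhs => rw [sum_single_complex d]
  simp [map_sum, hcomp]

/-! ### The invariant potential -/

/-- Invariance of i∂∂̄φ makes φ(· + τ) - φ pluriharmonic and periodic, hence constant. -/
theorem torusInvariant_of_ddbar {φ : (Fin n → ℂ) → ℝ} (hs : ContDiff ℝ ∞ φ)
    (hp : LatticePeriodic φ)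
    (hT : ∀ a b, TorusInvariant (dz a (dzbar b (fun ζ => (φ ζ : ℂ))))) : TorusInvariant φ := by
  intro z t
  set τ : Fin n → ℂ := fun a => I * (t a : ℂ)
  have hτ : ContDiff ℝ ∞ fun ζ : Fin n → ℂ => (fun a => ζ a + τ a) :=
    contDiff_id.add contDiff_const
  have hφc : ContDiff ℝ ∞ fun ζ => (φ ζ : ℂ) := Complex.ofRealCLM.contDiff.comp hs
  have hφt : ContDiff ℝ ∞ fun ζ : Fin n → ℂ => (φ (fun a => ζ a + τ a) : ℂ) := hφc.comp hτ
  have hpt : LatticePeriodic fun ζ : Fin n → ℂ => φ (fun a => ζ a + τ a) := by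
    intro z k l
    have := hp (fun a => z a + τ a) k l
    refine Eq.trans ?_ this
    refine congrArg φ (funext fun a => ?_)
    ring
  have hconst : ∀ z w, φ (fun a => z a + τ a) - φ z = φ (fun a => w a + τ a) - φ w := by
    refine LatticePeriodic.eq_of_pluriharmonic (F := fun z => φ (fun a => z a + τ a) - φ z)
      (fun z k l => ?_) ((hs.comp hτ).sub hs) fun a b z => ?_
    · simp only [hp z k l, hpt z k l]
    · have h1 : dzbar b (fun ζ : Fin n → ℂ => ((φ (fun a => ζ a + τ a) - φ ζ : ℝ) : ℂ)) =
          fun ζ : Fin n → ℂ => dzbar b (fun ζ => (φ ζ : ℂ)) (fun a => ζ a + τ a) -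
            dzbar b (fun ζ => (φ ζ : ℂ)) ζ := by
        funext ζ
        simp only [Complex.ofReal_sub]
        rw [dzbar_sub (hφt.differentiable (by simp) ζ) (hφc.differentiable (by simp) ζ)]
        rw [dzbar_translate (fun ζ => (φ ζ : ℂ))]
      have h2 : DifferentiableAt ℝ (fun ζ : Fin n → ℂ =>
          dzbar b (fun ζ => (φ ζ : ℂ)) (fun a => ζ a + τ a)) z :=
        ((ContDiff.dzbar hφc b).comp hτ).differentiable (by simp) z
      rw [h1, dz_sub h2
        ((ContDiff.dzbar hφc b).differentiable (by simp) z), dz_translate, hT a b z t, sub_self]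
  -- The constant difference is ≤ 0 when evaluated at a maximum of φ and ≥ 0 at a minimum.
  obtain ⟨z₁, hz₁⟩ := hp.exists_forall_le hs.continuous
  obtain ⟨z₂, hz₂⟩ := LatticePeriodic.exists_forall_le (F := fun z => -φ z)
    (fun z k l => by simp only [hp z k l]) hs.continuous.neg
  have h1 := hconst z z₁
  have h2 := hconst z z₂
  have h3 := hz₁ fun a => z₁ a + τ a
  have h4 := hz₂ fun a => z₂ a + τ a
  change φ (fun a => z a + τ a) = φ z
  linarith

theorem hess_convexPotential {h : (Fin n → ℝ) → ℝ} (hs : ContDiff ℝ ∞ h) (x : Fin n → ℝ)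
    (a b : Fin n) :
    hess (convexPotential h) x a b = (1 : Matrix (Fin n) (Fin n) ℝ) a b + pd a (pd b h) x := by
  have h1 : pd b (convexPotential h) = fun x => x b + pd b h x :=
    funext fun x => congrFun (grad_convexPotential hs x) b
  have h2 := (hasFDerivAt_apply (𝕜 := ℝ) (F' := fun _ : Fin n => ℝ) b x).add
    ((ContDiff.pd hs b).differentiable (by simp) x).hasFDerivAt
  simp only [hess, Matrix.of_apply]
  rw [h1]
  unfold pd at h2 ⊢
  refine (congrArg (fun L : (Fin n → ℝ) →L[ℝ] ℝ => L (Pi.single a 1)) h2.fderiv).trans ?_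
  simp only [add_apply, ContinuousLinearMap.proj_apply, Matrix.one_apply, Pi.single_apply]
  congr 1
  simp [eq_comm]

theorem hasFDerivAt_sum_norm_sq (z : Fin n → ℂ) :
    HasFDerivAt (fun ζ : Fin n → ℂ => ((∑ a, ‖ζ a‖ ^ 2 : ℝ) : ℂ))
      (Complex.ofRealCLM.comp (∑ a, ((2 * (z a).re) • Complex.reCLM.comp
        (ContinuousLinearMap.proj a : (Fin n → ℂ) →L[ℝ] ℂ) + (2 * (z a).im) • Complex.imCLM.comp
        (ContinuousLinearMap.proj a : (Fin n → ℂ) →L[ℝ] ℂ)))) z := by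
  have h0 : HasFDerivAt (fun ζ : Fin n → ℂ => ∑ a, ‖ζ a‖ ^ 2)
      (∑ a, ((2 * (z a).re) • Complex.reCLM.comp
        (ContinuousLinearMap.proj a : (Fin n → ℂ) →L[ℝ] ℂ) + (2 * (z a).im) • Complex.imCLM.comp
        (ContinuousLinearMap.proj a : (Fin n → ℂ) →L[ℝ] ℂ))) z := by
    refine HasFDerivAt.fun_sum fun a _ => ?_
    have h1 : HasFDerivAt (fun ζ : Fin n → ℂ => (ζ a).re)
        (Complex.reCLM.comp (ContinuousLinearMap.proj a : (Fin n → ℂ) →L[ℝ] ℂ)) z :=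
      Complex.reCLM.hasFDerivAt.comp z (hasFDerivAt_apply (𝕜 := ℝ) a z)
    have h2 : HasFDerivAt (fun ζ : Fin n → ℂ => (ζ a).im)
        (Complex.imCLM.comp (ContinuousLinearMap.proj a : (Fin n → ℂ) →L[ℝ] ℂ)) z :=
      Complex.imCLM.hasFDerivAt.comp z (hasFDerivAt_apply (𝕜 := ℝ) a z)
    have h3 := (h1.pow 2).add (h2.pow 2)
    have h4 : (fun ζ : Fin n → ℂ => ‖ζ a‖ ^ 2) = fun ζ => (ζ a).re ^ 2 + (ζ a).im ^ 2 := by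
      funext ζ
      rw [← Complex.normSq_eq_norm_sq, Complex.normSq_apply]
      ring
    rw [h4]
    refine h3.congr_fderiv ?_
    simp
  exact Complex.ofRealCLM.hasFDerivAt.comp z h0

theorem dzbar_localPotential {h : (Fin n → ℝ) → ℝ} (hs : ContDiff ℝ ∞ h) (b : Fin n)
    (z : Fin n → ℂ) :
    dzbar b (fun ζ => (localPotential h ζ : ℂ)) z =
      z b + 2 * ((pd b h (rePart z) : ℝ) : ℂ) := by
  have h1 := hasFDerivAt_sum_norm_sq z
  have hc : ContDiff ℝ ∞ fun x => ((4 * h x : ℝ) : ℂ) :=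
    Complex.ofRealCLM.contDiff.comp (contDiff_const.mul hs)
  have h2 : DifferentiableAt ℝ (fun ζ => (fun x => ((4 * h x : ℝ) : ℂ)) (rePart ζ)) z :=
    (hc.comp (reCLM n).contDiff).differentiable (by simp) z
  have h3 : (fun ζ => (localPotential h ζ : ℂ)) = fun ζ : Fin n → ℂ =>
      ((∑ a, ‖ζ a‖ ^ 2 : ℝ) : ℂ) + (fun x => ((4 * h x : ℝ) : ℂ)) (rePart ζ) := by
    funext ζ; simp [localPotential]
  have h4 := dzbar_comp_rePart b (fun x => ((4 * h x : ℝ) : ℂ)) z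
  have h5 : pd b (fun x => ((4 * h x : ℝ) : ℂ)) (rePart z) =
      4 * ((pd b h (rePart z) : ℝ) : ℂ) := by
    simp only [Complex.ofReal_mul]
    rw [pd_const_mul, pd_ofReal (hs.differentiable (by simp) _)]
    simp
  rw [h5] at h4
  rw [h3]
  unfold dzbar at h4 ⊢
  rw [fderiv_fun_add h1.differentiableAt h2, h1.fderiv, add_apply, add_apply]
  have h6 : z b = (1 / 2 : ℂ) * (2 * ((z b).re : ℂ) + I * (2 * ((z b).im : ℂ))) := by
    conv_lhs => rw [← Complex.re_add_im (z b)]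
    ring
  rw [show (2 : ℂ) * ((pd b h (rePart z) : ℝ) : ℂ) =
    1 / 2 * (4 * ((pd b h (rePart z) : ℝ) : ℂ)) by ring, ← h4]
  conv_rhs => rw [h6]
  simp [Pi.single_apply, apply_ite]
  ring

/-- The coefficient 4 of h cancels the two factors ½ of ∂∂̄, while |z|² contributes the identity;
the sum is the Hessian of |x|²/2 + h. -/
theorem ddbar_localPotential {h : (Fin n → ℝ) → ℝ} (hs : ContDiff ℝ ∞ h) (a b : Fin n)
    (z : Fin n → ℂ) :
    dz a (dzbar b (fun ζ => (localPotential h ζ : ℂ))) z =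
      hessC (convexPotential h) (rePart z) a b := by
  have h1 : dzbar b (fun ζ => (localPotential h ζ : ℂ)) =
      fun ζ => ζ b + (fun x => 2 * ((pd b h x : ℝ) : ℂ)) (rePart ζ) :=
    funext fun ζ => dzbar_localPotential hs b ζ
  have hc : ContDiff ℝ ∞ fun x => 2 * ((pd b h x : ℝ) : ℂ) :=
    contDiff_const.mul (Complex.ofRealCLM.contDiff.comp (ContDiff.pd hs b))
  have h2 : DifferentiableAt ℝ (fun ζ => (fun x => 2 * ((pd b h x : ℝ) : ℂ)) (rePart ζ)) z :=
    (hc.comp (reCLM n).contDiff).differentiable (by simp) z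
  have h3 := hasFDerivAt_apply (𝕜 := ℝ) (F' := fun _ : Fin n => ℂ) b z
  have h4 := dz_comp_rePart a (fun x => 2 * ((pd b h x : ℝ) : ℂ)) z
  rw [pd_const_mul, pd_ofReal ((ContDiff.pd hs b).differentiable (by simp) _)] at h4
  rw [h1, hessC, Matrix.map_apply, hess_convexPotential hs]
  unfold dz at h4 ⊢
  rw [fderiv_fun_add h3.differentiableAt h2, h3.fderiv, add_apply, add_apply]
  push_cast
  rw [show ((pd a (pd b h) (rePart z) : ℝ) : ℂ) =
    1 / 2 * (2 * ((pd a (pd b h) (rePart z) : ℝ) : ℂ)) by ring, ← h4]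
  have h5 : I * I = -1 := Complex.I_mul_I
  by_cases hab : a = b
  · subst hab
    simp only [ContinuousLinearMap.proj_apply, Pi.single_eq_same, Matrix.one_apply_eq,
      Complex.ofReal_one]
    linear_combination (-1 / 2 : ℂ) * h5
  · simp [Matrix.one_apply_ne hab, Ne.symm hab]

theorem pd_const_mul_real {a : Fin n} {F : (Fin n → ℝ) → ℝ} {x : Fin n → ℝ} (c : ℝ)
    (hF : DifferentiableAt ℝ F x) : pd a (fun x => c * F x) x = c * pd a F x := by
  unfold pd
  rw [fderiv_const_mul hF]
  rfl

/-- The witness is a quarter of φ on the real slice: φ depends on x only, and `localPotential`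
carries the factor 4. -/
theorem exists_invariantPotential {g : (Fin n → ℂ) → Matrix (Fin n) (Fin n) ℂ}
    (hg : IsKahlerFormInClass g) (hgT : TorusInvariant g) : ∃ h, IsInvariantPotential g h := by
  obtain ⟨φ, hs, hp, hφ⟩ := hg.cohomologous
  have hT : TorusInvariant φ := by
    refine torusInvariant_of_ddbar hs hp fun a b z t => ?_
    have h1 := hφ z a b
    rw [← hgT z t, hφ] at h1
    exact add_left_cancel h1
  have hhs : ContDiff ℝ ∞ fun x => (1 / 4 : ℝ) * φ (realPoint x) :=
    contDiff_const.mul (hs.comp contDiff_realPoint)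
  refine ⟨fun x => (1 / 4) * φ (realPoint x), hhs, fun x k => ?_, fun z a b => ?_⟩
  · have := hp (realPoint x) k 0
    simp only [Pi.zero_apply, Int.cast_zero, mul_zero, add_zero] at this
    change _ * φ (realPoint fun a => x a + (k a : ℝ)) = _
    rw [← this]
    congr 2
    funext a
    simp [realPoint]
  · rw [ddbar_localPotential hhs, hessC, Matrix.map_apply, hess_convexPotential hhs, hφ]
    have hre : (fun ζ => (φ ζ : ℂ)) = fun ζ => (fun x => (φ (realPoint x) : ℂ)) (rePart ζ) :=
      funext fun ζ => by rw [hT.eq_comp_rePart ζ]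
    have h1 : dz a (dzbar b (fun ζ => (φ ζ : ℂ))) z = 1 / 2 * pd a (fun x =>
        (1 / 2 : ℂ) * pd b (fun x => (φ (realPoint x) : ℂ)) x) (rePart z) := by
      have h0 : dzbar b (fun ζ => (φ ζ : ℂ)) = fun ζ => (fun x =>
          (1 / 2 : ℂ) * pd b (fun x => (φ (realPoint x) : ℂ)) x) (rePart ζ) := by
        funext ζ
        rw [hre]
        exact dzbar_comp_rePart b (fun x => (φ (realPoint x) : ℂ)) ζ
      rw [h0]
      exact dz_comp_rePart a (fun x =>
        (1 / 2 : ℂ) * pd b (fun x => (φ (realPoint x) : ℂ)) x) z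
    rw [h1, pd_const_mul]
    have hφr : ContDiff ℝ ∞ fun x => φ (realPoint x) := hs.comp contDiff_realPoint
    have h2 : pd b (fun x => (φ (realPoint x) : ℂ)) =
        fun x => ((pd b (fun x => φ (realPoint x)) x : ℝ) : ℂ) :=
      funext fun x => pd_ofReal (hφr.differentiable (by simp) x)
    have h3 : pd b (fun x => (1 / 4 : ℝ) * φ (realPoint x)) =
        fun x => (1 / 4 : ℝ) * pd b (fun x => φ (realPoint x)) x := by
      exact funext fun x => pd_const_mul_real _ (hφr.differentiable (by simp) x)
    have h4 : pd a (fun x => (1 / 4 : ℝ) * pd b (fun x => φ (realPoint x)) x) (rePart z) =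
        (1 / 4 : ℝ) * pd a (pd b (fun x => φ (realPoint x))) (rePart z) :=
      pd_const_mul_real _ ((ContDiff.pd hφr b).differentiable (by simp) _)
    rw [h2, pd_ofReal ((ContDiff.pd hφr b).differentiable (by simp) _), h3, h4]
    by_cases hab : a = b
    · subst hab; push_cast; simp; ring
    · simp [Matrix.one_apply_ne hab]; ring

/-! ### Kähler geometry of a torus-invariant metric -/

/-- `g = W(x)` and `α = A(x)` depend only on `x = Re z`, and `W` is the complexification of the
Hessian of a smooth convex function. -/
structure InvariantData (g α : (Fin n → ℂ) → Matrix (Fin n) (Fin n) ℂ)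
    (W A : (Fin n → ℝ) → Matrix (Fin n) (Fin n) ℂ) : Prop where
  metric : ∀ z, g z = W (rePart z)
  higgs : ∀ z, α z = A (rePart z)
  smoothW : MatSmooth W
  smoothA : MatSmooth A
  symm : ∀ x, (W x).transpose = W x
  real : ∀ x, conj (W x) = W x
  posDef : ∀ x, (W x).PosDef
  hessian : ∀ x a b c, mpd a W x b c = mpd b W x a c

/-- The derivative `∂/∂yᵃ = ∑ W^{ab} ∂/∂xᵇ` in the symplectic coordinates, as an operator in `x`. -/
def dy (W : (Fin n → ℝ) → Matrix (Fin n) (Fin n) ℂ) (a : Fin n) (F : (Fin n → ℝ) → ℂ)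
    (x : Fin n → ℝ) : ℂ :=
  ∑ b, (W x)⁻¹ a b * pd b F x

theorem dy_sum {ι : Type*} {s : Finset ι} (W : (Fin n → ℝ) → Matrix (Fin n) (Fin n) ℂ)
    {a : Fin n} {F : ι → (Fin n → ℝ) → ℂ} {x : Fin n → ℝ}
    (hF : ∀ i ∈ s, DifferentiableAt ℝ (F i) x) :
    dy W a (fun x => ∑ i ∈ s, F i x) x = ∑ i ∈ s, dy W a (F i) x := by
  unfold dy
  rw [Finset.sum_comm]
  refine Finset.sum_congr rfl fun b _ => ?_
  rw [pd_sum hF, Finset.mul_sum]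

theorem dy_mul (W : (Fin n → ℝ) → Matrix (Fin n) (Fin n) ℂ) {a : Fin n}
    {F H : (Fin n → ℝ) → ℂ} {x : Fin n → ℝ}
    (hF : DifferentiableAt ℝ F x) (hH : DifferentiableAt ℝ H x) :
    dy W a (fun x => F x * H x) x = dy W a F x * H x + F x * dy W a H x := by
  unfold dy
  rw [Finset.sum_mul, Finset.mul_sum, ← Finset.sum_add_distrib]
  refine Finset.sum_congr rfl fun b _ => ?_
  rw [pd_mul hF hH]
  ring

theorem dy_add (W : (Fin n → ℝ) → Matrix (Fin n) (Fin n) ℂ) {a : Fin n}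
    {F H : (Fin n → ℝ) → ℂ} {x : Fin n → ℝ}
    (hF : DifferentiableAt ℝ F x) (hH : DifferentiableAt ℝ H x) :
    dy W a (fun x => F x + H x) x = dy W a F x + dy W a H x := by
  unfold dy
  rw [← Finset.sum_add_distrib]
  refine Finset.sum_congr rfl fun b _ => ?_
  rw [pd_add hF hH]
  ring

theorem dy_const_mul (W : (Fin n → ℝ) → Matrix (Fin n) (Fin n) ℂ) (a : Fin n) (c : ℂ)
    (F : (Fin n → ℝ) → ℂ) (x : Fin n → ℝ) :
    dy W a (fun x => c * F x) x = c * dy W a F x := by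
  unfold dy
  rw [Finset.mul_sum]
  refine Finset.sum_congr rfl fun b _ => ?_
  rw [pd_const_mul]
  ring

/-- The trace `∑_c (∂_c W · W⁻¹)_{ac} = 2 Γ^c_{ca}` of the Christoffel symbols. -/
def christoffelTrace (W : (Fin n → ℝ) → Matrix (Fin n) (Fin n) ℂ) (a : Fin n)
    (x : Fin n → ℝ) : ℂ :=
  ∑ c, (mpd c W x * (W x)⁻¹) a c

theorem conj_trace (M : Matrix (Fin n) (Fin n) ℂ) :
    starRingEnd ℂ M.trace = (conj M).trace := by
  simp [Matrix.trace, conj]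

theorem conj_inv (M : Matrix (Fin n) (Fin n) ℂ) (hM : IsUnit M.det) :
    conj M⁻¹ = (conj M)⁻¹ := by
  symm
  refine Matrix.inv_eq_right_inv ?_
  rw [← conj_mul, Matrix.mul_nonsing_inv _ hM]
  ext i j
  by_cases h : i = j
  · subst h; simp [conj]
  · simp [conj, h]

namespace InvariantData

variable {g α : (Fin n → ℂ) → Matrix (Fin n) (Fin n) ℂ}
  {W A : (Fin n → ℝ) → Matrix (Fin n) (Fin n) ℂ}

theorem unit (h : InvariantData g α W A) (x : Fin n → ℝ) : IsUnit (W x).det :=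
  (Matrix.isUnit_iff_isUnit_det _).1 (h.posDef x).isUnit

theorem smoothInv (h : InvariantData g α W A) : MatSmooth fun x => (W x)⁻¹ :=
  h.smoothW.inv h.unit

theorem inv_symm (h : InvariantData g α W A) (x : Fin n → ℝ) (a b : Fin n) :
    (W x)⁻¹ a b = (W x)⁻¹ b a := by
  have := congrFun (congrFun (Matrix.transpose_nonsing_inv (W x)) b) a
  rw [h.symm, Matrix.transpose_apply] at this
  exact this

theorem inv_real (h : InvariantData g α W A) (x : Fin n → ℝ) : conj (W x)⁻¹ = (W x)⁻¹ := by
  rw [conj_inv _ (h.unit x), h.real]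

theorem inv_real_apply (h : InvariantData g α W A) (x : Fin n → ℝ) (a b : Fin n) :
    starRingEnd ℂ ((W x)⁻¹ a b) = (W x)⁻¹ a b :=
  congrFun (congrFun (h.inv_real x) a) b

theorem mpd_real (h : InvariantData g α W A) (x : Fin n → ℝ) (a : Fin n) :
    conj (mpd a W x) = mpd a W x := by
  rw [← mpd_conj]
  congr 1
  exact funext h.real

theorem mpd_symm (h : InvariantData g α W A) (x : Fin n → ℝ) (a b c : Fin n) :
    mpd a W x b c = mpd a W x c b := by
  simp only [mpd_apply]
  congr 1
  funext x
  exact congrFun (congrFun (h.symm x) c) b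

theorem contDiff_dy (h : InvariantData g α W A) {F : (Fin n → ℝ) → ℂ} (hF : ContDiff ℝ ∞ F)
    (a : Fin n) : ContDiff ℝ ∞ (dy W a F) :=
  ContDiff.sum fun b _ => (h.smoothInv a b).mul (ContDiff.pd hF b)

theorem dy_conj (h : InvariantData g α W A) (F : (Fin n → ℝ) → ℂ) (a : Fin n) (x : Fin n → ℝ) :
    dy W a (fun x => starRingEnd ℂ (F x)) x = starRingEnd ℂ (dy W a F x) := by
  unfold dy
  rw [map_sum]
  refine Finset.sum_congr rfl fun b _ => ?_
  rw [pd_conj, map_mul, h.inv_real_apply]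

/-- The operator `dy` has real coefficients and so commutes with taking real parts. This is needed
because the lowered field X is identified only up to its imaginary part. -/
theorem re_dy_congr (h : InvariantData g α W A) {F H : (Fin n → ℝ) → ℂ}
    (hF : ContDiff ℝ ∞ F) (hH : ContDiff ℝ ∞ H) (hFH : ∀ x, (F x).re = (H x).re)
    (a : Fin n) (x : Fin n → ℝ) : (dy W a F x).re = (dy W a H x).re := by
  have hc : ∀ {K : (Fin n → ℝ) → ℂ}, ContDiff ℝ ∞ K →
      dy W a (fun x => K x + starRingEnd ℂ (K x)) x = ((2 * (dy W a K x).re : ℝ) : ℂ) := by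
    intro K hK
    have hK' : ContDiff ℝ ∞ fun x => starRingEnd ℂ (K x) :=
      Complex.conjLIE.toContinuousLinearEquiv.contDiff.comp hK
    rw [dy_add W (hK.diffAt x) (hK'.diffAt x), h.dy_conj, Complex.add_conj]
  have h1 : (fun x => F x + starRingEnd ℂ (F x)) = fun x => H x + starRingEnd ℂ (H x) := by
    funext x
    rw [Complex.add_conj, Complex.add_conj, hFH]
  have h2 := hc hF
  rw [h1, hc hH] at h2
  have := Complex.ofReal_injective h2
  linarith

theorem ginv_eq (h : InvariantData g α W A) (z : Fin n → ℂ) (a b : Fin n) :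
    ginv g z a b = (W (rePart z))⁻¹ a b := by
  unfold ginv
  rw [h.metric, h.inv_symm]

theorem dz_metric (h : InvariantData g α W A) (z : Fin n → ℂ) (a b c : Fin n) :
    dz a (fun ζ => g ζ b c) z = (1 / 2) * mpd a W (rePart z) b c := by
  simp only [h.metric]
  exact dz_comp_rePart a (fun x => W x b c) z

theorem dz_higgs (h : InvariantData g α W A) (z : Fin n → ℂ) (a b c : Fin n) :
    dz a (fun ζ => α ζ b c) z = (1 / 2) * mpd a A (rePart z) b c := by
  simp only [h.higgs]
  exact dz_comp_rePart a (fun x => A x b c) z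

theorem dzbar_higgs (h : InvariantData g α W A) (z : Fin n → ℂ) (a b c : Fin n) :
    dzbar a (fun ζ => α ζ b c) z = (1 / 2) * mpd a A (rePart z) b c := by
  simp only [h.higgs]
  exact dzbar_comp_rePart a (fun x => A x b c) z

theorem christoffel_eq (h : InvariantData g α W A) (z : Fin n → ℂ) (c a b : Fin n) :
    christoffel g z c a b =
      (1 / 2) * (mpd a W (rePart z) * (W (rePart z))⁻¹) b c := by
  unfold christoffel
  simp only [h.ginv_eq, h.dz_metric, Matrix.mul_apply, Finset.mul_sum]
  refine Finset.sum_congr rfl fun d _ => ?_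
  rw [h.inv_symm _ d c]
  ring

theorem christoffel_real (h : InvariantData g α W A) (z : Fin n → ℂ) (c a b : Fin n) :
    starRingEnd ℂ (christoffel g z c a b) = christoffel g z c a b := by
  rw [h.christoffel_eq, map_mul]
  have h1 : conj (mpd a W (rePart z) * (W (rePart z))⁻¹) =
      mpd a W (rePart z) * (W (rePart z))⁻¹ := by
    rw [conj_mul, h.mpd_real, h.inv_real]
  have h2 := congrFun (congrFun h1 b) c
  simp only [conj, Matrix.map_apply] at h2
  rw [h2]
  congr 1
  norm_num [Complex.ext_iff]

theorem sum_christoffel (h : InvariantData g α W A) (z : Fin n → ℂ) (a : Fin n) :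
    ∑ c, christoffel g z c c a = (1 / 2) * christoffelTrace W a (rePart z) := by
  simp only [h.christoffel_eq, christoffelTrace, Finset.mul_sum]

theorem contDiff_christoffelTrace (h : InvariantData g α W A) (a : Fin n) :
    ContDiff ℝ ∞ (christoffelTrace W a) :=
  ContDiff.sum fun c _ => (h.smoothW.mpd c).mul h.smoothInv a c

theorem christoffelTrace_eq (h : InvariantData g α W A) (a : Fin n) (x : Fin n → ℝ) :
    christoffelTrace W a x = ∑ e, dy W e (fun x => W x a e) x := by
  unfold christoffelTrace dy
  simp only [Matrix.mul_apply]
  rw [Finset.sum_comm]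
  refine Finset.sum_congr rfl fun e _ => Finset.sum_congr rfl fun c _ => ?_
  rw [mpd_apply, h.inv_symm]
  ring

/-- Only the upper index of α sees the connection in a z̄-direction, and the metric is parallel;
lowering that index therefore leaves a plain derivative of q = AW. -/
theorem nablaZbar_eq (h : InvariantData g α W A) (z : Fin n → ℂ) (c : Fin n) :
    nablaZbar g α z c =
      (1 / 2 : ℂ) • (mpd c (fun x => A x * W x) (rePart z) * (W (rePart z))⁻¹) := by
  rw [mpd_mul h.smoothA h.smoothW, add_mul, mul_assoc (mpd c A _), Matrix.mul_nonsing_inv _ (h.unit _),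
    mul_one]
  ext a b
  simp only [nablaZbar, Matrix.of_apply, h.dzbar_higgs, h.christoffel_real]
  simp only [h.christoffel_eq, h.higgs, Matrix.smul_apply, Matrix.add_apply, smul_eq_mul, mul_add]
  congr 1
  rw [mul_assoc (A _), Matrix.mul_apply, Finset.mul_sum]
  exact Finset.sum_congr rfl fun d _ => by ring

/-- In a z-direction only the lower index sees the connection, so raising it with W⁻¹ removes the
Christoffel terms. -/
theorem nablaZ_eq (h : InvariantData g α W A) (z : Fin n → ℂ) (c : Fin n) :
    nablaZ g α z c =
      (1 / 2 : ℂ) • (W (rePart z) * mpd c (fun x => (W x)⁻¹ * A x) (rePart z)) := by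
  rw [mpd_mul h.smoothInv h.smoothA, mpd_inv h.smoothW h.unit, mul_add]
  simp only [← mul_assoc, mul_neg, neg_mul, Matrix.mul_nonsing_inv _ (h.unit _), one_mul]
  ext a b
  simp only [nablaZ, Matrix.of_apply, h.dz_higgs, h.christoffel_eq]
  simp only [h.higgs, Matrix.smul_apply, Matrix.add_apply, Matrix.neg_apply, smul_eq_mul]
  rw [Matrix.mul_apply (M := mpd c W _ * _), mul_add, mul_neg, Finset.mul_sum, neg_add_eq_sub]
  congr 1
  exact Finset.sum_congr rfl fun d _ => by ring

theorem pairing_eq (h : InvariantData g α W A) (z : Fin n → ℂ)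
    (P Q : Matrix (Fin n) (Fin n) ℂ) :
    pairing g z P Q =
      ((W (rePart z))⁻¹ * P * W (rePart z) * Q.transpose).trace := by
  unfold pairing Matrix.trace
  simp only [h.ginv_eq, h.metric, Matrix.diag_apply, Matrix.mul_apply, Matrix.transpose_apply,
    Finset.sum_mul]
  calc _ = ∑ e, ∑ c, ∑ d, ∑ f, (W (rePart z))⁻¹ c e * W (rePart z) f d * P c d * Q e f := by
        rw [Finset.sum_congr rfl fun c _ => Finset.sum_comm, Finset.sum_comm]
    _ = ∑ e, ∑ f, ∑ d, ∑ c, (W (rePart z))⁻¹ c e * W (rePart z) f d * P c d * Q e f := by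
        refine Finset.sum_congr rfl fun e _ => ?_
        rw [Finset.sum_congr rfl fun c _ => Finset.sum_comm, Finset.sum_comm]
        exact Finset.sum_congr rfl fun f _ => Finset.sum_comm
    _ = _ := by
        refine Finset.sum_congr rfl fun e _ => Finset.sum_congr rfl fun f _ =>
          Finset.sum_congr rfl fun d _ => Finset.sum_congr rfl fun c _ => ?_
        rw [h.inv_symm _ c e, show W (rePart z) f d = W (rePart z) d f from
          congrFun (congrFun (h.symm (rePart z)) d) f]
        ring

theorem pairing_sum_smul (h : InvariantData g α W A) (z : Fin n → ℂ)
    (c : Fin n → ℂ) (P : Fin n → Matrix (Fin n) (Fin n) ℂ) (Q : Matrix (Fin n) (Fin n) ℂ) :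
    pairing g z (∑ b, c b • P b) Q = ∑ b, c b * pairing g z (P b) Q := by
  simp only [h.pairing_eq, Finset.mul_sum, Finset.sum_mul, Matrix.trace_sum, Matrix.mul_smul,
    Matrix.smul_mul, Matrix.trace_smul, smul_eq_mul]

/-- Expand by the product rule: W contracts `dy` back to the x-derivative, and the y-divergence of W
is the Christoffel trace. Covariant divergences thereby become flat ones in y. -/
theorem sum_dy_metric_mul (h : InvariantData g α W A) {X : Fin n → (Fin n → ℝ) → ℂ}
    (hX : ∀ a, ContDiff ℝ ∞ (X a)) (x : Fin n → ℝ) :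
    ∑ e, dy W e (fun x => ∑ a, W x e a * X a x) x =
      ∑ a, (pd a (X a) x + christoffelTrace W a x * X a x) := by
  have h1 : ∀ e, dy W e (fun x => ∑ a, W x e a * X a x) x =
      ∑ a, (dy W e (fun x => W x e a) x * X a x + W x e a * dy W e (X a) x) := by
    intro e
    rw [dy_sum W fun a _ => ((h.smoothW e a).mul (hX a)).diffAt x]
    exact Finset.sum_congr rfl fun a _ => dy_mul W ((h.smoothW e a).diffAt x) ((hX a).diffAt x)
  simp only [h1]
  rw [Finset.sum_comm]
  refine Finset.sum_congr rfl fun a _ => ?_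
  rw [Finset.sum_add_distrib, add_comm]
  congr 1
  · unfold dy
    simp only [Finset.mul_sum]
    rw [Finset.sum_comm]
    have h2 : ∀ b, ∑ e, W x e a * ((W x)⁻¹ e b * pd b (X a) x) =
        (1 : Matrix (Fin n) (Fin n) ℂ) a b * pd b (X a) x := by
      intro b
      rw [← Matrix.mul_nonsing_inv _ (h.unit x), Matrix.mul_apply, Finset.sum_mul]
      refine Finset.sum_congr rfl fun e _ => ?_
      rw [show W x e a = W x a e from congrFun (congrFun (h.symm x) a) e]
      ring
    simp only [h2, Matrix.one_apply]
    simp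
  · rw [h.christoffelTrace_eq, Finset.sum_mul]
    refine Finset.sum_congr rfl fun e _ => ?_
    have : (fun x => W x e a) = fun x => W x a e :=
      funext fun x => congrFun (congrFun (h.symm x) a) e
    rw [this]

theorem divergence10_eq (h : InvariantData g α W A) {X : Fin n → (Fin n → ℝ) → ℂ}
    (hX : ∀ a, ContDiff ℝ ∞ (X a)) (z : Fin n → ℂ) :
    divergence10 g (fun ζ a => X a (rePart ζ)) z =
      (1 / 2) * ∑ e, dy W e (fun x => ∑ a, W x e a * X a x) (rePart z) := by
  rw [h.sum_dy_metric_mul hX, Finset.mul_sum]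
  unfold divergence10
  refine Finset.sum_congr rfl fun a _ => ?_
  rw [dz_comp_rePart a (X a), ← Finset.sum_mul, h.sum_christoffel]
  ring

theorem divergence01_eq (h : InvariantData g α W A) {X : Fin n → (Fin n → ℝ) → ℂ}
    (hX : ∀ a, ContDiff ℝ ∞ (X a)) (z : Fin n → ℂ) :
    divergence01 g (fun ζ a => X a (rePart ζ)) z =
      (1 / 2) * ∑ e, dy W e (fun x => ∑ a, W x e a * X a x) (rePart z) := by
  rw [h.sum_dy_metric_mul hX, Finset.mul_sum]
  unfold divergence01
  refine Finset.sum_congr rfl fun a _ => ?_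
  rw [dzbar_comp_rePart a (X a), ← Finset.sum_mul]
  simp only [h.christoffel_real]
  rw [h.sum_christoffel]
  ring

/-- Combined with `christoffelTrace_eq` this is Abreu's formula: S is -¼ times the double
y-divergence of W. -/
theorem scalarCurvature_eq (h : InvariantData g α W A) (z : Fin n → ℂ) :
    scalarCurvature g z =
      -(1 / 4) * (∑ a, dy W a (christoffelTrace W a) (rePart z)).re := by
  have h1 : ∀ a b, dzbar b (fun ζ => ∑ c, christoffel g ζ c c a) z =
      (1 / 4) * pd b (christoffelTrace W a) (rePart z) := by
    intro a b
    have : (fun ζ => ∑ c, christoffel g ζ c c a) =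
        fun ζ => (fun x => (1 / 2) * christoffelTrace W a x) (rePart ζ) :=
      funext fun ζ => h.sum_christoffel ζ a
    rw [this]
    refine (dzbar_comp_rePart b (fun x => (1 / 2) * christoffelTrace W a x) z).trans ?_
    rw [pd_const_mul]
    ring
  unfold scalarCurvature
  have h2 : -∑ a, ∑ b, ginv g z a b * dzbar b (fun ζ => ∑ c, christoffel g ζ c c a) z =
      ((-(1 / 4) : ℝ) : ℂ) * ∑ a, dy W a (christoffelTrace W a) (rePart z) := by
    simp only [h1, h.ginv_eq, dy, Finset.mul_sum, ← Finset.sum_neg_distrib]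
    refine Finset.sum_congr rfl fun a _ => Finset.sum_congr rfl fun b _ => ?_
    push_cast
    ring
  rw [h2, Complex.re_ofReal_mul]

theorem delStar_eq (h : InvariantData g α W A) (z : Fin n → ℂ) (b : Fin n) :
    delStar g α z b = -(1 / 2) * ∑ e,
      (∑ a, dy W a (fun x => (A x * W x) a e) (rePart z)) * (W (rePart z))⁻¹ e b := by
  unfold delStar dy
  simp only [h.nablaZbar_eq, h.ginv_eq, Matrix.smul_apply, Matrix.mul_apply (M := mpd _ _ _),
    smul_eq_mul, Finset.mul_sum, Finset.sum_mul, mpd_apply, ← Finset.sum_neg_distrib]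
  calc _ = ∑ a, ∑ e, ∑ c, -((W (rePart z))⁻¹ a c * (1 / 2 *
        (pd c (fun x => (A x * W x) a e) (rePart z) * (W (rePart z))⁻¹ e b))) :=
        Finset.sum_congr rfl fun a _ => Finset.sum_comm
    _ = _ := by
        rw [Finset.sum_comm]
        refine Finset.sum_congr rfl fun e _ => Finset.sum_congr rfl fun a _ =>
          Finset.sum_congr rfl fun c _ => by ring

/-- Lowering the index of ∂^*α gives -½ times the y-divergence of q, and the outer divergence
contributes another ½ and a second y-divergence. -/
theorem complexMomentMap_eq (h : InvariantData g α W A) (z : Fin n → ℂ) :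
    complexMomentMap g α z = -(1 / 4) * ∑ e, dy W e
      (fun x => ∑ a, dy W a (fun x => (A x * W x) a e) x) (rePart z) := by
  have hq : MatSmooth fun x => A x * W x := h.smoothA.mul h.smoothW
  set V : Fin n → (Fin n → ℝ) → ℂ := fun e x => ∑ a, dy W a (fun x => (A x * W x) a e) x with hV
  have hVs : ∀ e, ContDiff ℝ ∞ (V e) := fun e =>
    ContDiff.sum fun a _ => h.contDiff_dy (hq a e) a
  set X : Fin n → (Fin n → ℝ) → ℂ := fun b x => -(1 / 2) * ∑ e, V e x * (W x)⁻¹ e b with hX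
  have hXs : ∀ b, ContDiff ℝ ∞ (X b) := fun b =>
    contDiff_const.mul (ContDiff.sum fun e _ => (hVs e).mul (h.smoothInv e b))
  have h1 : delStar g α = fun ζ b => X b (rePart ζ) := by
    funext ζ b
    exact h.delStar_eq ζ b
  unfold complexMomentMap
  rw [h1, h.divergence01_eq hXs]
  have h2 : ∀ e, (fun x => ∑ a, W x e a * X a x) = fun x => -(1 / 2) * V e x := by
    intro e
    funext x
    simp only [hX, Finset.mul_sum]
    rw [Finset.sum_comm]
    have h3 : ∀ f, ∑ a, W x e a * (-(1 / 2) * (V f x * (W x)⁻¹ f a)) =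
        -(1 / 2) * ((1 : Matrix (Fin n) (Fin n) ℂ) e f * V f x) := by
      intro f
      rw [← Matrix.mul_nonsing_inv _ (h.unit x), Matrix.mul_apply, Finset.sum_mul, Finset.mul_sum]
      refine Finset.sum_congr rfl fun a _ => ?_
      rw [h.inv_symm x f a]
      ring
    simp only [h3, Matrix.one_apply]
    simp
  simp only [h2, dy_const_mul, ← Finset.mul_sum]
  ring

end InvariantData

/-! ### The real moment map -/

theorem MatSmooth.transpose {M : (Fin n → ℝ) → Matrix (Fin n) (Fin n) ℂ} (hM : MatSmooth M) :
    MatSmooth fun x => (M x).transpose :=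
  fun a b => hM b a

theorem conj_aeval (B : Matrix (Fin n) (Fin n) ℂ) (p : Polynomial ℝ) :
    conj (Polynomial.aeval B p) = Polynomial.aeval (conj B) p :=
  (Polynomial.aeval_algHom_apply (Complex.conjAe.toAlgHom.mapMatrix (m := Fin n)) B p).symm

theorem aeval_transpose (B : Matrix (Fin n) (Fin n) ℂ) (p : Polynomial ℝ) :
    (Polynomial.aeval B p).transpose = Polynomial.aeval B.transpose p := by
  induction p using Polynomial.induction_on' with
  | add p q hp hq => simp only [map_add, Matrix.transpose_add, hp, hq]
  | monomial k c =>
    simp only [Polynomial.aeval_monomial, Algebra.algebraMap_eq_smul_one, Matrix.smul_mul,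
      one_mul, Matrix.transpose_smul, Matrix.transpose_pow]

/-- The relations between `Ψ = p(B)`, its transpose and its conjugate, for `B = q G q̄ G` with `q`
symmetric and `G` real symmetric. -/
structure SpectralRelations (G q Ψ : Matrix (Fin n) (Fin n) ℂ) : Prop where
  symm : q.transpose = q
  symmG : G.transpose = G
  realG : conj G = G
  mul_q : Ψ * q = q * Ψ.transpose
  mul_G : Ψ.transpose * G = G * conj Ψ
  comm : Ψ * (q * G * conj q * G) = (q * G * conj q * G) * Ψ

/-- For B = qGq̄G one has Bᵗ = Gq̄Gq and B̄ = q̄GqG, so Bq = qBᵗ and BᵗG = GB̄ by associativity;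
both relations pass to polynomials, the second using that the coefficients are real. -/
theorem spectralRelations_aeval {G q : Matrix (Fin n) (Fin n) ℂ} (hq : q.transpose = q)
    (hG : G.transpose = G) (hGr : conj G = G) (p : Polynomial ℝ) :
    SpectralRelations G q (Polynomial.aeval (q * G * conj q * G) p) := by
  have hqc : (conj q).transpose = conj q := by
    rw [show (conj q).transpose = conj q.transpose from rfl, hq]
  have hBt : (q * G * conj q * G).transpose = G * conj q * G * q := by
    simp only [Matrix.transpose_mul, hq, hG, hqc, mul_assoc]
  have hBc : conj (q * G * conj q * G) = conj q * G * q * G := by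
    simp only [conj_mul, conj_conj, hGr]
  refine ⟨hq, hG, hGr, ?_, ?_, ?_⟩
  · rw [aeval_transpose, hBt]
    exact aeval_mul_eq_mul_aeval (by simp only [mul_assoc]) p
  · rw [aeval_transpose, hBt, conj_aeval, hBc]
    exact aeval_mul_eq_mul_aeval (by simp only [mul_assoc]) p
  · exact aeval_mul_eq_mul_aeval rfl p

namespace SpectralRelations

variable {G q Ψ : Matrix (Fin n) (Fin n) ℂ}

theorem conj_mul_q (h : SpectralRelations G q Ψ) :
    conj Ψ * conj q = conj q * (conj Ψ).transpose := by
  have := congrArg conj h.mul_q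
  rwa [conj_mul, conj_mul] at this

theorem conj_mul_G (h : SpectralRelations G q Ψ) : (conj Ψ).transpose * G = G * Ψ := by
  have := congrArg conj h.mul_G
  rw [conj_mul, conj_mul, h.realG, conj_conj] at this
  exact this

theorem isHermitian (h : SpectralRelations G q Ψ) :
    (Ψ * q * G * conj q).transpose = conj (Ψ * q * G * conj q) := by
  have hqc : (conj q).transpose = conj q := by
    rw [show (conj q).transpose = conj q.transpose from rfl, h.symm]
  simp only [Matrix.transpose_mul, conj_mul, conj_conj, h.realG, h.symmG, hqc, h.symm]
  rw [← h.mul_q, h.conj_mul_q]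
  simp only [← mul_assoc]
  rw [mul_assoc (conj q) (conj Ψ).transpose G, h.conj_mul_G]
  simp only [← mul_assoc]

/-- This is the cancellation behind the real equation. With s the trace containing dq and t = tr(GBΨ
dW), B = qGq̄G, the first pairing is s/2 and the second is (s - t - t̄)/2, because the two
derivatives of G contribute t and t̄. In the real part of the difference s disappears and Re t
remains. -/
theorem re_trace (h : SpectralRelations G q Ψ) {W dW : Matrix (Fin n) (Fin n) ℂ}
    (hWG : W * G = 1) (hdW : conj dW = dW) (dq : Matrix (Fin n) (Fin n) ℂ) :
    ((1 / 2) * (G * dq * (conj (q * G) * Ψ).transpose).trace -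
      starRingEnd ℂ ((1 / 2) * ((-(G * dW * G) * (q * G) + G * (dq * G + q * -(G * dW * G))) * W *
        (conj (q * G) * Ψ).transpose).trace)).re =
      (G * (q * G * conj q * G * Ψ) * dW).trace.re := by
  have hqc : (conj q).transpose = conj q := by
    rw [show (conj q).transpose = conj q.transpose from rfl, h.symm]
  have hQ : (conj (q * G) * Ψ).transpose = G * conj Ψ * conj q := by
    rw [conj_mul, h.realG, Matrix.transpose_mul, Matrix.transpose_mul, h.symmG, hqc, ← mul_assoc,
      h.mul_G]
  set t := (G * (q * G * conj q * G * Ψ) * dW).trace with ht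
  have hT1 : (G * dW * G * (q * G) * W * (G * conj Ψ * conj q)).trace = t := by
    have h1 : G * dW * G * (q * G) * W * (G * conj Ψ * conj q) =
        (G * dW) * (G * (q * (G * conj Ψ)) * conj q) := by
      simp only [← mul_assoc]
      rw [mul_assoc _ W G, hWG, mul_one]
    have h2 : q * (G * conj Ψ) = Ψ * q * G := by
      rw [← h.mul_G, ← mul_assoc, h.mul_q]
    rw [h1, h2, Matrix.trace_mul_cycle, ht, ← h.comm]
    refine congrArg Matrix.trace ?_
    simp only [mul_assoc]
  have hT2 : (G * (q * (G * dW * G)) * W * (G * conj Ψ * conj q)).trace = starRingEnd ℂ t := by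
    have h1 : G * (q * (G * dW * G)) * W * (G * conj Ψ * conj q) =
        (G * q * G) * dW * (G * conj Ψ * conj q) := by
      simp only [← mul_assoc]
      rw [mul_assoc _ W G, hWG, mul_one]
    rw [h1, Matrix.trace_mul_cycle, ht, ← h.comm, conj_trace]
    refine congrArg Matrix.trace ?_
    simp only [conj_mul, conj_conj, hdW, h.realG, mul_assoc]
  have hE : (G * (dq * G) * W * (G * conj Ψ * conj q)).trace =
      (G * dq * (G * conj Ψ * conj q)).trace := by
    refine congrArg Matrix.trace ?_
    simp only [← mul_assoc]
    rw [mul_assoc _ W G, hWG, mul_one]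
  have hsum : ((-(G * dW * G) * (q * G) + G * (dq * G + q * -(G * dW * G))) * W *
      (G * conj Ψ * conj q)).trace =
      (G * dq * (G * conj Ψ * conj q)).trace - t - starRingEnd ℂ t := by
    rw [← hE, ← hT2, ← hT1]
    simp only [neg_mul, mul_neg, mul_add, add_mul, Matrix.trace_add, Matrix.trace_neg]
    ring
  rw [hQ, hsum]
  set s := (G * dq * (G * conj Ψ * conj q)).trace
  have : starRingEnd ℂ (1 / 2 * (s - t - starRingEnd ℂ t)) =
      1 / 2 * (starRingEnd ℂ s - starRingEnd ℂ t - t) := by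
    simp only [map_mul, map_sub, Complex.conj_conj]
    congr 1
    norm_num [Complex.ext_iff]
  rw [this]
  norm_num [Complex.mul_re, Complex.sub_re, Complex.div_re]
  ring

end SpectralRelations

/-- The data of a compatible torus-invariant pair with `α ᾱ` of spectral radius less than one. -/
structure CompatibleData (g α : (Fin n → ℂ) → Matrix (Fin n) (Fin n) ℂ)
    (W A : (Fin n → ℝ) → Matrix (Fin n) (Fin n) ℂ) : Prop extends InvariantData g α W A where
  compat : ∀ x, (A x * W x).transpose = A x * W x
  spec : ∀ x, ∀ μ ∈ spectrum ℂ (A x * conj (A x)), μ.re < 1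

/-- `q = A W`, in the coordinates `x`. -/
def quadDiff (W A : (Fin n → ℝ) → Matrix (Fin n) (Fin n) ℂ) (x : Fin n → ℝ) :
    Matrix (Fin n) (Fin n) ℂ := A x * W x

/-- `ψ(A Ā)`. -/
def psiMat (A : (Fin n → ℝ) → Matrix (Fin n) (Fin n) ℂ) (x : Fin n → ℝ) :
    Matrix (Fin n) (Fin n) ℂ := spectralFun psi (A x * conj (A x))

/-- The matrix `-½ W + ψ(A Ā) q W⁻¹ q̄`. -/
def momentMatrix (W A : (Fin n → ℝ) → Matrix (Fin n) (Fin n) ℂ) (x : Fin n → ℝ) :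
    Matrix (Fin n) (Fin n) ℂ :=
  -(1 / 2 : ℂ) • W x + psiMat A x * quadDiff W A x * (W x)⁻¹ * conj (quadDiff W A x)

namespace CompatibleData

variable {g α : (Fin n → ℂ) → Matrix (Fin n) (Fin n) ℂ}
  {W A : (Fin n → ℝ) → Matrix (Fin n) (Fin n) ℂ}

theorem inv_transpose (h : CompatibleData g α W A) (x : Fin n → ℝ) :
    ((W x)⁻¹).transpose = (W x)⁻¹ := by
  rw [Matrix.transpose_nonsing_inv, h.symm]

theorem higgs_eq (h : CompatibleData g α W A) (x : Fin n → ℝ) :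
    A x = quadDiff W A x * (W x)⁻¹ := by
  rw [quadDiff, mul_assoc, Matrix.mul_nonsing_inv _ (h.unit x), mul_one]

theorem higgs_mul_conj (h : CompatibleData g α W A) (x : Fin n → ℝ) :
    A x * conj (A x) = quadDiff W A x * (W x)⁻¹ * conj (quadDiff W A x) * (W x)⁻¹ := by
  conv_lhs => rw [h.higgs_eq x]
  rw [conj_mul, h.inv_real, ← mul_assoc]

/-- For symmetric q, the matrix W⁻¹AĀ = GqGq̄G is Hermitian, so AĀ is self-adjoint for the positive
form G; the spectral hypothesis bounds its eigenvalues by 1. -/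
theorem exists_realDiag (h : CompatibleData g α W A) (x : Fin n → ℝ) :
    ∃ P δ, RealDiag (A x * conj (A x)) P δ ∧ ∀ i, δ i < 1 := by
  have hq := h.compat x
  change (quadDiff W A x).transpose = quadDiff W A x at hq
  have hq2 : (quadDiff W A x).conjTranspose = conj (quadDiff W A x) := by
    rw [← conj_transpose, show (conj (quadDiff W A x)).transpose =
      conj (quadDiff W A x).transpose from rfl, hq]
  have hq3 : (conj (quadDiff W A x)).conjTranspose = quadDiff W A x := by
    rw [← hq2, Matrix.conjTranspose_conjTranspose]
  have hG : ((W x)⁻¹).conjTranspose = (W x)⁻¹ := (h.posDef x).inv.isHermitian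
  have hH : ((W x)⁻¹ * (A x * conj (A x))).IsHermitian := by
    rw [h.higgs_mul_conj]
    unfold Matrix.IsHermitian
    simp only [Matrix.conjTranspose_mul, hq2, hq3, hG, mul_assoc]
  obtain ⟨P, δ, hP⟩ := HcscK.exists_realDiag (h.posDef x).inv hH
  exact ⟨P, δ, hP, fun i => by simpa using h.spec x _ (hP.mem_spectrum i)⟩

theorem spectralRelations (h : CompatibleData g α W A) (x : Fin n → ℝ) :
    SpectralRelations (W x)⁻¹ (quadDiff W A x) (psiMat A x) := by
  obtain ⟨P, δ, hP, -⟩ := h.exists_realDiag x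
  obtain ⟨p, hp⟩ := hP.exists_real_poly psi
  rw [psiMat, hp, h.higgs_mul_conj]
  exact spectralRelations_aeval (h.compat x) (h.inv_transpose x) (h.inv_real x) p

theorem smooth_mul_conj (h : CompatibleData g α W A) : MatSmooth fun x => A x * conj (A x) :=
  h.smoothA.mul h.smoothA.conj

theorem smooth_quadDiff (h : CompatibleData g α W A) : MatSmooth (quadDiff W A) :=
  h.smoothA.mul h.smoothW

theorem smooth_sqrt (h : CompatibleData g α W A) :
    MatSmooth fun x => spectralFun Real.sqrt (1 - A x * conj (A x)) := by
  refine ((MatSmooth.const 1).sub h.smooth_mul_conj).spectralFun_sqrt fun x => ?_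
  obtain ⟨P, δ, hP, hδ⟩ := h.exists_realDiag x
  exact ⟨P, _, hP.one_sub, fun i => by linarith [hδ i]⟩

/-- The interpolation formula is not visibly smooth where eigenvalues merge; writing ψ(B) as half
the inverse of 1 + √(1-B) reduces the claim to the square root. -/
theorem smooth_psiMat (h : CompatibleData g α W A) : MatSmooth (psiMat A) := by
  have h1 : psiMat A = fun x => (1 / 2 : ℂ) •
      (1 + spectralFun Real.sqrt (1 - A x * conj (A x)))⁻¹ := by
    funext x
    obtain ⟨P, δ, hP, -⟩ := h.exists_realDiag x
    exact hP.psi_eq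
  rw [h1]
  refine (((MatSmooth.const 1).add h.smooth_sqrt).inv fun x => ?_).smul _
  obtain ⟨P, δ, hP, -⟩ := h.exists_realDiag x
  exact hP.isUnit_det_one_add_sqrt

theorem smooth_momentMatrix (h : CompatibleData g α W A) : MatSmooth (momentMatrix W A) :=
  (h.smoothW.smul _).add
    (((h.smooth_psiMat.mul h.smooth_quadDiff).mul h.smoothInv).mul h.smooth_quadDiff.conj)

/-- Since qGq̄ = BW, the second term is ψ(B)BW = ½(1 - √(1-B))W, whose first half cancels -½W. -/
theorem momentMatrix_eq (h : CompatibleData g α W A) (x : Fin n → ℝ) :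
    momentMatrix W A x =
      -(1 / 2 : ℂ) • (spectralFun Real.sqrt (1 - A x * conj (A x)) * W x) := by
  obtain ⟨P, δ, hP, hδ⟩ := h.exists_realDiag x
  have h1 : psiMat A x * quadDiff W A x * (W x)⁻¹ * conj (quadDiff W A x) =
      spectralFun psi (A x * conj (A x)) * (A x * conj (A x)) * W x := by
    rw [mul_assoc _ (A x * conj (A x)), psiMat]
    conv_rhs => rw [h.higgs_mul_conj]
    simp only [mul_assoc, Matrix.nonsing_inv_mul _ (h.unit x), mul_one, h.higgs_mul_conj]
  rw [momentMatrix, h1, hP.psi_mul_self hδ, Matrix.smul_mul, sub_mul, one_mul, smul_sub]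
  simp only [neg_smul]
  abel

theorem momentMatrix_transpose (h : CompatibleData g α W A) (x : Fin n → ℝ) :
    (momentMatrix W A x).transpose = conj (momentMatrix W A x) := by
  have h1 : conj (-(1 / 2 : ℂ) • W x) = -(1 / 2 : ℂ) • W x := by
    conv_rhs => rw [← h.real x]
    ext i j
    simp only [conj, Matrix.map_apply, Matrix.smul_apply, smul_eq_mul, map_mul]
    congr 1
    norm_num [Complex.ext_iff]
  have h2 : ∀ C D : Matrix (Fin n) (Fin n) ℂ, conj (C + D) = conj C + conj D := fun C D => by
    ext i j; simp [conj]
  rw [momentMatrix, h2, h1, Matrix.transpose_add, Matrix.transpose_smul, h.symm,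
    (h.spectralRelations x).isHermitian]

theorem alphaHat_eq (h : CompatibleData g α W A) (z : Fin n → ℂ) :
    alphaHat α z = psiMat A (rePart z) := by
  rw [alphaHat, psiMat, h.higgs]

/-- The covector `W_{ea} Xᵃ` without the last term of `X`. -/
def pairingPart (W A : (Fin n → ℝ) → Matrix (Fin n) (Fin n) ℂ) (e : Fin n) (x : Fin n → ℝ) : ℂ :=
  (1 / 2) * ((W x)⁻¹ * mpd e (quadDiff W A) x * (conj (A x) * psiMat A x).transpose).trace -
    starRingEnd ℂ ((1 / 2) * (mpd e (fun x => (W x)⁻¹ * A x) x * W x *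
      (conj (A x) * psiMat A x).transpose).trace)

theorem contDiff_pairingPart (h : CompatibleData g α W A) (e : Fin n) :
    ContDiff ℝ ∞ (pairingPart W A e) := by
  have h1 : MatSmooth fun x => (conj (A x) * psiMat A x).transpose :=
    (h.smoothA.conj.mul h.smooth_psiMat).transpose
  refine (contDiff_const.mul ((h.smoothInv.mul (h.smooth_quadDiff.mpd e)).mul h1).trace).sub ?_
  exact Complex.conjLIE.toContinuousLinearEquiv.contDiff.comp (contDiff_const.mul
    ((((h.smoothInv.mul h.smoothA).mpd e).mul h.smoothW).mul h1).trace)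

theorem vectorFieldX_eq (h : CompatibleData g α W A) (z : Fin n → ℂ) (a : Fin n) :
    vectorFieldX g α z a = ∑ b, (W (rePart z))⁻¹ a b * pairingPart W A b (rePart z) +
      ∑ c, dy W c (fun x => (A x * conj (A x) * psiMat A x) c a) (rePart z) := by
  set Q := conj (A (rePart z)) * psiMat A (rePart z) with hQ
  have hQ' : conj (α z) * alphaHat α z = Q := by rw [h.alphaHat_eq, h.higgs]
  have h1 : pairing g z (nablaUp g α z a) Q = ∑ b, (W (rePart z))⁻¹ a b *
      ((1 / 2) * ((W (rePart z))⁻¹ * mpd b (quadDiff W A) (rePart z) * Q.transpose).trace) := by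
    unfold nablaUp
    rw [h.pairing_sum_smul]
    refine Finset.sum_congr rfl fun b _ => ?_
    rw [h.ginv_eq, h.nablaZbar_eq, h.pairing_eq]
    simp only [Matrix.mul_smul, Matrix.smul_mul, Matrix.trace_smul, smul_eq_mul]
    congr 3
    simp only [← mul_assoc]
    rw [mul_assoc _ _ (W (rePart z)), Matrix.nonsing_inv_mul _ (h.unit _), mul_one]
    rfl
  have h2 : pairing g z (nablaUpBar g α z a) Q = ∑ b, (W (rePart z))⁻¹ a b *
      ((1 / 2) * (mpd b (fun x => (W x)⁻¹ * A x) (rePart z) * W (rePart z) *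
        Q.transpose).trace) := by
    unfold nablaUpBar
    rw [h.pairing_sum_smul]
    refine Finset.sum_congr rfl fun b _ => ?_
    rw [h.ginv_eq, h.inv_symm, h.nablaZ_eq, h.pairing_eq]
    simp only [Matrix.mul_smul, Matrix.smul_mul, Matrix.trace_smul, smul_eq_mul]
    congr 3
    simp only [← mul_assoc]
    rw [Matrix.nonsing_inv_mul _ (h.unit _), one_mul]
  -- The coefficient 2 absorbs the ½ in ∂_z̄, and the two signs cancel.
  have h3 : -2 * nablaStar g (fun ζ => α ζ * conj (α ζ) * alphaHat α ζ) z a =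
      ∑ c, dy W c (fun x => (A x * conj (A x) * psiMat A x) c a) (rePart z) := by
    unfold nablaStar dy
    have h4 : ∀ c d, dzbar d (fun ζ => (α ζ * conj (α ζ) * alphaHat α ζ) c a) z =
        (1 / 2) * pd d (fun x => (A x * conj (A x) * psiMat A x) c a) (rePart z) := by
      intro c d
      simp only [h.alphaHat_eq, h.higgs]
      exact dzbar_comp_rePart d (fun x => (A x * conj (A x) * psiMat A x) c a) z
    simp only [h4, h.ginv_eq, Finset.mul_sum, ← Finset.sum_neg_distrib]
    exact Finset.sum_congr rfl fun c _ => Finset.sum_congr rfl fun d _ => by ring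
  have h5 : vectorFieldX g α z a = pairing g z (nablaUp g α z a) Q -
      starRingEnd ℂ (pairing g z (nablaUpBar g α z a) Q) +
      -2 * nablaStar g (fun ζ => α ζ * conj (α ζ) * alphaHat α ζ) z a := by
    rw [vectorFieldX, hQ', map_neg]
    ring
  rw [h5, h3, h1, h2, map_sum, ← Finset.sum_sub_distrib]
  congr 1
  refine Finset.sum_congr rfl fun b _ => ?_
  rw [map_mul, h.inv_real_apply, ← mul_sub]
  rfl

/-- Pulling W inside the y-divergence of BΨ costs tr(W⁻¹BΨ ∂ₑW). By `re_trace` the pairing terms of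
X have exactly this real part, so the lowered field is a pure divergence up to an imaginary part. -/
theorem re_metric_mul_X (h : CompatibleData g α W A) (e : Fin n) (x : Fin n → ℝ) :
    (∑ a, W x e a * (∑ b, (W x)⁻¹ a b * pairingPart W A b x +
      ∑ c, dy W c (fun x => (A x * conj (A x) * psiMat A x) c a) x)).re =
    (∑ c, dy W c (fun x => (A x * conj (A x) * psiMat A x * W x) c e) x).re := by
  have hBΨ : MatSmooth fun x => A x * conj (A x) * psiMat A x :=
    h.smooth_mul_conj.mul h.smooth_psiMat
  have hlow : ∑ a, W x e a * ∑ b, (W x)⁻¹ a b * pairingPart W A b x = pairingPart W A e x := by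
    have h1 := congrFun (congrArg (fun M : Matrix (Fin n) (Fin n) ℂ =>
      M.mulVec fun b => pairingPart W A b x) (Matrix.mul_nonsing_inv _ (h.unit x))) e
    simp only [Matrix.one_mulVec, ← Matrix.mulVec_mulVec] at h1
    exact h1
  have hprod : ∑ c, dy W c (fun x => (A x * conj (A x) * psiMat A x * W x) c e) x =
      ∑ a, W x e a * ∑ c, dy W c (fun x => (A x * conj (A x) * psiMat A x) c a) x +
      ((W x)⁻¹ * (A x * conj (A x) * psiMat A x) * mpd e W x).trace := by
    have h1 : ∀ c, dy W c (fun x => (A x * conj (A x) * psiMat A x * W x) c e) x =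
        ∑ a, (dy W c (fun x => (A x * conj (A x) * psiMat A x) c a) x * W x a e +
          (A x * conj (A x) * psiMat A x) c a * dy W c (fun x => W x a e) x) := by
      intro c
      simp only [Matrix.mul_apply (N := W _)]
      rw [dy_sum W fun a _ => ((hBΨ c a).mul (h.smoothW a e)).diffAt x]
      exact Finset.sum_congr rfl fun a _ =>
        dy_mul W ((hBΨ c a).diffAt x) ((h.smoothW a e).diffAt x)
    simp only [h1, Finset.sum_add_distrib]
    congr 1
    · rw [Finset.sum_comm]
      refine Finset.sum_congr rfl fun a _ => ?_
      rw [Finset.mul_sum]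
      refine Finset.sum_congr rfl fun c _ => ?_
      rw [show W x a e = W x e a from congrFun (congrFun (h.symm x) e) a, mul_comm]
    · simp only [Matrix.trace, Matrix.diag_apply, Matrix.mul_apply (N := mpd e W x),
        Matrix.mul_apply (M := (W x)⁻¹), dy, Finset.mul_sum, Finset.sum_mul]
      calc _ = ∑ c, ∑ f, ∑ a, (A x * conj (A x) * psiMat A x) c a *
            ((W x)⁻¹ c f * pd f (fun x => W x a e) x) :=
            Finset.sum_congr rfl fun c _ => Finset.sum_comm
        _ = ∑ f, ∑ a, ∑ c, (A x * conj (A x) * psiMat A x) c a *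
            ((W x)⁻¹ c f * pd f (fun x => W x a e) x) := by
            rw [Finset.sum_comm]
            exact Finset.sum_congr rfl fun f _ => Finset.sum_comm
        _ = _ := by
            refine Finset.sum_congr rfl fun f _ => Finset.sum_congr rfl fun a _ =>
              Finset.sum_congr rfl fun c _ => ?_
            -- Total symmetry of the third derivatives of v moves the differentiation index to e.
            rw [show pd f (fun x => W x a e) x = mpd e W x a f by
              rw [h.mpd_symm, h.hessian, h.mpd_symm]; rfl, h.inv_symm x f c]
            ring
  have hA : mpd e (fun x => (W x)⁻¹ * A x) x =
      -((W x)⁻¹ * mpd e W x * (W x)⁻¹) * (quadDiff W A x * (W x)⁻¹) +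
        (W x)⁻¹ * (mpd e (quadDiff W A) x * (W x)⁻¹ +
          quadDiff W A x * -((W x)⁻¹ * mpd e W x * (W x)⁻¹)) := by
    have h1 : A = fun x => quadDiff W A x * (W x)⁻¹ := funext h.higgs_eq
    rw [mpd_mul h.smoothInv h.smoothA, mpd_inv h.smoothW h.unit, ← h.higgs_eq]
    congr 2
    conv_lhs => rw [h1]
    rw [mpd_mul h.smooth_quadDiff h.smoothInv, mpd_inv h.smoothW h.unit]
  have htr := (h.spectralRelations x).re_trace (Matrix.mul_nonsing_inv _ (h.unit x))
    (h.mpd_real x e) (mpd e (quadDiff W A) x)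
  rw [← hA, ← h.higgs_mul_conj, ← h.higgs_eq] at htr
  simp only [mul_add, Finset.sum_add_distrib, hlow]
  rw [hprod, Complex.add_re, Complex.add_re, ← htr, add_comm]
  rfl

/-- Abreu's formula makes 2S the double divergence of -½W, and the factor 2 on div X cancels the ½
of the divergence formula. Commuting Ψ with B identifies BΨW with ΨqGq̄. -/
theorem realMomentMap_eq (h : CompatibleData g α W A) (z : Fin n → ℂ) :
    realMomentMap g α z = -2 * averageScalarCurvature g +
      (∑ e, dy W e (fun x => ∑ c, dy W c (fun x => momentMatrix W A x c e) x) (rePart z)).re := by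
  have hBΨ : MatSmooth fun x => A x * conj (A x) * psiMat A x :=
    h.smooth_mul_conj.mul h.smooth_psiMat
  set X : Fin n → (Fin n → ℝ) → ℂ := fun a x => ∑ b, (W x)⁻¹ a b * pairingPart W A b x +
      ∑ c, dy W c (fun x => (A x * conj (A x) * psiMat A x) c a) x with hX
  have hXs : ∀ a, ContDiff ℝ ∞ (X a) := fun a =>
    (ContDiff.sum fun b _ => (h.smoothInv a b).mul (h.contDiff_pairingPart b)).add
      (ContDiff.sum fun c _ => h.contDiff_dy (hBΨ c a) c)
  have hXeq : vectorFieldX g α = fun ζ a => X a (rePart ζ) := by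
    funext ζ a
    exact h.vectorFieldX_eq ζ a
  set Z : Fin n → (Fin n → ℝ) → ℂ :=
    fun e x => ∑ c, dy W c (fun x => (A x * conj (A x) * psiMat A x * W x) c e) x with hZ
  have hZs : ∀ e, ContDiff ℝ ∞ (Z e) := fun e =>
    ContDiff.sum fun c _ => h.contDiff_dy ((hBΨ.mul h.smoothW) c e) c
  have hWX : ∀ e, ContDiff ℝ ∞ fun x => ∑ a, W x e a * X a x := fun e =>
    ContDiff.sum fun a _ => (h.smoothW e a).mul (hXs a)
  have hdiv : (divergence10 g (vectorFieldX g α) z).re =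
      (1 / 2) * (∑ e, dy W e (Z e) (rePart z)).re := by
    rw [hXeq, h.divergence10_eq hXs]
    rw [show (1 / 2 : ℂ) = ((1 / 2 : ℝ) : ℂ) by norm_num, Complex.re_ofReal_mul, Complex.re_sum,
      Complex.re_sum]
    congr 1
    exact Finset.sum_congr rfl fun e _ =>
      h.re_dy_congr (hWX e) (hZs e) (fun x => h.re_metric_mul_X e x) e _
  have hM : ∀ e, (fun x => ∑ c, dy W c (fun x => momentMatrix W A x c e) x) =
      fun x => -(1 / 2) * christoffelTrace W e x + Z e x := by
    intro e
    funext x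
    rw [h.christoffelTrace_eq, hZ, Finset.mul_sum, ← Finset.sum_add_distrib]
    refine Finset.sum_congr rfl fun c _ => ?_
    have h1 : (fun x => momentMatrix W A x c e) = fun x => -(1 / 2) * W x e c +
        (A x * conj (A x) * psiMat A x * W x) c e := by
      funext x
      have h2 : psiMat A x * quadDiff W A x * (W x)⁻¹ * conj (quadDiff W A x) =
          A x * conj (A x) * psiMat A x * W x := by
        have h3 := (h.spectralRelations x).comm
        rw [← h.higgs_mul_conj] at h3
        rw [← h3, h.higgs_mul_conj]
        simp only [mul_assoc, Matrix.nonsing_inv_mul _ (h.unit x), mul_one]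
      rw [momentMatrix, h2, Matrix.add_apply, Matrix.smul_apply, smul_eq_mul,
        show W x c e = W x e c from congrFun (congrFun (h.symm x) e) c]
    rw [h1, dy_add W ((contDiff_const.mul (h.smoothW e c)).diffAt x)
      (((hBΨ.mul h.smoothW) c e).diffAt x), dy_const_mul]
  simp only [hM]
  have hsplit : ∀ e, dy W e (fun x => -(1 / 2) * christoffelTrace W e x + Z e x) (rePart z) =
      -(1 / 2) * dy W e (christoffelTrace W e) (rePart z) + dy W e (Z e) (rePart z) := by
    intro e
    rw [dy_add W ((contDiff_const.mul (h.contDiff_christoffelTrace e)).diffAt _)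
      ((hZs e).diffAt _), dy_const_mul]
  simp only [hsplit, Finset.sum_add_distrib, ← Finset.mul_sum]
  rw [realMomentMap, h.scalarCurvature_eq, hdiv, Complex.add_re,
    show (-(1 / 2) : ℂ) = ((-(1 / 2) : ℝ) : ℂ) by norm_num, Complex.re_ofReal_mul]
  ring

end CompatibleData

/-! ### The average scalar curvature -/

theorem pd_prod {s : Finset (Fin n)} {a : Fin n} {F : Fin n → (Fin n → ℝ) → ℂ}
    {x : Fin n → ℝ} (hF : ∀ i, DifferentiableAt ℝ (F i) x) :
    pd a (fun x => ∏ i ∈ s, F i x) x =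
      ∑ i ∈ s, pd a (F i) x * ∏ j ∈ s.erase i, F j x := by
  have h := HasFDerivAt.finsetProd (u := s) (g := F) (g' := fun i => fderiv ℝ (F i) x) (x := x)
    fun i _ => (hF i).hasFDerivAt
  unfold pd
  rw [h.fderiv]
  simp only [sum_apply, smul_apply, smul_eq_mul]
  exact Finset.sum_congr rfl fun i _ => mul_comm _ _

/-- Jacobi's formula. -/
theorem pd_det {M : (Fin n → ℝ) → Matrix (Fin n) (Fin n) ℂ} (hM : MatSmooth M) (a : Fin n)
    (x : Fin n → ℝ) :
    pd a (fun x => (M x).det) x = ((M x).adjugate * mpd a M x).trace := by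
  have h1 : ∀ i, ((M x).updateCol i fun k => mpd a M x k i).det =
      ((M x).adjugate * mpd a M x) i i := by
    intro i
    rw [← Matrix.cramer_apply, Matrix.cramer_eq_adjugate_mulVec]
    rfl
  have h2 : ∀ i, ((M x).updateCol i fun k => mpd a M x k i).det =
      ∑ σ : Equiv.Perm (Fin n), (Equiv.Perm.sign σ : ℤ) •
        (mpd a M x (σ i) i * ∏ j ∈ Finset.univ.erase i, M x (σ j) j) := by
    intro i
    rw [Matrix.det_apply]
    refine Finset.sum_congr rfl fun σ _ => ?_
    rw [← Finset.mul_prod_erase _ _ (Finset.mem_univ i), Matrix.updateCol_self]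
    congr 2
    refine Finset.prod_congr rfl fun j hj => ?_
    rw [Matrix.updateCol_ne (Finset.ne_of_mem_erase hj)]
  simp only [Matrix.trace, Matrix.diag_apply, ← h1, h2]
  rw [Finset.sum_comm]
  simp only [Matrix.det_apply]
  rw [pd_sum fun σ _ => ((contDiff_prod fun i _ => hM _ _).const_smul _).diffAt x]
  refine Finset.sum_congr rfl fun σ _ => ?_
  rw [← Finset.smul_sum, ← Finset.sum_congr rfl fun i _ => by rw [mpd_apply], ←
    pd_prod (F := fun i x => M x (σ i) i) fun i => (hM _ _).diffAt x]
  have h3 := pd_const_mul a (((Equiv.Perm.sign σ : ℤ) : ℂ)) (fun x => ∏ i, M x (σ i) i) x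
  simp only [zsmul_eq_mul]
  rw [← h3]
  congr 1
  funext x
  rw [Units.smul_def, zsmul_eq_mul]

open MeasureTheory in
/-- The integral of the divergence of a periodic vector field vanishes. -/
theorem integral_divergence_eq_zero {V : Fin n → (Fin n → ℝ) → ℝ}
    (hs : ∀ a, ContDiff ℝ ∞ (V a)) (hp : ∀ a, IntPeriodic (V a)) :
    ∫ x in Set.Icc (0 : Fin n → ℝ) 1, ∑ a, pd a (V a) x = 0 := by
  cases n with
  | zero => simp
  | succ m =>
    have hint : Continuous fun x => ∑ a, pd a (V a) x :=
      continuous_finsetSum _ fun a _ => (ContDiff.pd (hs a) a).continuous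
    have h := integral_divergence_of_hasFDerivAt_off_countable' (0 : Fin (m + 1) → ℝ) 1
      zero_le_one V (fun a x => fderiv ℝ (V a) x) ∅ Set.countable_empty
      (fun a => (hs a).continuous.continuousOn)
      (fun x _ a => ((hs a).differentiable (by simp) x).hasFDerivAt)
      (hint.continuousOn.integrableOn_compact isCompact_Icc)
    refine h.trans (Finset.sum_eq_zero fun a _ => ?_)
    rw [sub_eq_zero]
    congr 1
    funext x
    -- The opposite faces of the cube differ by a unit lattice vector, so their boundary integrals
    -- cancel.
    have := hp a (a.insertNth 0 x) (Pi.single a 1)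
    refine Eq.trans ?_ this
    congr 1
    funext b
    refine Fin.succAboveCases a ?_ (fun j => ?_) b
    · simp
    · simp [Fin.succAbove_ne]

open MeasureTheory in
-- Fubini in z = x + iw: the imaginary directions contribute the volume of a unit cube, which is 1.
theorem integral_unitCell (F : (Fin n → ℝ) → ℝ) :
    ∫ z in unitCell n, F (rePart z) = ∫ x in Set.Icc (0 : Fin n → ℝ) 1, F x := by
  have h1 : MeasurePreserving (fun (z : Fin n → ℂ) (a : Fin n) =>
      Complex.measurableEquivRealProd (z a)) :=
    volume_preserving_pi fun _ => Complex.volume_preserving_equiv_real_prod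
  have h2 := volume_measurePreserving_arrowProdEquivProdArrow ℝ ℝ (Fin n)
  have h3 := h2.comp h1
  have hemb : MeasurableEmbedding ((MeasurableEquiv.arrowProdEquivProdArrow ℝ ℝ (Fin n)) ∘
      fun (z : Fin n → ℂ) (a : Fin n) => Complex.measurableEquivRealProd (z a)) :=
    (MeasurableEquiv.arrowProdEquivProdArrow ℝ ℝ (Fin n)).measurableEmbedding.comp
      (MeasurableEquiv.piCongrRight fun _ : Fin n =>
        Complex.measurableEquivRealProd).measurableEmbedding
  have h4 := h3.setIntegral_preimage_emb hemb (fun p => F p.1 * 1)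
    (Set.Icc (0 : Fin n → ℝ) 1 ×ˢ Set.Icc (0 : Fin n → ℝ) 1)
  have hset : ((MeasurableEquiv.arrowProdEquivProdArrow ℝ ℝ (Fin n)) ∘
      fun (z : Fin n → ℂ) (a : Fin n) => Complex.measurableEquivRealProd (z a)) ⁻¹'
      (Set.Icc (0 : Fin n → ℝ) 1 ×ˢ Set.Icc (0 : Fin n → ℝ) 1) = unitCell n := by
    ext z
    simp only [unitCell, Set.mem_preimage, Set.mem_prod, Set.mem_Icc, Set.mem_ofPred_eq]
    constructor
    · rintro ⟨⟨a1, a2⟩, a3, a4⟩ a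
      exact ⟨⟨a1 a, a2 a⟩, a3 a, a4 a⟩
    · intro h
      exact ⟨⟨fun a => (h a).1.1, fun a => (h a).1.2⟩, fun a => (h a).2.1, fun a => (h a).2.2⟩
  rw [hset, Measure.volume_eq_prod] at h4
  replace h4 := h4.trans (setIntegral_prod_mul F (fun _ => (1 : ℝ)) _ _)
  have h5 : ∫ _ in Set.Icc (0 : Fin n → ℝ) 1, (1 : ℝ) = 1 := by
    simp [Measure.real, Real.volume_Icc_pi]
  rw [h5, mul_one] at h4
  rw [← h4]
  simp only [mul_one]
  rfl

theorem pd_re {a : Fin n} {F : (Fin n → ℝ) → ℂ} {x : Fin n → ℝ} (hF : DifferentiableAt ℝ F x) :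
    pd a (fun x => (F x).re) x = (pd a F x).re := by
  unfold pd
  have h := Complex.reCLM.hasFDerivAt.comp x hF.hasFDerivAt
  exact congrArg (fun L : (Fin n → ℝ) →L[ℝ] ℝ => L (Pi.single a 1)) h.fderiv

namespace InvariantData

variable {g α : (Fin n → ℂ) → Matrix (Fin n) (Fin n) ℂ}
  {W A : (Fin n → ℝ) → Matrix (Fin n) (Fin n) ℂ}

theorem det_smul_inv (h : InvariantData g α W A) (x : Fin n → ℝ) :
    (W x).adjugate = (W x).det • (W x)⁻¹ := by
  rw [Matrix.inv_def, smul_smul, Ring.mul_inverse_cancel _ (h.unit x), one_smul]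

/-- The Piola identity: the cofactor matrix of a Hessian is divergence free. -/
theorem sum_pd_adjugate (h : InvariantData g α W A) (a : Fin n) (x : Fin n → ℝ) :
    ∑ d, pd d (fun x => (W x).adjugate a d) x = 0 := by
  have h1 : ∀ d, pd d (fun x => (W x).adjugate a d) x = (W x).det *
      (((W x)⁻¹ * mpd d W x).trace * (W x)⁻¹ a d -
        ((W x)⁻¹ * mpd d W x * (W x)⁻¹) a d) := by
    intro d
    have h2 : (fun x => (W x).adjugate a d) = fun x => (W x).det * (W x)⁻¹ a d := by
      funext x
      rw [h.det_smul_inv, Matrix.smul_apply, smul_eq_mul]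
    have h3 : pd d (fun x => (W x)⁻¹ a d) x = -((W x)⁻¹ * mpd d W x * (W x)⁻¹) a d :=
      congrFun (congrFun (mpd_inv h.smoothW h.unit d x) a) d
    rw [h2, pd_mul (h.smoothW.det.diffAt x) ((h.smoothInv a d).diffAt x), h3,
      pd_det h.smoothW, h.det_smul_inv, Matrix.smul_mul, Matrix.trace_smul, smul_eq_mul]
    ring
  simp only [h1, ← Finset.mul_sum, Finset.sum_sub_distrib]
  rw [mul_eq_zero, sub_eq_zero]
  right
  -- Jacobi's formula and the derivative of the inverse give two contractions of the third
  -- derivatives of v, equal after relabelling by the Hessian symmetry.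
  simp only [Matrix.trace, Matrix.diag_apply, Matrix.mul_apply, Finset.sum_mul]
  calc ∑ d, ∑ e, ∑ f, (W x)⁻¹ e f * mpd d W x f e * (W x)⁻¹ a d =
      ∑ d, ∑ f, ∑ e, (W x)⁻¹ e f * mpd d W x f e * (W x)⁻¹ a d :=
        Finset.sum_congr rfl fun d _ => Finset.sum_comm
    _ = ∑ f, ∑ e, ∑ d, (W x)⁻¹ e f * mpd d W x f e * (W x)⁻¹ a d := by
        rw [Finset.sum_comm]
        exact Finset.sum_congr rfl fun f _ => Finset.sum_comm
    _ = _ := by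
        refine Finset.sum_congr rfl fun f _ => Finset.sum_congr rfl fun e _ =>
          Finset.sum_congr rfl fun d _ => ?_
        rw [h.hessian x d f e, h.inv_symm x e f]
        ring

theorem im_det (h : InvariantData g α W A) (x : Fin n → ℝ) : ((W x).det.re : ℂ) = (W x).det := by
  have h1 : starRingEnd ℂ (W x).det = (W x).det := by
    conv_rhs => rw [← h.real x]
    exact RingHom.map_det (starRingEnd ℂ) (W x)
  exact Complex.conj_eq_iff_re.1 h1

theorem periodic_mpd (hW : IntPeriodic W) (a : Fin n) : IntPeriodic (mpd a W) := by
  intro x k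
  ext i j
  have h1 : IntPeriodic fun x => W x i j := fun x k => by simp only [hW x k]
  exact h1.pd a x k

theorem periodic_christoffelTrace (hW : IntPeriodic W) (a : Fin n) :
    IntPeriodic (christoffelTrace W a) := by
  intro x k
  simp only [christoffelTrace, hW x k, periodic_mpd hW _ x k]

/-- By the Piola identity, S det W is the divergence of -¼ times the adjugate applied to the
Christoffel trace, a periodic field, so its integral over a cell vanishes. -/
theorem averageScalarCurvature_eq_zero (h : InvariantData g α W A) (hW : IntPeriodic W) :
    averageScalarCurvature g = 0 := by
  set V : Fin n → (Fin n → ℝ) → ℂ :=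
    fun d x => -(1 / 4) * ∑ a, (W x).adjugate a d * christoffelTrace W a x with hV
  have hterm : ∀ a d, ContDiff ℝ ∞ fun x => (W x).adjugate a d * christoffelTrace W a x :=
    fun a d => (h.smoothW.adjugate a d).mul (h.contDiff_christoffelTrace a)
  have hVs : ∀ d, ContDiff ℝ ∞ (V d) := fun d =>
    contDiff_const.mul (ContDiff.sum fun a _ => hterm a d)
  have hdiv : ∀ x, ∑ d, pd d (V d) x =
      -(1 / 4) * ((W x).det * ∑ a, dy W a (christoffelTrace W a) x) := by
    intro x
    have h1 : ∀ d, pd d (V d) x = -(1 / 4) * ∑ a, (pd d (fun x => (W x).adjugate a d) x *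
        christoffelTrace W a x + (W x).adjugate a d * pd d (christoffelTrace W a) x) := by
      intro d
      rw [hV, pd_const_mul, pd_sum fun a _ => (hterm a d).diffAt x]
      congr 1
      exact Finset.sum_congr rfl fun a _ => pd_mul ((h.smoothW.adjugate a d).diffAt x)
        ((h.contDiff_christoffelTrace a).diffAt x)
    simp only [h1, ← Finset.mul_sum]
    rw [Finset.sum_comm]
    congr 1
    rw [Finset.mul_sum]
    refine Finset.sum_congr rfl fun a _ => ?_
    rw [Finset.sum_add_distrib, ← Finset.sum_mul, h.sum_pd_adjugate, zero_mul, zero_add, dy,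
      Finset.mul_sum]
    refine Finset.sum_congr rfl fun d _ => ?_
    rw [h.det_smul_inv, Matrix.smul_apply, smul_eq_mul, mul_assoc]
  have hint : ∀ z, scalarCurvature g z * (g z).det.re =
      (fun x => ∑ d, pd d (fun x => (V d x).re) x) (rePart z) := by
    intro z
    simp only [pd_re ((hVs _).diffAt _)]
    rw [← Complex.re_sum, hdiv, h.scalarCurvature_eq, h.metric, ← h.im_det,
      show (-(1 / 4) : ℂ) = ((-(1 / 4) : ℝ) : ℂ) by norm_num, Complex.re_ofReal_mul,
      Complex.re_ofReal_mul, Complex.ofReal_re]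
    ring
  have hp : ∀ d, IntPeriodic fun x => (V d x).re := by
    intro d x k
    simp only [hV, hW x k, periodic_christoffelTrace hW _ x k]
  unfold averageScalarCurvature
  simp only [hint]
  rw [integral_unitCell fun x => ∑ d, pd d (fun x => (V d x).re) x,
    integral_divergence_eq_zero (V := fun d x => (V d x).re)
      (fun d => Complex.reCLM.contDiff.comp (hVs d)) hp, zero_div]

end InvariantData

/-! ### Symplectic coordinates -/

theorem posDef_of_complex {M : Matrix (Fin n) (Fin n) ℝ}
    (hM : (M.map (fun r : ℝ => (r : ℂ))).PosDef) : M.PosDef := by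
  refine Matrix.PosDef.of_dotProduct_mulVec_pos ?_ fun x hx => ?_
  · ext i j
    have := congrFun (congrFun hM.isHermitian i) j
    simp only [Matrix.conjTranspose_apply, Matrix.map_apply] at this
    rw [Matrix.conjTranspose_apply]
    exact Complex.ofReal_injective (by simpa using this)
  · have h1 : realPoint x ≠ 0 := fun h => hx (by
      funext a
      exact Complex.ofReal_injective (congrFun h a))
    have h2 := hM.dotProduct_mulVec_pos h1
    have h3 : star (realPoint x) ⬝ᵥ (M.map (fun r : ℝ => (r : ℂ))).mulVec (realPoint x) =
        ((star x ⬝ᵥ M.mulVec x : ℝ) : ℂ) := by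
      simp [dotProduct, Matrix.mulVec, realPoint]
    rw [h3] at h2
    exact_mod_cast h2

theorem map_inv_ofReal {M : Matrix (Fin n) (Fin n) ℝ} (hM : IsUnit M.det) :
    (M⁻¹).map (fun r : ℝ => (r : ℂ)) = (M.map (fun r : ℝ => (r : ℂ)))⁻¹ := by
  symm
  refine Matrix.inv_eq_right_inv ?_
  have h := congrArg (fun N : Matrix (Fin n) (Fin n) ℝ => N.map (Complex.ofRealHom))
    (Matrix.mul_nonsing_inv _ hM)
  simp only [Matrix.map_mul] at h
  refine h.trans ?_
  exact Matrix.map_one _ (map_zero _) (map_one _)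

theorem matSmooth_hessC {v : (Fin n → ℝ) → ℝ} (hv : ContDiff ℝ ∞ v) : MatSmooth (hessC v) :=
  fun a b => Complex.ofRealCLM.contDiff.comp (ContDiff.pd (ContDiff.pd hv b) a)

theorem mpd_hessC {v : (Fin n → ℝ) → ℝ} (hv : ContDiff ℝ ∞ v) (x : Fin n → ℝ) (a b c : Fin n) :
    mpd a (hessC v) x b c = ((pd a (pd b (pd c v)) x : ℝ) : ℂ) :=
  pd_ofReal ((ContDiff.pd (ContDiff.pd hv c) b).differentiable (by simp) x)

theorem invariantData {g α : (Fin n → ℂ) → Matrix (Fin n) (Fin n) ℂ} {h : (Fin n → ℝ) → ℝ}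
    (hg : IsKahlerFormInClass g) (hα : IsHiggsTerm α) (hαT : TorusInvariant α)
    (hh : IsInvariantPotential g h) :
    InvariantData g α (hessC (convexPotential h)) (fun x => α (realPoint x)) := by
  have hv := contDiff_convexPotential hh.smooth
  have hmetric : ∀ z, g z = hessC (convexPotential h) (rePart z) := fun z => by
    ext a b
    rw [hh.potential, ddbar_localPotential hh.smooth]
  refine ⟨hmetric, hαT.eq_comp_rePart, matSmooth_hessC hv,
    fun a b => (hα.smooth a b).comp contDiff_realPoint, fun x => ?_, fun x => ?_, fun x => ?_,
    fun x a b c => ?_⟩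
  · ext a b
    simp only [hessC, Matrix.transpose_apply, Matrix.map_apply]
    rw [(hess_isSymm hv x).apply]
  · ext a b
    simp [hessC, conj]
  · have := hg.posDef (realPoint x)
    rwa [hmetric, rePart_realPoint] at this
  · rw [mpd_hessC hv, mpd_hessC hv, pd_comm (ContDiff.pd hv c)]

/-- The chain rule for `x = ∂u(y)`: differentiation in `y` is the operator `dy`. -/
theorem pd_comp_grad {u : (Fin n → ℝ) → ℝ} {W : (Fin n → ℝ) → Matrix (Fin n) (Fin n) ℂ}
    (hu : ContDiff ℝ ∞ u) (hW : ∀ y, hessC u y = (W (grad u y))⁻¹) {F : (Fin n → ℝ) → ℂ}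
    (hF : ContDiff ℝ ∞ F) (a : Fin n) :
    pd a (fun y => F (grad u y)) = fun y => dy W a F (grad u y) := by
  funext y
  have hgr := contDiff_grad hu
  have h1 := (hF.differentiable (by simp) (grad u y)).hasFDerivAt.comp y
    (hgr.differentiable (by simp) y).hasFDerivAt
  have h2 : pd a (fun y => F (grad u y)) y =
      fderiv ℝ F (grad u y) (fderiv ℝ (grad u) y (Pi.single a 1)) :=
    congrArg (fun L : (Fin n → ℝ) →L[ℝ] ℂ => L (Pi.single a 1)) h1.fderiv
  rw [h2, fderiv_grad hu, fderiv_eq_sum_pd, dy]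
  refine Finset.sum_congr rfl fun b _ => ?_
  rw [← hW, hessC, Matrix.map_apply, Complex.real_smul, Matrix.mulVec_single_one, Matrix.col_apply,
    (hess_isSymm hu y).apply]

theorem doubleDiv_comp_grad {g α : (Fin n → ℂ) → Matrix (Fin n) (Fin n) ℂ}
    {W A : (Fin n → ℝ) → Matrix (Fin n) (Fin n) ℂ} (hd : InvariantData g α W A)
    {u : (Fin n → ℝ) → ℝ} (hu : ContDiff ℝ ∞ u) (hW : ∀ y, hessC u y = (W (grad u y))⁻¹)
    {N : (Fin n → ℝ) → Matrix (Fin n) (Fin n) ℂ} (hN : MatSmooth N) (y : Fin n → ℝ) :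
    doubleDiv (fun y => N (grad u y)) y =
      ∑ e, dy W e (fun x => ∑ c, dy W c (fun x => N x c e) x) (grad u y) := by
  have hs : ∀ a b c, ContDiff ℝ ∞ (dy W c fun x => N x a b) := fun a b c =>
    hd.contDiff_dy (hN a b) c
  have h1 : ∀ a b, pd a (pd b fun y => N (grad u y) a b) y =
      dy W b (dy W a fun x => N x a b) (grad u y) := by
    intro a b
    have hNu : ContDiff ℝ ∞ fun y => N (grad u y) a b := (hN a b).comp (contDiff_grad hu)
    rw [pd_comm hNu, pd_comp_grad hu hW (hN a b) a]
    rw [pd_comp_grad hu hW (hs a b a) b]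
  unfold doubleDiv
  simp only [h1]
  rw [Finset.sum_comm]
  refine Finset.sum_congr rfl fun e _ => ?_
  rw [dy_sum W fun c _ => (hs c e c).diffAt _]

/-- Conjugation exchanges N^{ab} and N^{ba}, and mixed partials commute. Vanishing of the real part
is therefore the whole equation for a Hermitian N. -/
theorem conj_doubleDiv {N : (Fin n → ℝ) → Matrix (Fin n) (Fin n) ℂ} (hN : MatSmooth N)
    (hherm : ∀ y, (N y).transpose = conj (N y)) (y : Fin n → ℝ) :
    starRingEnd ℂ (doubleDiv N y) = doubleDiv N y := by
  have key : ∀ a b, starRingEnd ℂ (pd a (pd b fun y => N y a b) y) =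
      pd b (pd a fun y => N y b a) y := by
    intro a b
    have h1 : (fun y => N y b a) = fun y => starRingEnd ℂ (N y a b) :=
      funext fun y => congrFun (congrFun (hherm y) a) b
    have h2 : pd b (fun y => N y b a) = fun y => starRingEnd ℂ (pd b (fun y => N y a b) y) := by
      rw [h1]
      exact funext fun y => pd_conj b _ y
    rw [pd_comm (hN b a), h2, pd_conj]
  unfold doubleDiv
  simp only [map_sum, key]
  exact Finset.sum_comm

theorem doubleDiv_smul (c : ℂ) (N : (Fin n → ℝ) → Matrix (Fin n) (Fin n) ℂ) (y : Fin n → ℝ) :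
    doubleDiv (fun y => c • N y) y = c * doubleDiv N y := by
  unfold doubleDiv
  simp only [Finset.mul_sum]
  refine Finset.sum_congr rfl fun a _ => Finset.sum_congr rfl fun b _ => ?_
  have h1 : pd b (fun y => (c • N y) a b) = fun y => c * pd b (fun y => N y a b) y :=
    funext fun y => pd_const_mul b c (fun y => N y a b) y
  rw [h1, pd_const_mul]

/-! ### Compatibility and the symmetry of the quadratic differential -/

/-- The image of αᵀ is of type (0,1) and αᵀ sees only (1,0)-components, on which J acts by i; with
the i in ω this gives -1, and the antisymmetry of ω leaves the antisymmetrisation of q. -/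
theorem omega_compatibility (g α : (Fin n → ℂ) → Matrix (Fin n) (Fin n) ℂ) (z : Fin n → ℂ)
    (X Y : (Fin n → ℂ) × (Fin n → ℂ)) :
    omega g z (stdJ X) (alphaT α z Y) + omega g z (alphaT α z X) (stdJ Y) =
      ∑ a, ∑ c, X.1 a * Y.1 c *
        (quadraticDifferential g α z a c - quadraticDifferential g α z c a) := by
  have h1 : ∀ X Y : (Fin n → ℂ) × (Fin n → ℂ), omega g z (stdJ X) (alphaT α z Y) =
      -∑ a, ∑ c, X.1 a * Y.1 c * quadraticDifferential g α z c a := by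
    intro X Y
    simp only [omega, stdJ, alphaT, quadraticDifferential, Matrix.of_apply, Pi.zero_apply,
      Pi.smul_apply, smul_eq_mul, zero_mul, sub_zero, Finset.mul_sum, ← Finset.sum_neg_distrib]
    refine Finset.sum_congr rfl fun a _ => ?_
    rw [Finset.sum_comm]
    refine Finset.sum_congr rfl fun c _ => Finset.sum_congr rfl fun b _ => ?_
    linear_combination (g z a b * X.1 a * Y.1 c * α z c b) * Complex.I_mul_I
  have h2 : omega g z (alphaT α z X) (stdJ Y) = -omega g z (stdJ Y) (alphaT α z X) := by
    simp only [omega, ← mul_neg, ← Finset.sum_neg_distrib]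
    congr 1
    exact Finset.sum_congr rfl fun a _ => Finset.sum_congr rfl fun b _ => by ring
  rw [h2, h1, h1, neg_neg]
  rw [Finset.sum_comm (f := fun a c => Y.1 a * X.1 c * quadraticDifferential g α z c a),
    neg_add_eq_sub, ← Finset.sum_sub_distrib]
  refine Finset.sum_congr rfl fun a _ => ?_
  rw [← Finset.sum_sub_distrib]
  exact Finset.sum_congr rfl fun c _ => by ring

theorem compatible_iff (g α : (Fin n → ℂ) → Matrix (Fin n) (Fin n) ℂ) :
    Compatible g α ↔ ∀ z, (quadraticDifferential g α z).IsSymm := by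
  constructor
  · intro h z
    ext a c
    have h1 := h z (Pi.single c 1, 0) (Pi.single a 1, 0)
    rw [omega_compatibility] at h1
    rw [Finset.sum_eq_single c (fun b _ hb => by simp [hb]) (by simp),
      Finset.sum_eq_single a (fun b _ hb => by simp [hb]) (by simp)] at h1
    simp only [Pi.single_eq_same, one_mul] at h1
    exact sub_eq_zero.1 h1
  · intro h z X Y
    rw [omega_compatibility]
    refine Finset.sum_eq_zero fun a _ => Finset.sum_eq_zero fun c _ => ?_
    rw [(h z).apply, sub_self, mul_zero]

/-- The symplectic picture of a torus-invariant pair: `u` and `v` are Legendre dual, `W = D²v` and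
`ξ` is the quadratic differential in the coordinates `y`. -/
structure SymplecticData (g α : (Fin n → ℂ) → Matrix (Fin n) (Fin n) ℂ)
    (W A : (Fin n → ℝ) → Matrix (Fin n) (Fin n) ℂ) (u v : (Fin n → ℝ) → ℝ)
    (ξ : (Fin n → ℝ) → Matrix (Fin n) (Fin n) ℂ) : Prop extends InvariantData g α W A where
  dual : LegendreDual u v
  hessU : ∀ y, hessC u y = (W (grad u y))⁻¹
  periodicW : IntPeriodic W
  xi_eq : ∀ y, ξ y = quadDiff W A (grad u y)
  spec : ∀ x, ∀ μ ∈ spectrum ℂ (A x * conj (A x)), μ.re < 1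

namespace SymplecticData

variable {g α : (Fin n → ℂ) → Matrix (Fin n) (Fin n) ℂ}
  {W A : (Fin n → ℝ) → Matrix (Fin n) (Fin n) ℂ} {u v : (Fin n → ℝ) → ℝ}
  {ξ : (Fin n → ℝ) → Matrix (Fin n) (Fin n) ℂ}

theorem grad_grad (h : SymplecticData g α W A u v ξ) (x : Fin n → ℝ) : grad u (grad v x) = x :=
  ((h.dual.grad_iff x (grad v x)).2 rfl).symm

theorem quadraticDifferential_eq (h : SymplecticData g α W A u v ξ) (z : Fin n → ℂ) :
    quadraticDifferential g α z = quadDiff W A (rePart z) := by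
  ext a b
  simp only [quadraticDifferential, Matrix.of_apply, h.higgs, h.metric, quadDiff, Matrix.mul_apply]
  refine Finset.sum_congr rfl fun c _ => ?_
  rw [show W (rePart z) b c = W (rePart z) c b from congrFun (congrFun (h.symm _) c) b]

theorem compatible_iff_isSymm (h : SymplecticData g α W A u v ξ) :
    Compatible g α ↔ ∀ y, (ξ y).IsSymm := by
  rw [compatible_iff]
  constructor
  · intro hc y
    have := hc (realPoint (grad u y))
    rwa [h.quadraticDifferential_eq, rePart_realPoint, ← h.xi_eq] at this
  · intro hs z
    have := hs (grad v (rePart z))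
    rwa [h.xi_eq, h.grad_grad, ← h.quadraticDifferential_eq] at this

theorem complexMomentMap_eq_doubleDiv (h : SymplecticData g α W A u v ξ) (z : Fin n → ℂ) :
    complexMomentMap g α z = -(1 / 4) * doubleDiv ξ (grad v (rePart z)) := by
  have h1 : ξ = fun y => quadDiff W A (grad u y) := funext h.xi_eq
  rw [h1, doubleDiv_comp_grad (N := quadDiff W A) h.toInvariantData h.dual.smooth_left h.hessU
    (h.smoothA.mul h.smoothW), h.grad_grad, h.complexMomentMap_eq]
  rfl

theorem complexMomentMap_iff (h : SymplecticData g α W A u v ξ) :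
    (∀ z, complexMomentMap g α z = 0) ↔ ComplexEquation ξ := by
  simp only [h.complexMomentMap_eq_doubleDiv]
  constructor
  · intro hz y
    have := hz (realPoint (grad u y))
    rw [rePart_realPoint, ← (h.dual.grad_iff _ y).1 rfl] at this
    simpa using this
  · intro hy z
    rw [hy, mul_zero]

theorem compatibleData (h : SymplecticData g α W A u v ξ) (hc : Compatible g α) :
    CompatibleData g α W A where
  toInvariantData := h.toInvariantData
  compat x := by
    have := (compatible_iff g α).1 hc (realPoint x)
    rwa [h.quadraticDifferential_eq, rePart_realPoint] at this
  spec := h.spec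

theorem inv_hessU (h : SymplecticData g α W A u v ξ) (y : Fin n → ℝ) :
    (hessC u y)⁻¹ = W (grad u y) := by
  rw [h.hessU, Matrix.nonsing_inv_nonsing_inv _ (h.unit _)]

theorem xiSq_eq (h : SymplecticData g α W A u v ξ) (hc : Compatible g α) (y : Fin n → ℝ) :
    xiSq u ξ y = A (grad u y) * conj (A (grad u y)) := by
  rw [xiSq, h.xi_eq, h.hessU, (h.compatibleData hc).higgs_mul_conj]

theorem realMatrix_eq (h : SymplecticData g α W A u v ξ) (hc : Compatible g α) :
    (fun η => -(1 / 2 : ℂ) • (hessC u η)⁻¹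
      + spectralFun psi (xiSq u ξ η) * ξ η * hessC u η * conj (ξ η)) =
      fun y => momentMatrix W A (grad u y) := by
  funext y
  rw [h.inv_hessU, h.xiSq_eq hc, h.xi_eq, h.hessU]
  rfl

/-- The curvature computation yields only a real part; Hermitian symmetry of the moment matrix
upgrades it to the full complex double divergence, and Ŝ drops out. -/
theorem realMomentMap_eq_doubleDiv (h : SymplecticData g α W A u v ξ) (hc : Compatible g α)
    (z : Fin n → ℂ) :
    ((realMomentMap g α z : ℝ) : ℂ) =
      doubleDiv (fun y => momentMatrix W A (grad u y)) (grad v (rePart z)) := by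
  have hcd := h.compatibleData hc
  have hM : MatSmooth fun y => momentMatrix W A (grad u y) := fun a b =>
    (hcd.smooth_momentMatrix a b).comp (contDiff_grad h.dual.smooth_left)
  have h1 := Complex.conj_eq_iff_re.1
    (conj_doubleDiv hM (fun y => hcd.momentMatrix_transpose _) (grad v (rePart z)))
  rw [← h1, hcd.realMomentMap_eq, h.averageScalarCurvature_eq_zero h.periodicW, mul_zero, zero_add,
    doubleDiv_comp_grad h.toInvariantData h.dual.smooth_left h.hessU hcd.smooth_momentMatrix,
    h.grad_grad]

theorem realMomentMap_iff (h : SymplecticData g α W A u v ξ) (hc : Compatible g α) :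
    (∀ z, realMomentMap g α z = 0) ↔ RealEquation u ξ := by
  unfold RealEquation
  rw [h.realMatrix_eq hc]
  constructor
  · intro hz y
    have h1 := h.realMomentMap_eq_doubleDiv hc (realPoint (grad u y))
    rwa [rePart_realPoint, ← (h.dual.grad_iff _ y).1 rfl, hz, Complex.ofReal_zero, eq_comm] at h1
  · intro hy z
    have h1 := h.realMomentMap_eq_doubleDiv hc z
    rwa [hy, Complex.ofReal_eq_zero] at h1

/-- The two matrices under the double divergence differ only by the factor -½. -/
theorem realEquation_iff_abreuEquation (h : SymplecticData g α W A u v ξ)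
    (hc : Compatible g α) : RealEquation u ξ ↔ AbreuEquation u ξ := by
  unfold RealEquation AbreuEquation
  rw [h.realMatrix_eq hc]
  have h1 : (fun y => momentMatrix W A (grad u y)) = fun η => -(1 / 2 : ℂ) •
      (spectralFun Real.sqrt (1 - xiSq u ξ η) * (hessC u η)⁻¹) := by
    funext y
    rw [(h.compatibleData hc).momentMatrix_eq, h.xiSq_eq hc, h.inv_hessU]
  rw [h1]
  simp only [doubleDiv_smul]
  simp

theorem hcscKSystem_iff (h : SymplecticData g α W A u v ξ) :
    HcscKSystem g α ↔ (∀ y, (ξ y).IsSymm) ∧ ComplexEquation ξ ∧ RealEquation u ξ := by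
  rw [← h.compatible_iff_isSymm, ← h.complexMomentMap_iff]
  constructor
  · rintro ⟨h1, h2, h3⟩
    exact ⟨h1, h2, (h.realMomentMap_iff h1).1 h3⟩
  · rintro ⟨h1, h2, h3⟩
    exact ⟨h1, h2, (h.realMomentMap_iff h1).2 h3⟩

/-- The inverse of a map commuting with integer translations commutes with them too. -/
theorem grad_add_int (h : SymplecticData g α W A u v ξ)
    (hv : ∀ (x : Fin n → ℝ) (k : Fin n → ℤ), grad v (fun a => x a + k a) =
      fun a => grad v x a + k a) (y : Fin n → ℝ) (k : Fin n → ℤ) :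
    grad u (fun a => y a + k a) = fun a => grad u y a + k a := by
  symm
  rw [h.dual.grad_iff, hv, ← (h.dual.grad_iff _ y).1 rfl]

end SymplecticData

theorem symplecticData {g α : (Fin n → ℂ) → Matrix (Fin n) (Fin n) ℂ} {h : (Fin n → ℝ) → ℝ}
    (hg : IsKahlerFormInClass g) (hα : IsHiggsTerm α) (hαT : TorusInvariant α)
    (hspec : ∀ z, ∀ μ ∈ spectrum ℂ (α z * conj (α z)), μ.re < 1)
    (hh : IsInvariantPotential g h) :
    SymplecticData g α (hessC (convexPotential h)) (fun x => α (realPoint x))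
      (legendre (convexPotential h)) (convexPotential h)
      (xi g α (legendre (convexPotential h))) := by
  have hd := invariantData hg hα hαT hh
  have hpos : ∀ x, (hess (convexPotential h) x).PosDef := fun x => posDef_of_complex (hd.posDef x)
  obtain ⟨hdual, hhess⟩ := legendre_properties hh.smooth hh.periodic hpos
  refine ⟨hd, hdual, fun y => ?_, fun x k => ?_, fun y => ?_, fun x => hspec _⟩
  · rw [hessC, hhess, map_inv_ofReal (hpos _).det_pos.ne'.isUnit]
    rfl
  · ext a b
    have h1 := (hh.periodic.pd b).pd a x k
    simp only [hessC, Matrix.map_apply, hess_convexPotential hh.smooth, h1]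
  · ext a b
    simp only [xi, quadraticDifferential, Matrix.of_apply, quadDiff, Matrix.mul_apply, hd.metric,
      rePart_realPoint]
    refine Finset.sum_congr rfl fun c _ => ?_
    rw [show hessC (convexPotential h) (grad (legendre (convexPotential h)) y) b c =
      hessC (convexPotential h) (grad (legendre (convexPotential h)) y) c b from
      congrFun (congrFun (hd.symm _) c) b]

end

end HcscK

theorem mainTheorem5 (n : ℕ) (g α : (Fin n → ℂ) → Matrix (Fin n) (Fin n) ℂ)
    (hg : IsKahlerFormInClass g) (hgT : TorusInvariant g)
    (hα : IsHiggsTerm α) (hαT : TorusInvariant α)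
    (hspec : ∀ z, ∀ μ ∈ spectrum ℂ (α z * HcscK.conj (α z)), μ.re < 1) :
    (∃ h, IsInvariantPotential g h) ∧
    ∀ h v u ξ, IsInvariantPotential g h → v = convexPotential h → u = legendre v →
      ξ = xi g α u →
      -- the symplectic coordinates and the tensors in these coordinates
      ((∀ z, g z = hessC v (rePart z)) ∧ LegendreDual u v ∧
        (∀ y, (hess u y).PosDef) ∧ IntPeriodic (hess u) ∧
        (∀ a b, ContDiff ℝ ∞ (fun y => ξ y a b)) ∧ IntPeriodic ξ ∧
        (∀ z, α z = ξ (grad v (rePart z)) * hessC u (grad v (rePart z)))) ∧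
      -- the three equations of the system, one by one
      (Compatible g α ↔ ∀ y, (ξ y).IsSymm) ∧
      (Compatible g α →
        ((∀ z, complexMomentMap g α z = 0) ↔ ComplexEquation ξ) ∧
        ((∀ z, realMomentMap g α z = 0) ↔ RealEquation u ξ) ∧
        (RealEquation u ξ ↔ AbreuEquation u ξ)) ∧
      -- the whole system
      (HcscKSystem g α ↔ (∀ y, (ξ y).IsSymm) ∧ ComplexEquation ξ ∧ RealEquation u ξ) ∧
      (HcscKSystem g α ↔ (∀ y, (ξ y).IsSymm) ∧ ComplexEquation ξ ∧ AbreuEquation u ξ) := by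
  refine ⟨exists_invariantPotential hg hgT, ?_⟩
  rintro h v u ξ hh rfl rfl rfl
  have hs := symplecticData hg hα hαT hspec hh
  have hpos : ∀ x, (hess (convexPotential h) x).PosDef := fun x => posDef_of_complex (hs.posDef x)
  have hhess := (legendre_properties hh.smooth hh.periodic hpos).2
  have hgrad := hs.grad_add_int (grad_convexPotential_add_int hh.smooth hh.periodic)
  -- Only the real lattice directions matter here, so the imaginary translation is taken to be 0.
  have hquad : IntPeriodic (quadDiff (hessC (convexPotential h)) fun x => α (realPoint x)) := by
    intro x k
    have h1 := hα.periodic (realPoint x) k 0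
    have h2 : realPoint (fun a => x a + (k a : ℝ)) =
        fun a => realPoint x a + (k a : ℂ) + Complex.I * ((0 : Fin n → ℤ) a : ℂ) := by
      funext a
      simp [realPoint]
    simp only [quadDiff, hs.periodicW x k, h2, h1]
  refine ⟨⟨hs.metric, hs.dual, fun y => ?_, fun y k => ?_, fun a b => ?_, fun y k => ?_,
    fun z => ?_⟩, hs.compatible_iff_isSymm, fun hc => ⟨hs.complexMomentMap_iff,
    hs.realMomentMap_iff hc, hs.realEquation_iff_abreuEquation hc⟩, hs.hcscKSystem_iff, ?_⟩
  · rw [hhess]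
    exact (hpos _).inv
  · ext a b
    apply Complex.ofReal_injective
    have h1 := hs.hessU fun a => y a + k a
    rw [hgrad, hs.periodicW, ← hs.hessU] at h1
    exact congrFun (congrFun h1 a) b
  · simp only [hs.xi_eq]
    exact ((hs.smoothA.mul hs.smoothW) a b).comp (contDiff_grad hs.dual.smooth_left)
  · rw [hs.xi_eq, hs.xi_eq, hgrad, hquad]
  · rw [hs.xi_eq, hs.hessU, hs.grad_grad, quadDiff, mul_assoc, Matrix.mul_nonsing_inv _ (hs.unit _),
      mul_one]
    exact hs.higgs z
  -- Symmetry of ξ is turned back into compatibility, since the two real equations are compared only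
  -- under it.
  · rw [hs.hcscKSystem_iff, ← hs.compatible_iff_isSymm]
    constructor
    · rintro ⟨h1, h2, h3⟩
      exact ⟨h1, h2, (hs.realEquation_iff_abreuEquation h1).1 h3⟩
    · rintro ⟨h1, h2, h3⟩
      exact ⟨h1, h2, (hs.realEquation_iff_abreuEquation h1).2 h3⟩
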